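/- Let $\Gamma$ be a finitely generated discrete group, let $G$ be a compact connected Lie group, and let $M$ be a closed smooth manifold with a smooth locally free action of $G$ (all isotropy groups are finite). Let $R$ be a commutative ring and let $\varphi$ be a multiplicative orbifold invariant with values in $R$. That is, $\varphi$ assigns an element of $R$ to each Lie groupoid that is Morita equivalent to a translation groupoid $N\rtimes K$, where $K$ is a compact Lie group acting smoothly and locally freely on a closed manifold $N$ (whose components may have different dimensions). The value $\varphi(\mathcal G)$ depends only on the Morita equivalence class of $\mathcal G$, and $\varphi(\mathcal G\times\mathcal H)=\varphi(\mathcal G)\varphi(\mathcal H)$. In all formulas below a term $\varphi(\mathcal G)$ is read as $0$ when $\mathcal G$ is the empty groupoid. *Notation.* For a homomorphism $\theta$ from a group into $K$, where $K$ acts on $N$, let $N^{\langle\theta\rangle}$ be the fixed point set of the image of $\theta$ and $C_K(\theta)$ the centralizer of that image. Put $$\varphi_\Gamma(N\rtimes K)=\sum_{(\theta)\in \mathrm{HOM}(\Gamma,K)/K}\varphi\bigl(N^{\langle\theta\rangle}\rtimes C_K(\theta)\bigr).$$ For a Lie group $A$ acting on $N$, the wreath product $A(\mathcal S_n)=A^n\rtimes\mathcal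 S_n$, with $(g,s)(h,t)=\bigl((g_ih_{s^{-1}(i)})_i,st\bigr)$, acts on $N^n$ by $(g,s)(x_i)_i=(g_ix_{s^{-1}(i)})_i$. For a finite $\Gamma$-set $X$ of order $n$ put $$\varphi_{[X]}(M\rtimes G)=\sum_{(\theta)}\varphi\bigl((M^n)^{\langle\theta\rangle}\rtimes C_{G(\mathcal S_n)}(\theta)\bigr),$$ where $(\theta)$ runs over the classes in $\mathrm{HOM}(\Gamma,G(\mathcal S_n))/G(\mathcal S_n)$ whose image in $\mathrm{HOM}(\Gamma,\mathcal S_n)/\mathcal S_n$ corresponds to the isomorphism class of $X$. Let $r(\Gamma/H)$ be the disjoint union of $r$ copies of the $\Gamma$-set $\Gamma/H$. For a subgroup $H\le\Gamma$ of finite index, $N_\Gamma(H)\times G$ acts on $\mathrm{HOM}(H,G)$ by $(\rho(u,g))(h)=g^{-1}\rho(uhu^{-1})g$. For $\rho\in \mathrm{HOM}(H,G)$ with isotropy group $T_\rho$, let $\mathrm{Aut}^{P_\rho}_{\Gamma\text{-}G}=H\backslash T_\rho$, where $H$ is embedded in $T_\rho$ by $h\mapsto(h,\rho(h))$. This is the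 automorphism group of the $\Gamma$-$G$-principal bundle $P_\rho=\Gamma\times_\rho G\to\Gamma/H$, and it acts on $M^{\langle\rho\rangle}$ by $H(u,g)\,x=gx$. **Theorem.** For every $n$, the sum defining $\varphi_\Gamma(M^n\rtimes G(\mathcal S_n))$ has only finitely many nonzero terms (hence so do the sums defining $\varphi_{[X]}(M\rtimes G)$), and in $R[[q]]$ $$\sum_{n\ge0}q^n\,\varphi_\Gamma\bigl(M^n\rtimes G(\mathcal S_n)\bigr)=\prod_{(H)}\Bigl(\sum_{r\ge0}q^{r|\Gamma/H|}\,\varphi_{r(\Gamma/H)}(M\rtimes G)\Bigr),$$ where $(H)$ runs over the conjugacy classes of subgroups of $\Gamma$ of finite index. Moreover, for every subgroup $H\le\Gamma$ of finite index, $$\sum_{n\ge0}q^n\,\varphi_{n(\Gamma/H)}(M\rtimes G)=\prod_{[\rho]}\ \sum_{r\ge0}q^r\,\varphi\Bigl((M^{\langle\rho\rangle})^r\rtimes \mathrm{Aut}^{P_\rho}_{\Gamma\text{-}G}(\mathcal S_r)\Bigr),$$ where $[\rho]$ runs over $\mathrm{HOM}(H,G)/(N_\Gamma(H)\times G)$.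 Both infinite products converge unconditionally, coefficient by coefficient ($R$ being discrete). -/

import Mathlib

open scoped Manifold ContDiff Topology PowerSeries.WithPiTopology
open Diffeology

universe u v w

/-! ## Smooth spaces

Smooth manifolds, their subspaces, products and quotients are handled inside the category of
diffeological spaces, which contains the category of smooth manifolds as a full subcategory. -/

namespace Diffeology

/-- A smooth map into an open set `s` which is the identity near a given point of `s`. -/
theorem exists_smooth_retraction {n : ℕ} {s : Set (EuclideanSpace ℝ (Fin n))} (hs : IsOpen s)
    {x : EuclideanSpace ℝ (Fin n)} (hx : x ∈ s) :
    ∃ f : EuclideanSpace ℝ (Fin n) → EuclideanSpace ℝ (Fin n),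
      ContDiff ℝ ∞ f ∧ (∀ y, f y ∈ s) ∧ ∀ᶠ y in 𝓝 x, f y = y := by
  obtain ⟨ε, hε, hb⟩ := Metric.isOpen_iff.mp hs x hx
  let b : ContDiffBump x := ⟨ε / 3, ε / 2, by positivity, by linarith⟩
  refine ⟨fun y ↦ x + b y • (y - x), ?_, ?_, ?_⟩
  · exact contDiff_const.add (b.contDiff.smul (contDiff_id.sub contDiff_const))
  · intro y
    apply hb
    rw [Metric.mem_ball, dist_eq_norm, add_sub_cancel_left, norm_smul]
    by_cases hy : dist y x < ε / 2
    · have h1 : ‖b y‖ ≤ 1 := by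
        rw [Real.norm_of_nonneg b.nonneg]; exact b.le_one
      have h2 : ‖y - x‖ < ε / 2 := by rwa [← dist_eq_norm]
      nlinarith [norm_nonneg (y - x), norm_nonneg (b y)]
    · rw [b.zero_of_le_dist (not_lt.mp hy)]
      simpa using hε
  · filter_upwards [b.eventuallyEq_one] with y hy
    simp [hy]

section Constructions

variable {X : Type*} {Y : Type*}

/-- The diffeology induced by a map: the plots of `X` are the maps whose composite with `f` is a
plot of `Y`. For an inclusion this is the subspace diffeology. -/
@[reducible]
def inducedDiffeology [DiffeologicalSpace Y] (f : X → Y) : DiffeologicalSpace X where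
  plots n := {p | IsPlot (f ∘ p)}
  constant_plots x := isPlot_const (x := f x)
  plot_reparam hp hf := isPlot_reparam (X := Y) hp hf
  locality {n p} hp := DiffeologicalSpace.locality (X := Y) fun x ↦ by
    obtain ⟨s, hs, hxs, h⟩ := hp x
    exact ⟨s, hs, hxs, fun hf hf' ↦ h hf hf'⟩

instance instDiffeologySubtype [DiffeologicalSpace X] (P : X → Prop) :
    DiffeologicalSpace {x // P x} :=
  inducedDiffeology Subtype.val

instance instDiffeologyProd [DiffeologicalSpace X] [DiffeologicalSpace Y] :
    DiffeologicalSpace (X × Y) where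
  plots n := {p | IsPlot (fun t ↦ (p t).1) ∧ IsPlot (fun t ↦ (p t).2)}
  constant_plots x := ⟨isPlot_const, isPlot_const⟩
  plot_reparam hp hf := ⟨isPlot_reparam hp.1 hf, isPlot_reparam hp.2 hf⟩
  locality {n p} hp := by
    refine ⟨DiffeologicalSpace.locality (X := X) fun x ↦ ?_,
      DiffeologicalSpace.locality (X := Y) fun x ↦ ?_⟩
    all_goals obtain ⟨s, hs, hxs, h⟩ := hp x
    · exact ⟨s, hs, hxs, fun hf hf' ↦ (h hf hf').1⟩
    · exact ⟨s, hs, hxs, fun hf hf' ↦ (h hf hf').2⟩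

instance instDiffeologyPi {ι : Type*} [DiffeologicalSpace X] : DiffeologicalSpace (ι → X) where
  plots n := {p | ∀ i, IsPlot (fun t ↦ p t i)}
  constant_plots x := fun _ ↦ isPlot_const
  plot_reparam hp hf := fun i ↦ isPlot_reparam (hp i) hf
  locality {n p} hp := fun i ↦ DiffeologicalSpace.locality (X := X) fun x ↦ by
    obtain ⟨s, hs, hxs, h⟩ := hp x
    exact ⟨s, hs, hxs, fun hf hf' ↦ h hf hf' i⟩

/-- The diffeology of a discrete space: plots are the locally constant maps. -/
@[reducible]
def discreteDiffeology (X : Type*) : DiffeologicalSpace X where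
  plots n := {p | IsLocallyConstant p}
  constant_plots x := IsLocallyConstant.const x
  plot_reparam hp hf := hp.comp_continuous hf.continuous
  locality {n p} hp := by
    refine (IsLocallyConstant.iff_eventually_eq p).2 fun x ↦ ?_
    obtain ⟨s, hs, hxs, h⟩ := hp x
    obtain ⟨f, hf, hfs, hfx⟩ := exists_smooth_retraction hs hxs
    have h1 := (IsLocallyConstant.iff_eventually_eq _).1 (h hfs hf) x
    filter_upwards [h1, hfx] with y hy hy'
    simpa [hy', hfx.self_of_nhds] using hy

/-- The quotient diffeology along a surjection: plots are the maps that locally lift to plots. -/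
@[reducible]
def quotientDiffeology [DiffeologicalSpace X] (π : X → Y) (hπ : Function.Surjective π) :
    DiffeologicalSpace Y where
  plots n := {p | ∀ x, ∃ q : EuclideanSpace ℝ (Fin n) → X, IsPlot q ∧ ∀ᶠ y in 𝓝 x, p y = π (q y)}
  constant_plots y := fun _ ↦ by
    obtain ⟨x, rfl⟩ := hπ y
    exact ⟨fun _ ↦ x, isPlot_const, by simp⟩
  plot_reparam {n m p f} hp hf := fun x ↦ by
    obtain ⟨q, hq, h⟩ := hp (f x)
    exact ⟨q ∘ f, isPlot_reparam hq hf, hf.continuous.continuousAt.eventually h⟩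
  locality {n p} hp := fun x ↦ by
    obtain ⟨s, hs, hxs, h⟩ := hp x
    obtain ⟨f, hf, hfs, hfx⟩ := exists_smooth_retraction hs hxs
    obtain ⟨q, hq, h'⟩ := h hfs hf x
    refine ⟨q, hq, ?_⟩
    filter_upwards [h', hfx] with y hy hy'
    rw [← hy, Function.comp_apply, hy']

/-- The diffeology of a smooth manifold (without boundary) modelled on `E`: plots are the smooth
maps. -/
@[reducible]
def manifoldDiffeology (E : Type*) [NormedAddCommGroup E] [NormedSpace ℝ E]
    (M : Type*) [TopologicalSpace M] [ChartedSpace E M] : DiffeologicalSpace M where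
  plots n := {p | ContMDiff 𝓘(ℝ, EuclideanSpace ℝ (Fin n)) 𝓘(ℝ, E) ∞ p}
  constant_plots x := contMDiff_const
  plot_reparam hp hf := hp.comp hf.contMDiff
  locality {n p} hp := fun x ↦ by
    obtain ⟨s, hs, hxs, h⟩ := hp x
    obtain ⟨f, hf, hfs, hfx⟩ := exists_smooth_retraction hs hxs
    refine (h hfs hf x).congr_of_eventuallyEq ?_
    filter_upwards [hfx] with y hy
    simp [hy]

end Constructions

/-- `f` is a diffeomorphism. -/
def IsDiffeomorphism {X Y : Type*} [DiffeologicalSpace X] [DiffeologicalSpace Y] (f : X → Y) :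
    Prop :=
  DSmooth f ∧ ∃ g : Y → X, DSmooth g ∧ Function.LeftInverse g f ∧ Function.RightInverse g f

/-- The diffeological space `X` is a smooth manifold: Hausdorff, second countable, and locally
diffeomorphic to open subsets of Euclidean spaces. As usual for fixed point sets of group actions,
different components may have different dimensions. -/
structure IsSmoothManifold (X : Type*) [DiffeologicalSpace X] : Prop where
  t2 : @T2Space X dTopology
  secondCountable : @SecondCountableTopology X dTopology
  chart : ∀ x : X, ∃ s : Set X, IsOpen[dTopology] s ∧ x ∈ s ∧
    ∃ (n : ℕ) (t : Set (EuclideanSpace ℝ (Fin n))), IsOpen t ∧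
      ∃ f : {y // y ∈ s} → {z // z ∈ t}, IsDiffeomorphism f

/-- The smooth map `f` is a submersion: there is a smooth local section through every point of the
source (for manifolds, this is equivalent to surjectivity of the differential). -/
def IsSubmersion {X Y : Type*} [DiffeologicalSpace X] [DiffeologicalSpace Y] (f : X → Y) : Prop :=
  DSmooth f ∧ ∀ x : X, ∃ (t : Set Y) (_ : IsOpen[dTopology] t) (hx : f x ∈ t)
    (σ : {y // y ∈ t} → X), DSmooth σ ∧ (∀ y, f (σ y) = y.1) ∧ σ ⟨f x, hx⟩ = x

end Diffeology

/-! ## Groupoids and Morita equivalence -/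

/-- A groupoid internal to diffeological spaces. The composite `mul ⟨(a, b), h⟩` means
"`a` after `b`". -/
structure DiffGroupoid : Type (u + 1) where
  Obj : Type u
  Arr : Type u
  [diffObj : DiffeologicalSpace Obj]
  [diffArr : DiffeologicalSpace Arr]
  src : Arr → Obj
  tgt : Arr → Obj
  one : Obj → Arr
  inv : Arr → Arr
  mul : {p : Arr × Arr // src p.1 = tgt p.2} → Arr
  src_one : ∀ x, src (one x) = x
  tgt_one : ∀ x, tgt (one x) = x
  src_inv : ∀ a, src (inv a) = tgt a
  tgt_inv : ∀ a, tgt (inv a) = src a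
  src_mul : ∀ p, src (mul p) = src p.1.2
  tgt_mul : ∀ p, tgt (mul p) = tgt p.1.1
  one_mul : ∀ a, mul ⟨(one (tgt a), a), src_one _⟩ = a
  mul_one : ∀ a, mul ⟨(a, one (src a)), (tgt_one _).symm⟩ = a
  inv_mul : ∀ a, mul ⟨(inv a, a), src_inv a⟩ = one (src a)
  mul_inv : ∀ a, mul ⟨(a, inv a), (tgt_inv a).symm⟩ = one (tgt a)
  mul_assoc : ∀ (a b c : Arr) (hab : src a = tgt b) (hbc : src b = tgt c),
    mul ⟨(mul ⟨(a, b), hab⟩, c), (src_mul _).trans hbc⟩ =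
      mul ⟨(a, mul ⟨(b, c), hbc⟩), hab.trans (tgt_mul ⟨(b, c), hbc⟩).symm⟩
  smooth_src : DSmooth src
  smooth_tgt : DSmooth tgt
  smooth_one : DSmooth one
  smooth_inv : DSmooth inv
  smooth_mul : DSmooth mul

attribute [instance] DiffGroupoid.diffObj DiffGroupoid.diffArr

namespace DiffGroupoid

/-- Lie groupoids: objects and arrows form smooth manifolds, source and target are submersions. -/
structure IsLie (A : DiffGroupoid.{u}) : Prop where
  obj : IsSmoothManifold A.Obj
  arr : IsSmoothManifold A.Arr
  src_submersion : IsSubmersion A.src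
  tgt_submersion : IsSubmersion A.tgt

/-- The product groupoid. -/
def prod (A B : DiffGroupoid.{u}) : DiffGroupoid.{u} where
  Obj := A.Obj × B.Obj
  Arr := A.Arr × B.Arr
  diffObj := instDiffeologyProd
  diffArr := instDiffeologyProd
  src a := (A.src a.1, B.src a.2)
  tgt a := (A.tgt a.1, B.tgt a.2)
  one x := (A.one x.1, B.one x.2)
  inv a := (A.inv a.1, B.inv a.2)
  mul p := (A.mul ⟨(p.1.1.1, p.1.2.1), congrArg Prod.fst p.2⟩,
    B.mul ⟨(p.1.1.2, p.1.2.2), congrArg Prod.snd p.2⟩)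
  src_one x := by simp only [src_one]
  tgt_one x := by simp only [tgt_one]
  src_inv a := by simp only [src_inv]
  tgt_inv a := by simp only [tgt_inv]
  src_mul p := by simp only [src_mul]
  tgt_mul p := by simp only [tgt_mul]
  one_mul a := by simp only [one_mul]
  mul_one a := by simp only [mul_one]
  inv_mul a := by simp only [inv_mul]
  mul_inv a := by simp only [mul_inv]
  mul_assoc a b c hab hbc := by
    ext
    · exact A.mul_assoc _ _ _ _ _
    · exact B.mul_assoc _ _ _ _ _
  smooth_src := fun n p hp ↦ ⟨A.smooth_src n _ hp.1, B.smooth_src n _ hp.2⟩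
  smooth_tgt := fun n p hp ↦ ⟨A.smooth_tgt n _ hp.1, B.smooth_tgt n _ hp.2⟩
  smooth_one := fun n p hp ↦ ⟨A.smooth_one n _ hp.1, B.smooth_one n _ hp.2⟩
  smooth_inv := fun n p hp ↦ ⟨A.smooth_inv n _ hp.1, B.smooth_inv n _ hp.2⟩
  smooth_mul := fun n p hp ↦
    ⟨A.smooth_mul n (fun t ↦ ⟨((p t).1.1.1, (p t).1.2.1), congrArg Prod.fst (p t).2⟩)
        ⟨hp.1.1, hp.2.1⟩,
      B.smooth_mul n (fun t ↦ ⟨((p t).1.1.2, (p t).1.2.2), congrArg Prod.snd (p t).2⟩)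
        ⟨hp.1.2, hp.2.2⟩⟩

/-- Smooth functors. -/
structure Morphism (A B : DiffGroupoid.{u}) where
  obj : A.Obj → B.Obj
  arr : A.Arr → B.Arr
  smooth_obj : DSmooth obj
  smooth_arr : DSmooth arr
  src_arr : ∀ a, B.src (arr a) = obj (A.src a)
  tgt_arr : ∀ a, B.tgt (arr a) = obj (A.tgt a)
  arr_one : ∀ x, arr (A.one x) = B.one (obj x)
  arr_mul : ∀ p : {p : A.Arr × A.Arr // A.src p.1 = A.tgt p.2}, arr (A.mul p) =
    B.mul ⟨(arr p.1.1, arr p.1.2), by rw [src_arr, tgt_arr, p.2]⟩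

/-- Essential (weak) equivalences of Lie groupoids: `(b, x) ↦ tgt b` is a surjective submersion
`B.Arr ×_{B.Obj} A.Obj → B.Obj`, and `A.Arr` is the fibre product of
`A.Obj × A.Obj → B.Obj × B.Obj ← B.Arr`. -/
structure Morphism.IsEssentialEquivalence {A B : DiffGroupoid.{u}} (F : Morphism A B) : Prop where
  submersion : IsSubmersion
    (fun p : {p : B.Arr × A.Obj // B.src p.1 = F.obj p.2} ↦ B.tgt p.1.1)
  surjective : Function.Surjective
    (fun p : {p : B.Arr × A.Obj // B.src p.1 = F.obj p.2} ↦ B.tgt p.1.1)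
  fullyFaithful : IsDiffeomorphism
    (fun a : A.Arr ↦ (⟨((A.src a, A.tgt a), F.arr a), F.src_arr a, F.tgt_arr a⟩ :
      {q : (A.Obj × A.Obj) × B.Arr // B.src q.2 = F.obj q.1.1 ∧ B.tgt q.2 = F.obj q.1.2}))

/-- Morita equivalence of Lie groupoids. -/
def MoritaEquivalent (A B : DiffGroupoid.{u}) : Prop :=
  ∃ C : DiffGroupoid.{u}, C.IsLie ∧ ∃ (F : Morphism C A) (F' : Morphism C B),
    F.IsEssentialEquivalence ∧ F'.IsEssentialEquivalence

end DiffGroupoid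

/-! ## Smooth group actions and translation groupoids -/

/-- Groups with smooth operations (Lie groups, if the underlying space is a manifold). -/
class DiffGroup (K : Type*) [Group K] [DiffeologicalSpace K] : Prop where
  smooth_mul : DSmooth (fun p : K × K ↦ p.1 * p.2)
  smooth_inv : DSmooth (fun k : K ↦ k⁻¹)

/-- Smooth actions. -/
class DiffAction (K : Type*) (N : Type*) [Group K] [DiffeologicalSpace K] [DiffeologicalSpace N]
    [MulAction K N] : Prop where
  smooth_smul : DSmooth (fun p : K × N ↦ p.1 • p.2)

section SmoothLemmas

variable {K : Type*} [Group K] [DiffeologicalSpace K] {N : Type*} [DiffeologicalSpace N]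
  {n : ℕ}

theorem isPlot_mul [DiffGroup K] {p q : EuclideanSpace ℝ (Fin n) → K} (hp : IsPlot p)
    (hq : IsPlot q) : IsPlot (fun t ↦ p t * q t) :=
  DiffGroup.smooth_mul n (fun t ↦ (p t, q t)) ⟨hp, hq⟩

theorem isPlot_inv [DiffGroup K] {p : EuclideanSpace ℝ (Fin n) → K} (hp : IsPlot p) :
    IsPlot (fun t ↦ (p t)⁻¹) :=
  DiffGroup.smooth_inv n p hp

theorem isPlot_smul [MulAction K N] [DiffAction K N] {p : EuclideanSpace ℝ (Fin n) → K}
    {q : EuclideanSpace ℝ (Fin n) → N} (hp : IsPlot p) (hq : IsPlot q) :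
    IsPlot (fun t ↦ p t • q t) :=
  DiffAction.smooth_smul n (fun t ↦ (p t, q t)) ⟨hp, hq⟩

/-- A Lie group is a group with smooth operations in the diffeological sense. -/
theorem diffGroup_of_lieGroup (F : Type*) [NormedAddCommGroup F] [NormedSpace ℝ F] (G : Type*)
    [Group G] [TopologicalSpace G] [ChartedSpace F G] [LieGroup 𝓘(ℝ, F) ∞ G] :
    letI := manifoldDiffeology F G
    DiffGroup G :=
  letI := manifoldDiffeology F G
  { smooth_mul := fun n _ hp ↦
      show ContMDiff 𝓘(ℝ, EuclideanSpace ℝ (Fin n)) 𝓘(ℝ, F) ∞ _ from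
        ContMDiff.mul (I := 𝓘(ℝ, F)) hp.1 hp.2
    smooth_inv := fun n _ hp ↦
      show ContMDiff 𝓘(ℝ, EuclideanSpace ℝ (Fin n)) 𝓘(ℝ, F) ∞ _ from
        ContMDiff.inv (I := 𝓘(ℝ, F)) hp }

/-- A smooth action on a manifold is smooth in the diffeological sense. -/
theorem diffAction_of_contMDiffSMul (F : Type*) [NormedAddCommGroup F] [NormedSpace ℝ F]
    (E : Type*) [NormedAddCommGroup E] [NormedSpace ℝ E] (G : Type*) [Group G]
    [TopologicalSpace G] [ChartedSpace F G] (M : Type*) [TopologicalSpace M] [ChartedSpace E M]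
    [MulAction G M] [ContMDiffSMul 𝓘(ℝ, F) 𝓘(ℝ, E) ∞ G M] :
    letI := manifoldDiffeology F G
    letI := manifoldDiffeology E M
    DiffAction G M :=
  letI := manifoldDiffeology F G
  letI := manifoldDiffeology E M
  { smooth_smul := fun n p hp ↦ by
      have h1 : ContMDiff 𝓘(ℝ, EuclideanSpace ℝ (Fin n)) (𝓘(ℝ, F).prod 𝓘(ℝ, E)) ∞ p :=
        ContMDiff.prodMk hp.1 hp.2
      exact (ContMDiffSMul.contMDiff_smul (I := 𝓘(ℝ, F)) (I' := 𝓘(ℝ, E)) (G := G)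
        (M := M)).comp h1 }

end SmoothLemmas

instance instDiffGroupSubgroup {K : Type*} [Group K] [DiffeologicalSpace K] [DiffGroup K]
    (S : Subgroup K) : DiffGroup S where
  smooth_mul := fun _ _ hp ↦ isPlot_mul (K := K) hp.1 hp.2
  smooth_inv := fun _ _ hp ↦ isPlot_inv (K := K) hp

/-- The translation groupoid `N ⋊ K` of an action of `K` on `N`: the arrow `(k, x)` goes from `x`
to `k • x`. -/
def translationGroupoid (K N : Type u) [Group K] [DiffeologicalSpace K] [DiffGroup K]
    [DiffeologicalSpace N] [MulAction K N] [DiffAction K N] : DiffGroupoid.{u} where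
  Obj := N
  Arr := K × N
  diffObj := inferInstance
  diffArr := instDiffeologyProd
  src a := a.2
  tgt a := a.1 • a.2
  one x := (1, x)
  inv a := (a.1⁻¹, a.1 • a.2)
  mul p := (p.1.1.1 * p.1.2.1, p.1.2.2)
  src_one _ := rfl
  tgt_one x := one_smul K x
  src_inv _ := rfl
  tgt_inv a := inv_smul_smul a.1 a.2
  src_mul _ := rfl
  tgt_mul p := by rw [mul_smul]; exact congrArg _ p.2.symm
  one_mul a := Prod.ext (one_mul a.1) rfl
  mul_one a := Prod.ext (mul_one a.1) rfl
  inv_mul a := Prod.ext (inv_mul_cancel a.1) rfl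
  mul_inv a := Prod.ext (mul_inv_cancel a.1) rfl
  mul_assoc a b c _ _ := Prod.ext (mul_assoc a.1 b.1 c.1) rfl
  smooth_src := fun _ _ hp ↦ hp.2
  smooth_tgt := fun _ _ hp ↦ isPlot_smul hp.1 hp.2
  smooth_one := fun _ _ hp ↦ ⟨isPlot_const, hp⟩
  smooth_inv := fun _ _ hp ↦ ⟨isPlot_inv hp.1, isPlot_smul hp.1 hp.2⟩
  smooth_mul := fun _ _ hp ↦ ⟨isPlot_mul hp.1.1 hp.2.1, hp.2.2⟩

/-- `A` is a Lie groupoid presenting a closed quotient orbifold: it is Morita equivalent to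
`N ⋊ K`, where `K` is a compact Lie group acting smoothly and locally freely (i.e. with finite
isotropy groups) on a closed manifold `N`. -/
def IsClosedQuotientOrbifold (A : DiffGroupoid.{u}) : Prop :=
  A.IsLie ∧ ∃ (K N : Type u) (_ : Group K) (_ : DiffeologicalSpace K) (_ : DiffGroup K)
    (_ : DiffeologicalSpace N) (_ : MulAction K N) (_ : DiffAction K N),
    IsSmoothManifold K ∧ @CompactSpace K dTopology ∧
    IsSmoothManifold N ∧ @CompactSpace N dTopology ∧
    (∀ x : N, Finite (MulAction.stabilizer K x)) ∧
    A.MoritaEquivalent (translationGroupoid K N)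

/-- Multiplicative orbifold invariants with values in `R`: functions of (Lie groupoids presenting)
closed quotient orbifolds that are invariant under Morita equivalence and multiplicative on product
groupoids. Nothing is required of the values at other groupoids. -/
structure MultiplicativeOrbifoldInvariant (R : Type v) [CommRing R] where
  toFun : DiffGroupoid.{u} → R
  morita : ∀ A B, IsClosedQuotientOrbifold A → IsClosedQuotientOrbifold B →
    A.MoritaEquivalent B → toFun A = toFun B
  map_prod : ∀ A B, IsClosedQuotientOrbifold A → IsClosedQuotientOrbifold B →
    toFun (A.prod B) = toFun A * toFun B

open Classical in
/-- The value of an invariant at a groupoid, taken to be zero at the empty groupoid. -/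
noncomputable def MultiplicativeOrbifoldInvariant.eval {R : Type v} [CommRing R]
    (φ : MultiplicativeOrbifoldInvariant.{u} R) (A : DiffGroupoid.{u}) : R :=
  if IsEmpty A.Obj then 0 else φ.toFun A

/-! ## Fixed points, centralizers and `Γ`-extensions -/

section FixedPoints

variable {L : Type*} [Group L] {K : Type*} [Group K] (N : Type*) [MulAction K N]

/-- The fixed point set `N^⟨θ⟩` of a homomorphism `θ : L → K`. -/
def fixedSet (θ : L →* K) : Type _ := {x : N // ∀ l, θ l • x = x}

instance (θ : L →* K) [DiffeologicalSpace N] : DiffeologicalSpace (fixedSet N θ) :=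
  instDiffeologySubtype _

/-- The centralizer `C_K(θ)` of a homomorphism `θ : L → K`. -/
abbrev homCentralizer (θ : L →* K) : Subgroup K := Subgroup.centralizer (Set.range θ)

instance (θ : L →* K) : MulAction (homCentralizer θ) (fixedSet N θ) where
  smul c x := ⟨c.1 • x.1, fun l ↦ by
    rw [← mul_smul, Subgroup.mem_centralizer_iff.1 c.2 (θ l) ⟨l, rfl⟩, mul_smul, x.2 l]⟩
  one_smul x := Subtype.ext (one_smul K x.1)
  mul_smul c d x := Subtype.ext (mul_smul c.1 d.1 x.1)

instance (θ : L →* K) [DiffeologicalSpace K] [DiffeologicalSpace N] [DiffAction K N] :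
    DiffAction (homCentralizer θ) (fixedSet N θ) where
  smooth_smul := fun _ _ hp ↦ isPlot_smul (K := K) (N := N) hp.1 hp.2

end FixedPoints

/-- Conjugacy of homomorphisms `L → K`. -/
def conjSetoid (L K : Type*) [Group L] [Group K] : Setoid (L →* K) where
  r θ θ' := ∃ k : K, ∀ l, θ' l = k * θ l * k⁻¹
  iseqv :=
    { refl := fun θ ↦ ⟨1, by simp⟩
      symm := fun {θ θ'} ⟨k, hk⟩ ↦ ⟨k⁻¹, fun l ↦ by rw [hk]; group⟩
      trans := fun {θ θ' θ''} ⟨k, hk⟩ ⟨m, hm⟩ ↦ ⟨m * k, fun l ↦ by rw [hm, hk]; group⟩ }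

/-- `HOM(L, K) / K`. -/
abbrev HomConj (L K : Type*) [Group L] [Group K] : Type _ := Quotient (conjSetoid L K)

namespace MultiplicativeOrbifoldInvariant

variable {R : Type v} [CommRing R] (φ : MultiplicativeOrbifoldInvariant.{u} R)
  (Γ : Type w) [Group Γ]

/-- The term `φ (N^⟨θ⟩ ⋊ C_K(θ))` (zero if `N^⟨θ⟩` is empty) of a conjugacy class `(θ)`, computed
at a representative. -/
noncomputable def sectorTerm (K N : Type u) [Group K] [DiffeologicalSpace K] [DiffGroup K]
    [DiffeologicalSpace N] [MulAction K N] [DiffAction K N] (c : HomConj Γ K) : R :=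
  φ.eval (translationGroupoid (homCentralizer c.out) (fixedSet N c.out))

/-- The `Γ`-extension `φ_Γ (N ⋊ K)`, the sum of `φ (N^⟨θ⟩ ⋊ C_K(θ))` over `HOM(Γ, K) / K`. -/
noncomputable def extension (K N : Type u) [Group K] [DiffeologicalSpace K] [DiffGroup K]
    [DiffeologicalSpace N] [MulAction K N] [DiffAction K N] : R :=
  ∑ᶠ c : HomConj Γ K, φ.sectorTerm Γ K N c

end MultiplicativeOrbifoldInvariant

/-! ## Wreath products -/

instance (n : ℕ) : DiffeologicalSpace (Equiv.Perm (Fin n)) := discreteDiffeology _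

/-- The wreath product `G(S_n)`: pairs of an `n`-tuple in `G` and a permutation, with
`(g, s) * (h, t) = (i ↦ g i * h (s⁻¹ i), s * t)`. -/
def Wreath (G : Type*) [Group G] (n : ℕ) : Type _ :=
  (Fin n → G) ⋊[mulAutArrow] Equiv.Perm (Fin n)

namespace Wreath

variable {G : Type*} [Group G] {n : ℕ}

instance : Group (Wreath G n) :=
  inferInstanceAs (Group ((Fin n → G) ⋊[mulAutArrow] Equiv.Perm (Fin n)))

/-- The tuple of an element of the wreath product. -/
def tuple (a : Wreath G n) : Fin n → G := SemidirectProduct.left a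

/-- The permutation of an element of the wreath product. -/
def perm (a : Wreath G n) : Equiv.Perm (Fin n) := SemidirectProduct.right a

theorem mul_tuple (a b : Wreath G n) (i : Fin n) :
    (a * b).tuple i = a.tuple i * b.tuple (a.perm⁻¹ i) := rfl

theorem mul_perm (a b : Wreath G n) : (a * b).perm = a.perm * b.perm := rfl

theorem one_tuple (i : Fin n) : (1 : Wreath G n).tuple i = 1 := rfl

theorem one_perm : (1 : Wreath G n).perm = 1 := rfl

theorem inv_perm (a : Wreath G n) : (a⁻¹).perm = (a.perm)⁻¹ := rfl

theorem inv_tuple (a : Wreath G n) (i : Fin n) : (a⁻¹).tuple i = (a.tuple (a.perm i))⁻¹ := rfl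

instance [DiffeologicalSpace G] : DiffeologicalSpace (Wreath G n) :=
  inducedDiffeology fun a : Wreath G n ↦ (a.tuple, a.perm)

theorem isPlot_iff [DiffeologicalSpace G] {m : ℕ} {p : EuclideanSpace ℝ (Fin m) → Wreath G n} :
    IsPlot p ↔ (∀ i, IsPlot fun t ↦ (p t).tuple i) ∧
      ∃ s : Equiv.Perm (Fin n), ∀ t, (p t).perm = s := by
  constructor
  · rintro ⟨h1, h2⟩
    refine ⟨h1, (p 0).perm, fun t ↦ ?_⟩
    exact IsLocallyConstant.apply_eq_of_isPreconnected h2 isPreconnected_univ trivial trivial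
  · rintro ⟨h1, s, hs⟩
    refine ⟨h1, ?_⟩
    have : (fun t ↦ (p t).perm) = fun _ ↦ s := funext hs
    show IsPlot (fun t ↦ (p t).perm)
    rw [this]
    exact isPlot_const

instance [DiffeologicalSpace G] [DiffGroup G] : DiffGroup (Wreath G n) where
  smooth_mul := fun m p hp ↦ by
    obtain ⟨h1, s, hs⟩ := isPlot_iff.1 hp.1
    obtain ⟨h2, t, ht⟩ := isPlot_iff.1 hp.2
    refine isPlot_iff.2 ⟨fun i ↦ ?_, s * t, fun x ↦ ?_⟩
    · have : (fun x ↦ ((p x).1 * (p x).2).tuple i) =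
          fun x ↦ (p x).1.tuple i * (p x).2.tuple (s⁻¹ i) := by
        funext x; rw [mul_tuple, hs]
      exact this ▸ isPlot_mul (h1 i) (h2 (s⁻¹ i))
    · simp only [Function.comp_apply, mul_perm, hs, ht]
  smooth_inv := fun m p hp ↦ by
    obtain ⟨h1, s, hs⟩ := isPlot_iff.1 hp
    refine isPlot_iff.2 ⟨fun i ↦ ?_, s⁻¹, fun x ↦ ?_⟩
    · have : (fun x ↦ ((p x)⁻¹).tuple i) = fun x ↦ ((p x).tuple (s i))⁻¹ := by
        funext x; rw [inv_tuple, hs]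
      exact this ▸ isPlot_inv (h1 (s i))
    · simp only [Function.comp_apply, inv_perm, hs]

/-- The action of `G(S_n)` on `M^n`: `(g, s) • x = (i ↦ g i • x (s⁻¹ i))`. -/
instance {M : Type*} [MulAction G M] : MulAction (Wreath G n) (Fin n → M) where
  smul a x := fun i ↦ a.tuple i • x (a.perm⁻¹ i)
  one_smul x := funext fun i ↦ one_smul G (x i)
  mul_smul a b _ := funext fun i ↦ mul_smul (a.tuple i) (b.tuple (a.perm⁻¹ i)) _

theorem smul_apply {M : Type*} [MulAction G M] (a : Wreath G n) (x : Fin n → M) (i : Fin n) :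
    (a • x) i = a.tuple i • x (a.perm⁻¹ i) := rfl

instance {M : Type*} [MulAction G M] [DiffeologicalSpace G] [DiffeologicalSpace M]
    [DiffAction G M] : DiffAction (Wreath G n) (Fin n → M) where
  smooth_smul := fun m p hp i ↦ by
    obtain ⟨h1, s, hs⟩ := isPlot_iff.1 hp.1
    have : (fun t ↦ ((p t).1 • (p t).2) i) = fun t ↦ (p t).1.tuple i • (p t).2 (s⁻¹ i) := by
      funext t; rw [smul_apply, hs]
    exact this ▸ isPlot_smul (h1 i) (hp.2 (s⁻¹ i))

end Wreath

/-! ## Extensions associated to finite `Γ`-sets -/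

section GammaSets

variable {Γ : Type w} [Group Γ] {G : Type*} [Group G]

/-- The conjugacy class `c` of homomorphisms `Γ → G(S_n)` lies over the isomorphism class of the
`Γ`-set `X`, i.e. `{1, …, n}` with the `Γ`-action obtained by composing with `G(S_n) → S_n` is
isomorphic to `X`. -/
def LiesOver {n : ℕ} (c : HomConj Γ (Wreath G n)) (X : Type*) [MulAction Γ X] : Prop :=
  ∃ θ : Γ →* Wreath G n, Quotient.mk (conjSetoid Γ (Wreath G n)) θ = c ∧
    ∃ e : Fin n ≃ X, ∀ (γ : Γ) (i : Fin n), e ((θ γ).perm i) = γ • e i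

end GammaSets

/-- The extension `φ_[X] (M ⋊ G)` associated to a finite `Γ`-set `X` of order `n`: the sum of
`φ ((M^n)^⟨θ⟩ ⋊ C_{G(S_n)}(θ))` over the classes in `HOM(Γ, G(S_n)) / G(S_n)` lying over `[X]`. -/
noncomputable def MultiplicativeOrbifoldInvariant.setExtension {R : Type v} [CommRing R]
    (φ : MultiplicativeOrbifoldInvariant.{u} R) (Γ : Type w) [Group Γ]
    (X : Type*) [MulAction Γ X] (G M : Type u) [Group G] [DiffeologicalSpace G] [DiffGroup G]
    [DiffeologicalSpace M] [MulAction G M] [DiffAction G M] : R :=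
  ∑ᶠ (c : HomConj Γ (Wreath G (Nat.card X))) (_ : LiesOver c X),
    φ.sectorTerm Γ (Wreath G (Nat.card X)) (Fin (Nat.card X) → M) c

/-- The `Γ`-set `r (Γ / H)`, the disjoint union of `r` copies of `Γ / H`. -/
abbrev copies {Γ : Type w} [Group Γ] (r : ℕ) (H : Subgroup Γ) : Type w := Σ _ : Fin r, Γ ⧸ H

/-- Conjugacy of subgroups of finite index. -/
def finiteIndexSetoid (Γ : Type w) [Group Γ] : Setoid {H : Subgroup Γ // H.FiniteIndex} where
  r H H' := ∃ γ : Γ, ∀ x, x ∈ H'.1 ↔ γ⁻¹ * x * γ ∈ H.1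
  iseqv :=
    { refl := fun H ↦ ⟨1, by simp⟩
      symm := fun {H H'} ⟨γ, h⟩ ↦ ⟨γ⁻¹, fun x ↦ by rw [h]; group⟩
      trans := fun {H H' H''} ⟨γ, h⟩ ⟨δ, h'⟩ ↦ ⟨δ * γ, fun x ↦ by rw [h', h]; group⟩ }

/-- Conjugacy classes `(H)` of subgroups of finite index of `Γ`. -/
abbrev FiniteIndexClass (Γ : Type w) [Group Γ] : Type w := Quotient (finiteIndexSetoid Γ)

/-! ## The `Γ`-`G`-bundles `P_ρ` and their automorphism groups -/

section Irreducible

variable {Γ : Type u} [Group Γ] {H : Subgroup Γ} {G : Type u} [Group G]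

/-- The right action of `(u, g) ∈ N_Γ(H) × G` on `HOM(H, G)`:
`(ρ(u, g)) h = g⁻¹ * ρ (u * h * u⁻¹) * g`. -/
def twist (ρ : H →* G) (p : Subgroup.normalizer (H : Set Γ) × G) : H →* G :=
  (MulAut.conj p.2⁻¹).toMonoidHom.comp (ρ.comp (H.normalizerMonoidHom p.1).toMonoidHom)

theorem twist_apply (ρ : H →* G) (p : Subgroup.normalizer (H : Set Γ) × G) (h : H) :
    twist ρ p h = p.2⁻¹ * ρ ⟨p.1 * h * (p.1 : Γ)⁻¹, (p.1.2 h).1 h.2⟩ * p.2 := by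
  have : H.normalizerMonoidHom p.1 h = ⟨p.1 * h * (p.1 : Γ)⁻¹, (p.1.2 h).1 h.2⟩ :=
    Subtype.ext rfl
  simp [twist, ← this]

theorem twist_one (ρ : H →* G) : twist ρ 1 = ρ := by
  ext h
  simp [twist]

theorem twist_mul (ρ : H →* G) (p q : Subgroup.normalizer (H : Set Γ) × G) :
    twist ρ (p * q) = twist (twist ρ p) q := by
  ext h
  simp [twist, mul_assoc]

/-- The orbit equivalence relation of `N_Γ(H) × G` on `HOM(H, G)`. -/
def twistSetoid (H : Subgroup Γ) (G : Type u) [Group G] : Setoid (H →* G) where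
  r ρ ρ' := ∃ p : Subgroup.normalizer (H : Set Γ) × G, ρ' = twist ρ p
  iseqv :=
    { refl := fun ρ ↦ ⟨1, (twist_one ρ).symm⟩
      symm := fun {ρ ρ'} ⟨p, hp⟩ ↦ ⟨p⁻¹, by rw [hp, ← twist_mul, mul_inv_cancel, twist_one]⟩
      trans := fun {ρ ρ' ρ''} ⟨p, hp⟩ ⟨q, hq⟩ ↦ ⟨p * q, by rw [hq, hp, twist_mul]⟩ }

/-- `HOM(H, G) / (N_Γ(H) × G)`. -/
abbrev TwistClass (H : Subgroup Γ) (G : Type u) [Group G] : Type u := Quotient (twistSetoid H G)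

variable (ρ : H →* G)

/-- `T_ρ`, the isotropy group of `ρ` in `N_Γ(H) × G`. -/
def isotropy : Subgroup (Subgroup.normalizer (H : Set Γ) × G) where
  carrier := {p | twist ρ p = ρ}
  one_mem' := twist_one ρ
  mul_mem' {p q} hp hq := by
    simp only [Set.mem_ofPred_eq] at *
    rw [twist_mul, hp, hq]
  inv_mem' {p} hp := by
    simp only [Set.mem_ofPred_eq] at *
    conv_lhs => rw [← hp]
    rw [← twist_mul, mul_inv_cancel, twist_one]

theorem mem_isotropy_iff (p : Subgroup.normalizer (H : Set Γ) × G) :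
    p ∈ isotropy ρ ↔ ∀ h : H, ρ ⟨p.1 * h * (p.1 : Γ)⁻¹, (p.1.2 h).1 h.2⟩ = p.2 * ρ h * p.2⁻¹ := by
  change twist ρ p = ρ ↔ _
  rw [DFunLike.ext_iff]
  refine forall_congr' fun h ↦ ?_
  rw [twist_apply]
  constructor
  · intro e; rw [← e]; group
  · intro e; rw [e]; group

/-- The inclusion `h ↦ (h, ρ h)` of `H` in `T_ρ`. -/
def toIsotropy : H →* isotropy ρ where
  toFun h := ⟨(⟨h.1, Subgroup.le_normalizer h.2⟩, ρ h), (mem_isotropy_iff ρ _).2 fun k ↦ by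
    rw [← map_inv, ← map_mul, ← map_mul]; rfl⟩
  map_one' := Subtype.ext (Prod.ext rfl (map_one ρ))
  map_mul' h k := Subtype.ext (Prod.ext rfl (map_mul ρ h k))

instance : (toIsotropy ρ).range.Normal where
  conj_mem := by
    rintro _ ⟨h, rfl⟩ t
    refine ⟨⟨t.1.1 * h * (t.1.1 : Γ)⁻¹, (t.1.1.2 h).1 h.2⟩, ?_⟩
    exact Subtype.ext (Prod.ext rfl ((mem_isotropy_iff ρ t.1).1 t.2 h))

/-- The group `Aut^{P_ρ} = H \ T_ρ` of automorphisms of the `Γ`-`G`-principal bundle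
`P_ρ = Γ ×_ρ G → Γ / H`; see `bundleAutEquiv` for the identification. -/
def BundleAut : Type u := isotropy ρ ⧸ (toIsotropy ρ).range

namespace BundleAut

instance : Group (BundleAut ρ) :=
  inferInstanceAs (Group (isotropy ρ ⧸ (toIsotropy ρ).range))

/-- The projection `T_ρ → H \ T_ρ`. -/
def mk : isotropy ρ →* BundleAut ρ := QuotientGroup.mk' (toIsotropy ρ).range

theorem mk_surjective : Function.Surjective (mk ρ) :=
  QuotientGroup.mk'_surjective _

instance instDiffeologyNormalizer : DiffeologicalSpace (Subgroup.normalizer (H : Set Γ)) :=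
  discreteDiffeology _

instance instDiffGroupNormalizer : DiffGroup (Subgroup.normalizer (H : Set Γ)) where
  smooth_mul := fun _ _ hp ↦ IsLocallyConstant.comp₂ hp.1 hp.2 (· * ·)
  smooth_inv := fun _ _ hp ↦ IsLocallyConstant.comp hp (·⁻¹)

instance instDiffeology [DiffeologicalSpace G] : DiffeologicalSpace (BundleAut ρ) :=
  quotientDiffeology (mk ρ) (mk_surjective ρ)

instance [DiffeologicalSpace G] [DiffGroup G] : DiffGroup (BundleAut ρ) where
  smooth_mul := fun n p hp x ↦ by
    obtain ⟨q, hq, h⟩ := hp.1 x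
    obtain ⟨q', hq', h'⟩ := hp.2 x
    refine ⟨fun t ↦ q t * q' t, ?_, ?_⟩
    · exact ⟨isPlot_mul (K := Subgroup.normalizer (H : Set Γ)) hq.1 hq'.1,
        isPlot_mul (K := G) hq.2 hq'.2⟩
    · filter_upwards [h, h'] with t ht ht'
      simp only [Function.comp_apply]
      rw [ht, ht', map_mul]
  smooth_inv := fun n p hp x ↦ by
    obtain ⟨q, hq, h⟩ := hp x
    refine ⟨fun t ↦ (q t)⁻¹, ?_, ?_⟩
    · exact ⟨isPlot_inv (K := Subgroup.normalizer (H : Set Γ)) hq.1, isPlot_inv (K := G) hq.2⟩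
    · filter_upwards [h] with t ht
      simp only [Function.comp_apply]
      rw [ht, map_inv]

variable (M : Type*) [MulAction G M]

/-- The action of `T_ρ` on `M^⟨ρ⟩` by `(u, g) x = g x`. -/
instance isotropyAction : MulAction (isotropy ρ) (fixedSet M ρ) where
  smul t x := ⟨t.1.2 • x.1, fun h ↦ by
    have h1 := (mem_isotropy_iff ρ _).1 (inv_mem t.2) h
    have h2 : ρ h * t.1.2 = t.1.2 * ρ ⟨(t.1⁻¹).1 * h * ((t.1⁻¹).1 : Γ)⁻¹,
        ((t.1⁻¹).1.2 h).1 h.2⟩ := by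
      rw [h1]; simp [mul_assoc]
    rw [← mul_smul, h2, mul_smul, x.2]⟩
  one_smul x := Subtype.ext (one_smul G x.1)
  mul_smul s t x := Subtype.ext (mul_smul s.1.2 t.1.2 x.1)

/-- The action of `Aut^{P_ρ}` on `M^⟨ρ⟩` by `H(u, g) x = g x`, as a homomorphism to the
permutation group. -/
def toPerm : BundleAut ρ →* Equiv.Perm (fixedSet M ρ) :=
  QuotientGroup.lift (toIsotropy ρ).range (MulAction.toPermHom (isotropy ρ) (fixedSet M ρ)) (by
    rintro _ ⟨h, rfl⟩
    exact Equiv.ext fun x ↦ Subtype.ext (x.2 h))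

instance : MulAction (BundleAut ρ) (fixedSet M ρ) := MulAction.compHom _ (toPerm ρ M)

theorem mk_smul (t : isotropy ρ) (x : fixedSet M ρ) : (mk ρ t • x).1 = t.1.2 • x.1 := rfl

instance [DiffeologicalSpace G] [DiffeologicalSpace M] [DiffAction G M] :
    DiffAction (BundleAut ρ) (fixedSet M ρ) where
  smooth_smul := fun _ p hp ↦ DiffeologicalSpace.locality fun x ↦ by
    obtain ⟨q, hq, h⟩ := hp.1 x
    obtain ⟨s, hs, hso, hxs⟩ := eventually_nhds_iff.1 h
    refine ⟨s, hso, hxs, fun {m f} hf hf' ↦ ?_⟩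
    have h1 : (fun t ↦ ((p (f t)).1 • (p (f t)).2).1) =
        fun t ↦ (q (f t)).1.2 • (p (f t)).2.1 := by
      funext t
      have h2 : (p (f t)).1 = mk ρ (q (f t)) := hs _ (hf t)
      rw [h2, mk_smul]
    change IsPlot (fun t ↦ ((p (f t)).1 • (p (f t)).2).1)
    rw [h1]
    exact isPlot_smul (K := G) (N := M) (isPlot_reparam hq.2 hf') (isPlot_reparam hp.2 hf')

end BundleAut

/-! The identification of `H \ T_ρ` with the automorphism group of the bundle `P_ρ`. -/

/-- The equivalence relation `(γ * h, g) ∼ (γ, ρ h * g)` on `Γ × G`. -/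
def bundleSetoid : Setoid (Γ × G) where
  r a b := ∃ h : H, a.1 = b.1 * h ∧ ρ h * a.2 = b.2
  iseqv :=
    { refl := fun a ↦ ⟨1, by simp, by simp⟩
      symm := fun {a b} ⟨h, h1, h2⟩ ↦ ⟨h⁻¹, by simp [h1], by simp [← h2]⟩
      trans := fun {a b c} ⟨h, h1, h2⟩ ⟨k, k1, k2⟩ ↦
        ⟨k * h, by simp [h1, k1, mul_assoc], by simp [← k2, ← h2, mul_assoc]⟩ }

/-- The total space `P_ρ = Γ ×_ρ G`. -/
def Bundle : Type u := Quotient (bundleSetoid ρ)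

/-- The commuting left `Γ`-action and right `G`-action on `P_ρ`: `p ↦ γ p g`. -/
def Bundle.act (γ : Γ) (g : G) : Bundle ρ → Bundle ρ :=
  Quotient.map (fun a ↦ (γ * a.1, a.2 * g)) fun a b ⟨h, h1, h2⟩ ↦
    ⟨h, by simp [h1, mul_assoc], by simp [← h2, mul_assoc]⟩

/-- The automorphism group of the `Γ`-`G`-principal bundle `P_ρ`: the bijections commuting with the
actions of `Γ` and `G`. (These cover maps of the finite base `Γ / H` and are automatically
smooth.) -/
def bundleAutGroup : Subgroup (Equiv.Perm (Bundle ρ)) where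
  carrier := {f | ∀ γ g p, f (Bundle.act ρ γ g p) = Bundle.act ρ γ g (f p)}
  one_mem' := fun _ _ _ ↦ rfl
  mul_mem' {f f'} hf hf' := fun γ g p ↦ by
    simp only [Equiv.Perm.coe_mul, Function.comp_apply, hf' γ g p, hf γ g]
  inv_mem' {f} hf := fun γ g p ↦ by
    rw [Equiv.Perm.inv_eq_iff_eq, hf]
    exact congrArg _ (f.apply_symm_apply p).symm

/-- `(u, g) ∈ T_ρ` acts on `P_ρ` by `[γ, g'] ↦ [γ * u⁻¹, g * g']`. -/
def isotropyMap (t : isotropy ρ) : Bundle ρ → Bundle ρ :=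
  Quotient.map (fun a ↦ (a.1 * (t.1.1 : Γ)⁻¹, t.1.2 * a.2)) fun a b ⟨h, h1, h2⟩ ↦
    ⟨⟨t.1.1 * h * (t.1.1 : Γ)⁻¹, (t.1.1.2 h).1 h.2⟩, by simp [h1, mul_assoc], by
      rw [(mem_isotropy_iff ρ t.1).1 t.2 h, ← h2]; simp [mul_assoc]⟩

theorem isotropyMap_one : isotropyMap ρ 1 = id := by
  funext p
  induction p using Quotient.inductionOn with
  | h a => exact congrArg (Quotient.mk (bundleSetoid ρ)) (Prod.ext (by simp) (by simp))

theorem isotropyMap_mul (s t : isotropy ρ) :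
    isotropyMap ρ (s * t) = isotropyMap ρ s ∘ isotropyMap ρ t := by
  funext p
  induction p using Quotient.inductionOn with
  | h a =>
    exact congrArg (Quotient.mk (bundleSetoid ρ))
      (Prod.ext (by simp [mul_assoc]) (by simp [mul_assoc]))

/-- The resulting homomorphism from `T_ρ` to the automorphism group of `P_ρ`. -/
def isotropyHom : isotropy ρ →* bundleAutGroup ρ where
  toFun t := ⟨⟨isotropyMap ρ t, isotropyMap ρ t⁻¹,
    fun p ↦ by rw [← Function.comp_apply (f := isotropyMap ρ _), ← isotropyMap_mul]
               simp [isotropyMap_one],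
    fun p ↦ by rw [← Function.comp_apply (f := isotropyMap ρ _), ← isotropyMap_mul]
               simp [isotropyMap_one]⟩, fun γ g p ↦ by
      induction p using Quotient.inductionOn with
      | h a =>
        exact congrArg (Quotient.mk (bundleSetoid ρ))
          (Prod.ext (mul_assoc _ _ _) (mul_assoc _ _ _).symm)⟩
  map_one' := Subtype.ext (Equiv.ext fun p ↦ congrFun (isotropyMap_one ρ) p)
  map_mul' s t := Subtype.ext (Equiv.ext fun p ↦ congrFun (isotropyMap_mul ρ s t) p)

theorem isotropyHom_ker : (isotropyHom ρ).ker = (toIsotropy ρ).range := by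
  ext t
  rw [MonoidHom.mem_ker, MonoidHom.mem_range]
  constructor
  · intro h
    have h1 : isotropyMap ρ t (Quotient.mk _ (1, 1)) = Quotient.mk (bundleSetoid ρ) (1, 1) :=
      Equiv.congr_fun (congrArg Subtype.val h) (Quotient.mk (bundleSetoid ρ) (1, 1))
    obtain ⟨k, k1, k2⟩ := Quotient.exact h1
    simp only [one_mul, mul_one] at k1 k2
    refine ⟨k⁻¹, Subtype.ext (Prod.ext (Subtype.ext ?_) ?_)⟩
    · simp [toIsotropy, ← k1]
    · simp only [toIsotropy, MonoidHom.coe_mk, OneHom.coe_mk, map_inv]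
      exact inv_eq_of_mul_eq_one_right k2
  · rintro ⟨k, rfl⟩
    refine Subtype.ext (Equiv.ext fun p ↦ ?_)
    induction p using Quotient.inductionOn with
    | h a => exact Quotient.sound ⟨k⁻¹, by simp [toIsotropy], by simp [toIsotropy]⟩

theorem isotropyHom_surjective : Function.Surjective (isotropyHom ρ) := by
  intro f
  obtain ⟨⟨v, g⟩, hv⟩ := Quotient.exists_rep (f.1 (Quotient.mk (bundleSetoid ρ) (1, 1)))
  have key : ∀ a : Γ × G, f.1 (Quotient.mk (bundleSetoid ρ) a) =
      Quotient.mk (bundleSetoid ρ) (a.1 * v, g * a.2) := fun a ↦ by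
    have := f.2 a.1 a.2 (Quotient.mk (bundleSetoid ρ) (1, 1))
    rw [← hv] at this
    simpa [Bundle.act] using this
  have h1 : ∀ h : H, ∃ k : H, (h : Γ) * v = v * k ∧ ρ k * g = g * ρ h := fun h ↦ by
    have e : Quotient.mk (bundleSetoid ρ) ((h : Γ), (1 : G)) =
        Quotient.mk (bundleSetoid ρ) ((1 : Γ), ρ h) :=
      Quotient.sound ⟨h, by simp, by simp⟩
    have e' := congrArg f.1 e
    rw [key, key] at e'
    obtain ⟨k, k1, k2⟩ := Quotient.exact e'
    exact ⟨k, by simpa using k1, by simpa using k2⟩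
  have h2 : ∀ h : H, ∃ k : H, v * h = k * v := fun h ↦ by
    have hinj : Quotient.mk (bundleSetoid ρ) (v * h * v⁻¹, (1 : G)) =
        Quotient.mk (bundleSetoid ρ) ((1 : Γ), g⁻¹ * ρ h * g) := by
      apply f.1.injective
      rw [key, key]
      exact Quotient.sound ⟨h, by simp, by simp [mul_assoc]⟩
    obtain ⟨k, k1, -⟩ := Quotient.exact hinj
    exact ⟨k, by simp only [one_mul] at k1; rw [← k1]; group⟩
  have hn : v⁻¹ ∈ Subgroup.normalizer (H : Set Γ) := by
    intro x
    constructor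
    · intro hx
      obtain ⟨k, k1, -⟩ := h1 ⟨x, hx⟩
      have : v⁻¹ * x * v⁻¹⁻¹ = k := by
        simp only at k1
        rw [inv_inv, mul_assoc, k1, inv_mul_cancel_left]
      rw [this]; exact k.2
    · intro hx
      obtain ⟨k, k1⟩ := h2 ⟨_, hx⟩
      have : x = k := by
        simp only [inv_inv] at k1
        have := congrArg (· * v⁻¹) k1
        simpa [mul_assoc] using this
      rw [this]; exact k.2
  refine ⟨⟨(⟨v⁻¹, hn⟩, g), (mem_isotropy_iff ρ _).2 fun h ↦ ?_⟩, ?_⟩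
  · obtain ⟨k, k1, k2⟩ := h1 h
    have : (⟨v⁻¹ * h * (v⁻¹ : Γ)⁻¹, (hn h).1 h.2⟩ : H) = k :=
      Subtype.ext (by
        change v⁻¹ * h * (v⁻¹ : Γ)⁻¹ = k
        rw [inv_inv, mul_assoc, k1, inv_mul_cancel_left])
    rw [eq_mul_inv_iff_mul_eq, ← k2, ← this]
  · refine Subtype.ext (Equiv.ext fun p ↦ ?_)
    induction p using Quotient.inductionOn with
    | h a =>
      rw [key]
      exact congrArg (Quotient.mk (bundleSetoid ρ)) (Prod.ext (by simp) rfl)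

/-- The group `H \ T_ρ` is the automorphism group of the bundle `P_ρ`. -/
noncomputable def bundleAutEquiv : BundleAut ρ ≃* bundleAutGroup ρ :=
  (QuotientGroup.quotientMulEquivOfEq (isotropyHom_ker ρ).symm).trans
    (QuotientGroup.quotientKerEquivOfSurjective _ (isotropyHom_surjective ρ))

end Irreducible

/-! ## Generating functions -/

/-- The power series `∑ r, a r * q ^ (d * r)`, for `d ≥ 1`. -/
def dilatedSeries {R : Type v} [CommRing R] (d : ℕ) (a : ℕ → R) : PowerSeries R :=
  PowerSeries.mk fun n ↦ if d ∣ n then a (n / d) else 0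

/-! A homomorphism `θ : Γ → G(S_n)` is a `Γ`-`G`-principal bundle with total space `{1, …, n} × G`:
`G` multiplies on the right and `Γ` acts through `θ`. Since `G(S_n)` is the full group of right
`G`-equivariant bijections of this space, conjugacy classes are isomorphism classes of bundles and
centralizers are automorphism groups. Each bundle is a disjoint union of irreducible bundles `P_ρ →
Γ/H`, whose types are pairs of a class `(H)` and a class `[ρ]`. So conjugacy classes correspond to
finitely supported multiplicities `m` on the set of types with `∑ m i * [Γ : H i] = n`
(`exists_bijOn_multiplicity`).

A point of `M^n` is an equivariant function on the total space; it is fixed by `θ` iff the function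
is `Γ`-invariant, and then it is determined by its values at one base point per component. Hence the
sector of `θ` is isomorphic to the product of the translation groupoids of `Aut(P_ρ)(S_r)` on
`(M^⟨ρ⟩)^r`, with `r` the multiplicity of `ρ` (`exists_centralizerEquiv`, `exists_fixedEquiv`), and
multiplicativity of `φ` factors its term (`eval_sector`). Summing over all `m` expands a product of
series indexed by types (`hasProd_dilatedSeries`). The types over one `H` give the second formula;
all types, grouped by `(H)`, give the first. The value of `φ` at a point is an idempotent `e` that
fixes the relevant values but need not be `1`, and it is carried through the expansion.

Convergence needs finitely many relevant types of each index. A finitely generated group has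
finitely many subgroups of a given index. For fixed `H`, the pairs `(ρ, x)` with `x` fixed by `ρ`
form a compact set on which the conjugacy class of `ρ` is locally constant
(`eventually_conj_of_fixedSet`): elements near `1` with a fixed point are trivial
(`eventually_eq_one_of_smul_eq`), so nearby `ρ'` factors through the finite group `ρ(H)`, and finite
subgroups of Lie groups are rigid (`Subgroup.eventually_conj_of_finite`). Linearization of finite
group actions (`exists_linearizing_chart`) also makes the fixed sets and centralizers compact
manifolds, so that `φ` may be applied to them. -/

namespace Diffeology

/-! ## Compact manifolds as diffeological spaces -/

/-- A chart of a topological and diffeological space around a point, with values in `V`. -/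
def HasChartAt (V : Type*) [NormedAddCommGroup V] [NormedSpace ℝ V] {X : Type*}
    [DiffeologicalSpace X] [TopologicalSpace X] (x : X) : Prop :=
  ∃ (f : X → V) (g : V → X) (s : Set X) (t : Set V), IsOpen s ∧ x ∈ s ∧ IsOpen t ∧
    Set.MapsTo f s t ∧ Set.MapsTo g t s ∧ Set.LeftInvOn g f s ∧ Set.RightInvOn g f t ∧
    ContinuousOn f s ∧
    (∀ (n : ℕ) (p : EuclideanSpace ℝ (Fin n) → X), IsPlot p → (∀ z, p z ∈ s) →
      ContDiff ℝ ∞ (f ∘ p)) ∧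
    (∀ (n : ℕ) (q : EuclideanSpace ℝ (Fin n) → V), ContDiff ℝ ∞ q → (∀ z, q z ∈ t) →
      IsPlot (g ∘ q))

theorem HasChartAt.congr {V W : Type*} [NormedAddCommGroup V] [NormedSpace ℝ V]
    [NormedAddCommGroup W] [NormedSpace ℝ W] (e : V ≃L[ℝ] W) {X : Type*}
    [DiffeologicalSpace X] [TopologicalSpace X] {x : X} (h : HasChartAt V x) :
    HasChartAt W x := by
  obtain ⟨f, g, s, t, hs, hx, ht, hf, hg, hl, hr, hc, h1, h2⟩ := h
  refine ⟨fun y ↦ e (f y), fun z ↦ g (e.symm z), s, e.symm ⁻¹' t, hs, hx,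
    ht.preimage e.symm.continuous, fun y hy ↦ by simpa using hf hy, fun z hz ↦ hg hz,
    fun y hy ↦ by simpa using hl hy, fun z hz ↦ ?_, e.continuous.comp_continuousOn hc,
    fun n p hp hps ↦ e.contDiff.comp (h1 n p hp hps),
    fun n q hq hqt ↦ h2 n _ (e.symm.contDiff.comp hq) hqt⟩
  have := hr hz
  simp [this]

theorem HasChartAt.euclidean {V : Type*} [NormedAddCommGroup V] [NormedSpace ℝ V]
    [FiniteDimensional ℝ V] {X : Type*}
    [DiffeologicalSpace X] [TopologicalSpace X] {x : X} (h : HasChartAt V x) :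
    ∃ n : ℕ, HasChartAt (EuclideanSpace ℝ (Fin n)) x :=
  ⟨Module.finrank ℝ V, h.congr (ContinuousLinearEquiv.ofFinrankEq (by simp))⟩

/-- A diffeological space carrying a compact Hausdorff topology for which the plots are continuous
and which has charts around every point. -/
def IsCompactManifold (X : Type*) [DiffeologicalSpace X] : Prop :=
  ∃ _ : TopologicalSpace X, T2Space X ∧ CompactSpace X ∧
    (∀ (n : ℕ) (p : EuclideanSpace ℝ (Fin n) → X), IsPlot p → Continuous p) ∧
    ∀ x : X, ∃ n : ℕ, HasChartAt (EuclideanSpace ℝ (Fin n)) x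

/-- An inverse chart, cut off to a globally defined plot, detects openness in the D-topology near
the image of the point; continuity of the chart carries this back to `X`. -/
theorem isOpen_of_chart {X : Type*} [DiffeologicalSpace X] [TopologicalSpace X]
    (hch : ∀ x : X, ∃ n : ℕ, HasChartAt (EuclideanSpace ℝ (Fin n)) x) {W : Set X}
    (hW : IsOpen[dTopology] W) : IsOpen W := by
  rw [isOpen_iff_mem_nhds]
  intro x hxW
  obtain ⟨n, f, g, s, t, hs, hx, ht, hf, hg, hl, hr, hc, h1, h2⟩ := hch x
  have key : ∀ᶠ z in 𝓝 (f x), g z ∈ W := by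
    -- Plots are defined on all of Euclidean space, so `g` is precomposed with a smooth map into `t`
    -- that is the identity near `f x`.
    obtain ⟨r, hr1, hr2, hr3⟩ := exists_smooth_retraction ht (hf hx)
    have hp : IsPlot (g ∘ r) := h2 n r hr1 hr2
    have ho := isOpen_iff_preimages_plots.1 hW n _ hp
    have hm : f x ∈ (g ∘ r) ⁻¹' W := by
      simp only [Set.mem_preimage, Function.comp_apply, hr3.self_of_nhds, hl hx, hxW]
    filter_upwards [ho.mem_nhds hm, hr3] with z hz hz'
    simpa [hz'] using hz
  have hca : ContinuousAt f x := hc.continuousAt (hs.mem_nhds hx)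
  filter_upwards [hca.eventually key, hs.mem_nhds hx] with y hy hys
  rwa [hl hys] at hy

/-- Products and fixed sets are easier to handle with their usual topologies than with the
D-topology. Constructions therefore carry an auxiliary topology, which is identified with the
D-topology here. -/
theorem dTopology_eq_of_chart {X : Type*} [DiffeologicalSpace X] [τ : TopologicalSpace X]
    (hp : ∀ (n : ℕ) (p : EuclideanSpace ℝ (Fin n) → X), IsPlot p → Continuous p)
    (hch : ∀ x : X, ∃ n : ℕ, HasChartAt (EuclideanSpace ℝ (Fin n)) x) : dTopology = τ := by
  ext W
  refine ⟨fun h ↦ isOpen_of_chart hch h, fun h ↦ isOpen_iff_preimages_plots.2 fun n p hpp ↦ ?_⟩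
  exact h.preimage (hp n p hpp)

theorem IsCompactManifold.compactSpace {X : Type*} [DiffeologicalSpace X]
    (h : IsCompactManifold X) : @CompactSpace X dTopology := by
  obtain ⟨τ, _, h2, h3, h4⟩ := h
  rw [dTopology_eq_of_chart h3 h4]
  exact h2

/-- By compactness finitely many chart domains cover `X`, and each has the topology induced from a
Euclidean space. -/
theorem secondCountable_of_chart {X : Type*} [DiffeologicalSpace X] [τ : TopologicalSpace X]
    [CompactSpace X]
    (hp : ∀ (n : ℕ) (p : EuclideanSpace ℝ (Fin n) → X), IsPlot p → Continuous p)
    (hch : ∀ x : X, ∃ n : ℕ, HasChartAt (EuclideanSpace ℝ (Fin n)) x) :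
    SecondCountableTopology X := by
  have key : ∀ x : X, ∃ s : Set X, IsOpen s ∧ x ∈ s ∧ SecondCountableTopology s := by
    intro x
    obtain ⟨n, f, g, s, t, hs, hx, ht, hf, hg, hl, hr, hc, h1, h2⟩ := hch x
    refine ⟨s, hs, hx, ?_⟩
    -- Continuity of the inverse chart is not part of `HasChartAt`; it follows because the inverse
    -- chart is locally a plot and plots are continuous.
    have hind : Topology.IsInducing (s.domRestrict f) := by
      refine (Topology.isInducing_iff_nhds).2 fun y ↦ le_antisymm ?_ ?_
      · exact (continuousOn_iff_continuous_domRestrict.1 hc).continuousAt.le_comap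
      · intro W hW
        rw [Filter.mem_comap]
        have hgc : ContinuousAt g (f y) := by
          obtain ⟨r, hr1, hr2, hr3⟩ := exists_smooth_retraction ht (hf y.2)
          have hgr : Continuous (g ∘ r) := hp n _ (h2 n r hr1 hr2)
          refine hgr.continuousAt.congr ?_
          filter_upwards [hr3] with z hz
          simp [hz]
        have hW' : Subtype.val '' W ∈ 𝓝 (y : X) := by
          rw [← map_nhds_subtype_coe_eq_nhds y.2 (hs.mem_nhds y.2)]
          exact Filter.image_mem_map hW
        have : g (f y) = y := hl y.2
        rw [ContinuousAt, this] at hgc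
        refine ⟨g ⁻¹' (Subtype.val '' W), hgc hW', fun z hz ↦ ?_⟩
        obtain ⟨z', hz', e⟩ : g (f z) ∈ Subtype.val '' W := hz
        rw [hl z.2] at e
        rwa [← Subtype.ext e]
    exact hind.secondCountableTopology
  choose s hs hxs hsc using key
  obtain ⟨F, hF⟩ := isCompact_univ.elim_finite_subcover s hs fun x _ ↦ Set.mem_iUnion.2 ⟨x, hxs x⟩
  have : ∀ i : F, SecondCountableTopology (s i) := fun i ↦ hsc i
  refine TopologicalSpace.secondCountableTopology_of_countable_cover (U := fun i : F ↦ s i)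
    (fun i ↦ hs i) ?_
  rw [Set.eq_univ_iff_forall]
  intro x
  obtain ⟨i, hi, hx⟩ := Set.mem_iUnion₂.1 (hF (Set.mem_univ x))
  exact Set.mem_iUnion.2 ⟨⟨i, hi⟩, hx⟩

theorem IsCompactManifold.isSmoothManifold {X : Type*} [DiffeologicalSpace X]
    (h : IsCompactManifold X) : IsSmoothManifold X := by
  obtain ⟨τ, h1, h2, h3, h4⟩ := h
  have e := dTopology_eq_of_chart h3 h4
  refine ⟨e ▸ h1, e ▸ secondCountable_of_chart h3 h4, fun x ↦ ?_⟩
  obtain ⟨n, f, g, s, t, hs, hx, ht, hf, hg, hl, hr, hc, hp, hq⟩ := h4 x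
  refine ⟨s, e ▸ hs, hx, n, t, ht, fun y ↦ ⟨f y, hf y.2⟩, fun m p hpp ↦ ?_,
    fun z ↦ ⟨g z, hg z.2⟩, fun m q hqq ↦ ?_, fun y ↦ Subtype.ext (hl y.2),
    fun z ↦ Subtype.ext (hr z.2)⟩
  · exact (hp m _ hpp fun z ↦ (p z).2).isPlot
  · exact hq m _ (IsPlot.contDiff hqq) fun z ↦ (q z).2

theorem IsCompactManifold.of_diffeo {X Y : Type*} [DiffeologicalSpace X] [DiffeologicalSpace Y]
    (e : X ≃ Y) (he : DSmooth e) (he' : DSmooth e.symm) (h : IsCompactManifold X) :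
    IsCompactManifold Y := by
  obtain ⟨τ, h1, h2, h3, h4⟩ := h
  let τ' : TopologicalSpace Y := τ.induced e.symm
  let H : Y ≃ₜ X := e.symm.toHomeomorphOfIsInducing ⟨rfl⟩
  refine ⟨τ', H.symm.t2Space, H.symm.compactSpace, fun n p hp ↦ ?_, fun y ↦ ?_⟩
  · exact continuous_induced_rng.2 (h3 n _ (he' n p hp))
  · obtain ⟨n, f, g, s, t, hs, hx, ht, hf, hg, hl, hr, hc, hp, hq⟩ := h4 (e.symm y)
    refine ⟨n, f ∘ e.symm, e ∘ g, e.symm ⁻¹' s, t, hs.preimage H.continuous, hx, ht,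
      fun z hz ↦ hf hz, fun z hz ↦ by simpa using hg hz, fun z hz ↦ ?_, fun z hz ↦ ?_,
      hc.comp H.continuous.continuousOn fun z hz ↦ hz,
      fun m p hpp hps ↦ hp m _ (he' m p hpp) hps, fun m q hqq hqt ↦ he m _ (hq m q hqq hqt)⟩
    · have := hl hz
      simp only [Function.comp_apply] at this ⊢
      rw [this, e.apply_symm_apply]
    · have := hr hz
      simpa using this

theorem IsCompactManifold.prod {X Y : Type*} [DiffeologicalSpace X] [DiffeologicalSpace Y]
    (hX : IsCompactManifold X) (hY : IsCompactManifold Y) : IsCompactManifold (X × Y) := by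
  obtain ⟨τ, h1, h2, h3, h4⟩ := hX
  obtain ⟨τ', k1, k2, k3, k4⟩ := hY
  refine ⟨inferInstance, inferInstance, inferInstance,
    fun n p hp ↦ (h3 n _ hp.1).prodMk (k3 n _ hp.2), fun x ↦ ?_⟩
  obtain ⟨n, f, g, s, t, hs, hx, ht, hf, hg, hl, hr, hc, hp, hq⟩ := h4 x.1
  obtain ⟨n', f', g', s', t', hs', hx', ht', hf', hg', hl', hr', hc', hp', hq'⟩ := k4 x.2
  refine HasChartAt.euclidean (V := EuclideanSpace ℝ (Fin n) × EuclideanSpace ℝ (Fin n'))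
    ⟨Prod.map f f', Prod.map g g', s ×ˢ s', t ×ˢ t', hs.prod hs', ⟨hx, hx'⟩, ht.prod ht',
      hf.prodMap hf', hg.prodMap hg', fun y hy ↦ Prod.ext (hl hy.1) (hl' hy.2),
      fun y hy ↦ Prod.ext (hr hy.1) (hr' hy.2), hc.prodMap hc',
      fun m p hpp hps ↦ (hp m _ hpp.1 fun z ↦ (hps z).1).prodMk
        (hp' m _ hpp.2 fun z ↦ (hps z).2),
      fun m q hqq hqt ↦ ⟨hq m _ hqq.fst fun z ↦ (hqt z).1, hq' m _ hqq.snd fun z ↦ (hqt z).2⟩⟩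

theorem IsCompactManifold.of_finite {X : Type*} [Finite X] :
    @IsCompactManifold X (discreteDiffeology X) := by
  let := discreteDiffeology X
  let τ : TopologicalSpace X := ⊥
  have : DiscreteTopology X := ⟨rfl⟩
  refine ⟨τ, inferInstance, inferInstance, fun n p hp ↦ IsLocallyConstant.continuous hp,
    fun x ↦ ⟨0, fun _ ↦ 0, fun _ ↦ x, {x}, Set.univ, isOpen_discrete _, rfl, isOpen_univ,
      fun _ _ ↦ trivial, fun _ _ ↦ rfl, fun y hy ↦ hy.symm, fun z _ ↦ Subsingleton.elim _ _,
      continuousOn_const, fun n p hp hps ↦ contDiff_const, fun n q hq hqt ↦ isPlot_const⟩⟩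

theorem IsCompactManifold.of_unique {X : Type*} [DiffeologicalSpace X] [Unique X] :
    IsCompactManifold X := by
  let τ : TopologicalSpace X := ⊥
  refine ⟨τ, inferInstance, inferInstance, fun n p hp ↦ ?_,
    fun x ↦ ⟨0, fun _ ↦ 0, fun _ ↦ x, Set.univ, Set.univ, isOpen_univ, trivial, isOpen_univ,
      fun _ _ ↦ trivial, fun _ _ ↦ trivial, fun y hy ↦ Subsingleton.elim _ _,
      fun z _ ↦ Subsingleton.elim _ _,
      continuousOn_const, fun n p hp hps ↦ contDiff_const, fun n q hq hqt ↦ isPlot_const⟩⟩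
  have : p = fun _ ↦ default := funext fun _ ↦ Subsingleton.elim _ _
  rw [this]
  exact continuous_const

/-- The product of a family of types, to be endowed with the product diffeology. -/
def DPi {ι : Type*} (X : ι → Type*) : Type _ := ∀ i, X i

instance {ι : Type*} (X : ι → Type*) [∀ i, DiffeologicalSpace (X i)] :
    DiffeologicalSpace (DPi X) where
  plots n := {p | ∀ i, IsPlot (fun t ↦ p t i)}
  constant_plots x := fun _ ↦ isPlot_const
  plot_reparam hp hf := fun i ↦ isPlot_reparam (hp i) hf
  locality {n p} hp := fun i ↦ DiffeologicalSpace.locality (X := X i) fun x ↦ by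
    obtain ⟨s, hs, hxs, h⟩ := hp x
    exact ⟨s, hs, hxs, fun hf hf' ↦ h hf hf' i⟩

/-- Splitting off the first factor of a product over `Option ι`. -/
def DPi.optionEquiv {ι : Type*} (X : Option ι → Type*) :
    X none × DPi (fun i ↦ X (some i)) ≃ DPi X where
  toFun p := fun o ↦ match o with
    | none => p.1
    | some i => p.2 i
  invFun p := (p none, fun i ↦ p (some i))
  left_inv _ := rfl
  right_inv p := by
    funext o
    cases o <;> rfl

theorem DPi.dSmooth_optionEquiv {ι : Type*} (X : Option ι → Type*)
    [∀ i, DiffeologicalSpace (X i)] : DSmooth (DPi.optionEquiv X) := by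
  intro n p hp o
  cases o with
  | none => exact hp.1
  | some i => exact hp.2 i

theorem DPi.dSmooth_optionEquiv_symm {ι : Type*} (X : Option ι → Type*)
    [∀ i, DiffeologicalSpace (X i)] : DSmooth (DPi.optionEquiv X).symm :=
  fun _ _ hp ↦ ⟨hp none, fun i ↦ hp (some i)⟩

/-- Reindexing a product. -/
def DPi.congrEquiv {ι κ : Type*} (e : ι ≃ κ) (X : κ → Type*) :
    DPi (fun i ↦ X (e i)) ≃ DPi X :=
  Equiv.piCongrLeft X e

theorem DPi.dSmooth_congrEquiv {ι κ : Type*} (e : ι ≃ κ) (X : κ → Type*)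
    [∀ i, DiffeologicalSpace (X i)] : DSmooth (DPi.congrEquiv e X) := by
  intro n p hp k
  obtain ⟨i, rfl⟩ := e.surjective k
  have : (fun t ↦ (DPi.congrEquiv e X ∘ p) t (e i)) = fun t ↦ p t i := by
    funext t
    exact Equiv.piCongrLeft_apply_apply X e (p t) i
  rw [this]
  exact hp i

theorem DPi.dSmooth_congrEquiv_symm {ι κ : Type*} (e : ι ≃ κ) (X : κ → Type*)
    [∀ i, DiffeologicalSpace (X i)] : DSmooth (DPi.congrEquiv e X).symm :=
  fun _ _ hp i ↦ hp (e i)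

theorem IsCompactManifold.pi {ι : Type*} [Finite ι] (X : ι → Type w)
    [∀ i, DiffeologicalSpace (X i)] (h : ∀ i, IsCompactManifold (X i)) :
    IsCompactManifold (DPi X) := by
  cases nonempty_fintype ι
  revert X
  refine Fintype.induction_empty_option (P := fun ι _ ↦ ∀ (X : ι → Type w)
    [∀ i, DiffeologicalSpace (X i)], (∀ i, IsCompactManifold (X i)) → IsCompactManifold (DPi X))
    ?_ ?_ ?_ ι
  · intro α β _ e ih X _ h
    exact (ih (fun i ↦ X (e i)) fun i ↦ h (e i)).of_diffeo (DPi.congrEquiv e X)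
      (DPi.dSmooth_congrEquiv e X) (DPi.dSmooth_congrEquiv_symm e X)
  · intro X _ _
    have : Unique (DPi X) := Pi.uniqueOfIsEmpty X
    exact .of_unique
  · intro α _ ih X _ h
    exact ((h none).prod (ih (fun i ↦ X (some i)) fun i ↦ h (some i))).of_diffeo
      (DPi.optionEquiv X) (DPi.dSmooth_optionEquiv X) (DPi.dSmooth_optionEquiv_symm X)

theorem IsCompactManifold.piConst {ι : Type*} [Finite ι] {X : Type*} [DiffeologicalSpace X]
    (h : IsCompactManifold X) : IsCompactManifold (ι → X) :=
  (IsCompactManifold.pi (fun _ : ι ↦ X) fun _ ↦ h).of_diffeo (Equiv.refl _)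
    (fun _ _ hp ↦ hp) (fun _ _ hp ↦ hp)

end Diffeology

theorem Wreath.isCompactManifold {K : Type*} [Group K] [DiffeologicalSpace K] {n : ℕ}
    (h : IsCompactManifold K) : IsCompactManifold (Wreath K n) := by
  have h1 : IsCompactManifold ((Fin n → K) × Equiv.Perm (Fin n)) :=
    h.piConst.prod IsCompactManifold.of_finite
  let e : (Fin n → K) × Equiv.Perm (Fin n) ≃ Wreath K n :=
    { toFun := fun a ↦ (⟨a.1, a.2⟩ : (Fin n → K) ⋊[mulAutArrow] Equiv.Perm (Fin n))
      invFun := fun a ↦ (a.tuple, a.perm)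
      left_inv := fun _ ↦ rfl
      right_inv := fun _ ↦ rfl }
  exact h1.of_diffeo e (fun _ _ hp ↦ hp) (fun _ _ hp ↦ hp)

/-! ## Translation groupoids of locally free actions -/

namespace DiffGroupoid

/-- The identity functor. -/
def Morphism.id (A : DiffGroupoid.{u}) : Morphism A A where
  obj x := x
  arr a := a
  smooth_obj := dSmooth_id
  smooth_arr := dSmooth_id
  src_arr _ := rfl
  tgt_arr _ := rfl
  arr_one _ := rfl
  arr_mul _ := rfl

/-- A smooth functor which is a diffeomorphism on objects and arrows is an essential
equivalence. -/
theorem Morphism.isEssentialEquivalence_of_inverse {A B : DiffGroupoid.{u}} (F : Morphism A B)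
    (hB : IsSubmersion B.tgt) (g₀ : B.Obj → A.Obj) (g₁ : B.Arr → A.Arr) (hg₀ : DSmooth g₀)
    (hg₁ : DSmooth g₁) (hl₀ : Function.LeftInverse g₀ F.obj)
    (hr₀ : Function.RightInverse g₀ F.obj) (hl₁ : Function.LeftInverse g₁ F.arr)
    (hr₁ : Function.RightInverse g₁ F.arr) : F.IsEssentialEquivalence where
  submersion := by
    refine ⟨fun n p hp ↦ B.smooth_tgt n _ hp.1, fun ⟨⟨b, x⟩, hbx⟩ ↦ ?_⟩
    obtain ⟨t, ht, hx, σ, hσ, h1, h2⟩ := hB.2 b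
    -- The object coordinate is forced by the arrow coordinate, so a local section of `B.tgt` is
    -- enough.
    refine ⟨t, ht, hx, fun y ↦ ⟨(σ y, g₀ (B.src (σ y))), (hr₀ _).symm⟩,
      fun n p hp ↦ ⟨hσ n p hp, hg₀ n _ (B.smooth_src n _ (hσ n p hp))⟩, fun y ↦ h1 y, ?_⟩
    refine Subtype.ext (Prod.ext h2 ?_)
    change g₀ (B.src (σ _)) = x
    rw [h2]
    exact (congrArg g₀ hbx).trans (hl₀ x)
  surjective y := ⟨⟨(B.one y, g₀ y), (B.src_one y).trans (hr₀ y).symm⟩, B.tgt_one y⟩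
  fullyFaithful := by
    refine ⟨fun n p hp ↦ ⟨⟨A.smooth_src n p hp, A.smooth_tgt n p hp⟩, F.smooth_arr n p hp⟩,
      fun q ↦ g₁ q.1.2, fun n p hp ↦ hg₁ n _ hp.2, fun a ↦ hl₁ a, fun ⟨⟨⟨x, y⟩, b⟩, h1, h2⟩ ↦ ?_⟩
    refine Subtype.ext (Prod.ext (Prod.ext ?_ ?_) (hr₁ b))
    · apply hl₀.injective
      change F.obj (A.src (g₁ b)) = F.obj x
      rw [← F.src_arr, hr₁, h1]
    · apply hl₀.injective
      change F.obj (A.tgt (g₁ b)) = F.obj y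
      rw [← F.tgt_arr, hr₁, h2]

theorem IsLie.moritaEquivalent {A B : DiffGroupoid.{u}} (hA : A.IsLie) (F : Morphism A B)
    (hF : F.IsEssentialEquivalence) : A.MoritaEquivalent B :=
  ⟨A, hA, .id A, F, Morphism.isEssentialEquivalence_of_inverse _ hA.tgt_submersion id id dSmooth_id
    dSmooth_id (fun _ ↦ rfl) (fun _ ↦ rfl) (fun _ ↦ rfl) (fun _ ↦ rfl), hF⟩

theorem IsLie.moritaEquivalent' {A B : DiffGroupoid.{u}} (hA : A.IsLie) (F : Morphism A B)
    (hF : F.IsEssentialEquivalence) : B.MoritaEquivalent A :=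
  ⟨A, hA, F, .id A, hF, Morphism.isEssentialEquivalence_of_inverse _ hA.tgt_submersion id id
    dSmooth_id dSmooth_id (fun _ ↦ rfl) (fun _ ↦ rfl) (fun _ ↦ rfl) (fun _ ↦ rfl)⟩

end DiffGroupoid

/-- For translation groupoids there are even global sections through each arrow, obtained by
freezing the group element. -/
theorem Diffeology.isSubmersion_of_section {X Y : Type*} [DiffeologicalSpace X]
    [DiffeologicalSpace Y] {f : X → Y} (hf : DSmooth f)
    (h : ∀ x, ∃ σ : Y → X, DSmooth σ ∧ (∀ y, f (σ y) = y) ∧ σ (f x) = x) : IsSubmersion f := by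
  refine ⟨hf, fun x ↦ ?_⟩
  obtain ⟨σ, h1, h2, h3⟩ := h x
  exact ⟨Set.univ, @isOpen_univ _ dTopology, trivial, fun y ↦ σ y.1, fun n p hp ↦ h1 n _ hp,
    fun y ↦ h2 y.1, h3⟩

/-- Locally free actions of compact Lie groups on closed manifolds. -/
structure CompactLocallyFree (K N : Type*) [Group K] [DiffeologicalSpace K]
    [DiffeologicalSpace N] [MulAction K N] : Prop where
  group : IsCompactManifold K
  space : IsCompactManifold N
  finite_stabilizer : ∀ x : N, Finite (MulAction.stabilizer K x)

/-! ### Transport of compact locally free actions along isomorphisms and products -/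

section Transfer

variable {K N : Type*} [Group K] [DiffeologicalSpace K] [DiffeologicalSpace N] [MulAction K N]
  {K₁ N₁ : Type*} [Group K₁] [DiffeologicalSpace K₁] [DiffeologicalSpace N₁] [MulAction K₁ N₁]
  {K₂ N₂ : Type*} [Group K₂] [DiffeologicalSpace K₂] [DiffeologicalSpace N₂] [MulAction K₂ N₂]

theorem CompactLocallyFree.of_equiv (e : K ≃* K₁) (he : DSmooth e) (he' : DSmooth e.symm)
    (f : N ≃ N₁) (hf : DSmooth f) (hf' : DSmooth f.symm)
    (hef : ∀ k x, f (k • x) = e k • f x) (h : CompactLocallyFree K N) :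
    CompactLocallyFree K₁ N₁ where
  group := h.group.of_diffeo e.toEquiv he he'
  space := h.space.of_diffeo f hf hf'
  finite_stabilizer x := by
    have := h.finite_stabilizer (f.symm x)
    refine Finite.of_injective (fun k : MulAction.stabilizer K₁ x ↦
      (⟨e.symm k, f.injective ?_⟩ : MulAction.stabilizer K (f.symm x))) fun a b hab ↦ ?_
    · have := k.2
      rw [MulAction.mem_stabilizer_iff] at this
      simp [hef, this]
    · exact Subtype.ext (e.symm.injective (congrArg Subtype.val hab))

/-- A group acting on a product through an isomorphism with a product. -/
theorem CompactLocallyFree.of_prod (e : K ≃* K₁ × K₂) (he' : DSmooth e.symm)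
    (he : DSmooth e) (f : N ≃ N₁ × N₂) (hf' : DSmooth f.symm) (hf : DSmooth f)
    (hef : ∀ k x, f (k • x) = ((e k).1 • (f x).1, (e k).2 • (f x).2))
    (h₁ : CompactLocallyFree K₁ N₁) (h₂ : CompactLocallyFree K₂ N₂) :
    CompactLocallyFree K N where
  group := (h₁.group.prod h₂.group).of_diffeo e.symm.toEquiv he' he
  space := (h₁.space.prod h₂.space).of_diffeo f.symm hf' hf
  finite_stabilizer x := by
    have := h₁.finite_stabilizer (f x).1
    have := h₂.finite_stabilizer (f x).2
    have key : ∀ k : MulAction.stabilizer K x,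
        ((e k).1 • (f x).1, (e k).2 • (f x).2) = f x := fun k ↦ by
      rw [← hef, MulAction.mem_stabilizer_iff.1 k.2]
    refine Finite.of_injective (fun k : MulAction.stabilizer K x ↦
      ((⟨(e k).1, congrArg Prod.fst (key k)⟩ : MulAction.stabilizer K₁ (f x).1),
        (⟨(e k).2, congrArg Prod.snd (key k)⟩ : MulAction.stabilizer K₂ (f x).2)))
      fun a b hab ↦ ?_
    exact Subtype.ext (e.injective (Prod.ext (congrArg (fun p ↦ p.1.1) hab)
      (congrArg (fun p ↦ p.2.1) hab)))

theorem CompactLocallyFree.of_unique [Unique K] [Unique N] : CompactLocallyFree K N :=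
  ⟨.of_unique, .of_unique, fun _ ↦ inferInstance⟩

end Transfer

/-! ### Values of an invariant at translation groupoids -/

section Translation

variable {K N : Type u} [Group K] [DiffeologicalSpace K] [DiffGroup K]
  [DiffeologicalSpace N] [MulAction K N] [DiffAction K N]
  {K₁ N₁ : Type u} [Group K₁] [DiffeologicalSpace K₁] [DiffGroup K₁]
  [DiffeologicalSpace N₁] [MulAction K₁ N₁] [DiffAction K₁ N₁]
  {K₂ N₂ : Type u} [Group K₂] [DiffeologicalSpace K₂] [DiffGroup K₂]
  [DiffeologicalSpace N₂] [MulAction K₂ N₂] [DiffAction K₂ N₂]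

theorem CompactLocallyFree.isLie (h : CompactLocallyFree K N) :
    (translationGroupoid K N).IsLie where
  obj := h.space.isSmoothManifold
  arr := (h.group.prod h.space).isSmoothManifold
  src_submersion := isSubmersion_of_section (translationGroupoid K N).smooth_src fun x ↦
    ⟨fun y ↦ (x.1, y), fun _ _ hp ↦ ⟨isPlot_const, hp⟩, fun _ ↦ rfl, rfl⟩
  tgt_submersion := isSubmersion_of_section (translationGroupoid K N).smooth_tgt fun x ↦
    ⟨fun y : N ↦ ((x.1 : K), (x.1 : K)⁻¹ • y), fun _ _ hp ↦ ⟨isPlot_const, isPlot_smul isPlot_const hp⟩,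
      fun y : N ↦ smul_inv_smul (x.1 : K) y,
      Prod.ext rfl (inv_smul_smul (x.1 : K) (x.2 : N))⟩

theorem CompactLocallyFree.isClosedQuotientOrbifold (h : CompactLocallyFree K N) :
    IsClosedQuotientOrbifold (translationGroupoid K N) :=
  ⟨h.isLie, K, N, inferInstance, inferInstance, inferInstance, inferInstance, inferInstance,
    inferInstance, h.group.isSmoothManifold, h.group.compactSpace, h.space.isSmoothManifold,
    h.space.compactSpace, h.finite_stabilizer, h.isLie.moritaEquivalent (.id _)
      (DiffGroupoid.Morphism.isEssentialEquivalence_of_inverse _ h.isLie.tgt_submersion id id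
        dSmooth_id dSmooth_id (fun _ ↦ rfl) (fun _ ↦ rfl) (fun _ ↦ rfl) (fun _ ↦ rfl))⟩

variable {R : Type v} [CommRing R] (φ : MultiplicativeOrbifoldInvariant.{u} R)

namespace MultiplicativeOrbifoldInvariant

theorem eval_of_isEmpty [IsEmpty N] : φ.eval (translationGroupoid K N) = 0 :=
  if_pos ‹IsEmpty N›

theorem eval_of_nonempty [Nonempty N] :
    φ.eval (translationGroupoid K N) = φ.toFun (translationGroupoid K N) :=
  if_neg (not_isEmpty_iff.2 ‹Nonempty N›)

/-- An equivariant diffeomorphism is an isomorphism of translation groupoids, hence a Morita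
equivalence. The empty case is separate because there `eval` ignores `toFun`. -/
theorem eval_congr (e : K ≃* K₁) (he : DSmooth e) (he' : DSmooth e.symm)
    (f : N ≃ N₁) (hf : DSmooth f) (hf' : DSmooth f.symm)
    (hef : ∀ k x, f (k • x) = e k • f x) (h : CompactLocallyFree K N) :
    φ.eval (translationGroupoid K N) = φ.eval (translationGroupoid K₁ N₁) := by
  have h₁ := h.of_equiv e he he' f hf hf' hef
  rcases isEmpty_or_nonempty N with hN | hN
  · have : IsEmpty N₁ := f.symm.isEmpty
    rw [eval_of_isEmpty, eval_of_isEmpty]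
  · have : Nonempty N₁ := f.symm.nonempty
    rw [eval_of_nonempty, eval_of_nonempty]
    let F : DiffGroupoid.Morphism (translationGroupoid K N) (translationGroupoid K₁ N₁) :=
      { obj := f
        arr := fun a ↦ (e a.1, f a.2)
        smooth_obj := hf
        smooth_arr := fun n p hp ↦ ⟨he n _ hp.1, hf n _ hp.2⟩
        src_arr := fun _ ↦ rfl
        tgt_arr := fun a ↦ (hef a.1 a.2).symm
        arr_one := fun x ↦ Prod.ext (map_one e) rfl
        arr_mul := fun p ↦ Prod.ext (map_mul e _ _) rfl }
    refine φ.morita _ _ h.isClosedQuotientOrbifold h₁.isClosedQuotientOrbifold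
      (h.isLie.moritaEquivalent F ?_)
    exact F.isEssentialEquivalence_of_inverse h₁.isLie.tgt_submersion f.symm
      (fun a ↦ (e.symm a.1, f.symm a.2)) hf' (fun n p hp ↦ ⟨he' n _ hp.1, hf' n _ hp.2⟩)
      f.symm_apply_apply f.apply_symm_apply
      (fun a ↦ Prod.ext (e.symm_apply_apply _) (f.symm_apply_apply _))
      (fun a ↦ Prod.ext (e.apply_symm_apply _) (f.apply_symm_apply _))

theorem eval_eq_mul (e : K ≃* K₁ × K₂) (he' : DSmooth e.symm)
    (he : DSmooth e) (f : N ≃ N₁ × N₂) (hf' : DSmooth f.symm) (hf : DSmooth f)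
    (hef : ∀ k x, f (k • x) = ((e k).1 • (f x).1, (e k).2 • (f x).2))
    (h₁ : CompactLocallyFree K₁ N₁) (h₂ : CompactLocallyFree K₂ N₂) :
    φ.eval (translationGroupoid K N) =
      φ.eval (translationGroupoid K₁ N₁) * φ.eval (translationGroupoid K₂ N₂) := by
  have h := CompactLocallyFree.of_prod e he' he f hf' hf hef h₁ h₂
  -- The convention of value `0` at the empty groupoid is itself multiplicative: a product is empty
  -- iff a factor is.
  rcases isEmpty_or_nonempty N₁ with hN₁ | hN₁
  · have : IsEmpty N := f.isEmpty
    rw [eval_of_isEmpty, eval_of_isEmpty, zero_mul]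
  rcases isEmpty_or_nonempty N₂ with hN₂ | hN₂
  · have : IsEmpty N := f.isEmpty
    rw [eval_of_isEmpty, eval_of_isEmpty (N := N₂), mul_zero]
  have : Nonempty N := f.nonempty
  rw [eval_of_nonempty, eval_of_nonempty, eval_of_nonempty,
    ← φ.map_prod _ _ h₁.isClosedQuotientOrbifold h₂.isClosedQuotientOrbifold]
  set B := (translationGroupoid K₁ N₁).prod (translationGroupoid K₂ N₂) with hB
  have hBL : B.IsLie :=
    { obj := (h₁.space.prod h₂.space).isSmoothManifold
      arr := ((h₁.group.prod h₁.space).prod (h₂.group.prod h₂.space)).isSmoothManifold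
      src_submersion := isSubmersion_of_section B.smooth_src fun x ↦
        ⟨fun y ↦ ((x.1.1, y.1), (x.2.1, y.2)),
          fun _ _ hp ↦ ⟨⟨isPlot_const, hp.1⟩, ⟨isPlot_const, hp.2⟩⟩, fun _ ↦ rfl, rfl⟩
      tgt_submersion := isSubmersion_of_section B.smooth_tgt fun x ↦
        ⟨fun y : N₁ × N₂ ↦ (((x.1.1 : K₁), (x.1.1 : K₁)⁻¹ • y.1),
            ((x.2.1 : K₂), (x.2.1 : K₂)⁻¹ • y.2)),
          fun _ _ hp ↦ ⟨⟨isPlot_const, isPlot_smul isPlot_const hp.1⟩,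
            ⟨isPlot_const, isPlot_smul isPlot_const hp.2⟩⟩,
          fun y : N₁ × N₂ ↦
            Prod.ext (smul_inv_smul (x.1.1 : K₁) y.1) (smul_inv_smul (x.2.1 : K₂) y.2),
          Prod.ext (Prod.ext rfl (inv_smul_smul (x.1.1 : K₁) (x.1.2 : N₁)))
            (Prod.ext rfl (inv_smul_smul (x.2.1 : K₂) (x.2.2 : N₂)))⟩ }
  let F : DiffGroupoid.Morphism (translationGroupoid K N) B :=
    { obj := f
      arr := fun a ↦ (((e a.1).1, (f a.2).1), ((e a.1).2, (f a.2).2))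
      smooth_obj := hf
      smooth_arr := fun n p hp ↦ ⟨⟨(he n _ hp.1).1, (hf n _ hp.2).1⟩,
        ⟨(he n _ hp.1).2, (hf n _ hp.2).2⟩⟩
      src_arr := fun _ ↦ rfl
      tgt_arr := fun a ↦ (hef a.1 a.2).symm
      arr_one := fun x ↦ by
        have h1 : (e 1).1 = 1 := congrArg Prod.fst (map_one e)
        have h2 : (e 1).2 = 1 := congrArg Prod.snd (map_one e)
        exact Prod.ext (Prod.ext h1 rfl) (Prod.ext h2 rfl)
      arr_mul := fun p ↦ by
        have h1 : (e ((p.1.1.1 : K) * p.1.2.1)).1 = (e p.1.1.1).1 * (e p.1.2.1).1 :=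
          congrArg Prod.fst (map_mul e _ _)
        have h2 : (e ((p.1.1.1 : K) * p.1.2.1)).2 = (e p.1.1.1).2 * (e p.1.2.1).2 :=
          congrArg Prod.snd (map_mul e _ _)
        exact Prod.ext (Prod.ext h1 rfl) (Prod.ext h2 rfl) }
  have hF : F.IsEssentialEquivalence :=
    F.isEssentialEquivalence_of_inverse hBL.tgt_submersion f.symm
      (fun a ↦ (e.symm (a.1.1, a.2.1), f.symm (a.1.2, a.2.2))) hf'
      (fun n p hp ↦ ⟨he' n (fun t ↦ ((p t).1.1, (p t).2.1)) ⟨hp.1.1, hp.2.1⟩,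
        hf' n (fun t ↦ ((p t).1.2, (p t).2.2)) ⟨hp.1.2, hp.2.2⟩⟩)
      f.symm_apply_apply f.apply_symm_apply
      (fun a ↦ Prod.ext (e.symm_apply_apply _) (f.symm_apply_apply _))
      (fun a ↦ by
        have h1 := e.apply_symm_apply (a.1.1, a.2.1)
        have h2 := f.apply_symm_apply (a.1.2, a.2.2)
        have h11 : (e (e.symm (a.1.1, a.2.1))).1 = a.1.1 := congrArg Prod.fst h1
        have h12 : (e (e.symm (a.1.1, a.2.1))).2 = a.2.1 := congrArg Prod.snd h1
        have h21 : (f (f.symm (a.1.2, a.2.2))).1 = a.1.2 := congrArg Prod.fst h2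
        have h22 : (f (f.symm (a.1.2, a.2.2))).2 = a.2.2 := congrArg Prod.snd h2
        exact Prod.ext (Prod.ext h11 h21) (Prod.ext h12 h22))
  refine φ.morita _ _ h.isClosedQuotientOrbifold ?_ (h.isLie.moritaEquivalent F hF)
  -- The product groupoid `B` is not literally a translation groupoid, but it is presented by `N ⋊
  -- K` through `F`.
  exact ⟨hBL, K, N, inferInstance, inferInstance, inferInstance, inferInstance, inferInstance,
    inferInstance, h.group.isSmoothManifold, h.group.compactSpace, h.space.isSmoothManifold,
    h.space.compactSpace, h.finite_stabilizer, h.isLie.moritaEquivalent' F hF⟩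

end MultiplicativeOrbifoldInvariant

end Translation

/-! ### Products of families of actions -/

section Pi

variable {ι : Type*} (K N : ι → Type*) [∀ i, Group (K i)] [∀ i, DiffeologicalSpace (K i)]
  [∀ i, DiffeologicalSpace (N i)] [∀ i, MulAction (K i) (N i)]

instance : Group (DPi K) := inferInstanceAs (Group (∀ i, K i))

instance [∀ i, DiffGroup (K i)] : DiffGroup (DPi K) where
  smooth_mul := fun _ _ hp i ↦ isPlot_mul (hp.1 i) (hp.2 i)
  smooth_inv := fun _ _ hp i ↦ isPlot_inv (hp i)

instance : MulAction (DPi K) (DPi N) where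
  smul k x := fun i ↦ k i • x i
  one_smul x := funext fun i ↦ one_smul (K i) (x i)
  mul_smul k l x := funext fun i ↦ mul_smul (k i) (l i) (x i)

instance [∀ i, DiffAction (K i) (N i)] : DiffAction (DPi K) (DPi N) where
  smooth_smul := fun _ _ hp i ↦ isPlot_smul (hp.1 i) (hp.2 i)

end Pi

/-! ### The value at a point and finite products -/

namespace MultiplicativeOrbifoldInvariant

variable {R : Type v} [CommRing R] (φ : MultiplicativeOrbifoldInvariant.{u} R)

instance instDiffeologyPUnit : DiffeologicalSpace PUnit.{u + 1} := discreteDiffeology _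

instance : DiffGroup PUnit.{u + 1} where
  smooth_mul := fun _ _ _ ↦ isPlot_const (x := PUnit.unit)
  smooth_inv := fun _ _ _ ↦ isPlot_const (x := PUnit.unit)

instance : DiffAction PUnit.{u + 1} PUnit.{u + 1} where
  smooth_smul := fun _ _ _ ↦ isPlot_const (x := PUnit.unit)

/-- The value at a point. -/
noncomputable def pointValue : R :=
  φ.eval (translationGroupoid PUnit.{u + 1} PUnit.{u + 1})

theorem eval_of_unique {K N : Type u} [Group K] [DiffeologicalSpace K] [DiffGroup K]
    [DiffeologicalSpace N] [MulAction K N] [DiffAction K N] [Unique K] [Unique N] :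
    φ.eval (translationGroupoid K N) = φ.pointValue :=
  φ.eval_congr (MulEquiv.ofUnique : K ≃* PUnit) (fun _ _ _ ↦ isPlot_const (x := PUnit.unit))
    (fun _ _ _ ↦ isPlot_const (x := default)) (Equiv.ofUnique N PUnit)
    (fun _ _ _ ↦ isPlot_const (x := PUnit.unit)) (fun _ _ _ ↦ isPlot_const (x := default))
    (fun _ _ ↦ Subsingleton.elim _ _) .of_unique

/-- A point times `N ⋊ K` is again `N ⋊ K`. This is all that is known about `pointValue`: the zero
invariant shows that it need not be `1`. -/
theorem pointValue_mul_eval {K N : Type u} [Group K] [DiffeologicalSpace K] [DiffGroup K]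
    [DiffeologicalSpace N] [MulAction K N] [DiffAction K N] (h : CompactLocallyFree K N) :
    φ.pointValue * φ.eval (translationGroupoid K N) = φ.eval (translationGroupoid K N) := by
  symm
  refine φ.eval_eq_mul (K₁ := PUnit) (N₁ := PUnit) (MulEquiv.uniqueProd.symm : K ≃* PUnit × K)
    (fun _ _ hp ↦ hp.2) (fun _ _ hp ↦ ⟨isPlot_const, hp⟩) ((Equiv.punitProd N).symm)
    (fun _ _ hp ↦ hp.2) (fun _ _ hp ↦ ⟨isPlot_const, hp⟩) (fun _ _ ↦ rfl) .of_unique h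

theorem pointValue_mul_self : φ.pointValue * φ.pointValue = φ.pointValue :=
  φ.pointValue_mul_eval .of_unique

/-- Induction on `ι`, splitting off one factor at a time. The factor `pointValue` is the value of
the empty product and matters only there, since it is absorbed by any other factor. -/
theorem eval_pi {ι : Type u} [Fintype ι] (K N : ι → Type u) [∀ i, Group (K i)]
    [∀ i, DiffeologicalSpace (K i)] [∀ i, DiffGroup (K i)]
    [∀ i, DiffeologicalSpace (N i)] [∀ i, MulAction (K i) (N i)] [∀ i, DiffAction (K i) (N i)]
    (h : ∀ i, CompactLocallyFree (K i) (N i)) :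
    CompactLocallyFree (DPi K) (DPi N) ∧ φ.eval (translationGroupoid (DPi K) (DPi N)) =
      φ.pointValue * ∏ i, φ.eval (translationGroupoid (K i) (N i)) := by
  revert K N
  refine Fintype.induction_empty_option (P := fun ι _ ↦ ∀ (K N : ι → Type u) [∀ i, Group (K i)]
    [∀ i, DiffeologicalSpace (K i)] [∀ i, DiffGroup (K i)]
    [∀ i, DiffeologicalSpace (N i)] [∀ i, MulAction (K i) (N i)] [∀ i, DiffAction (K i) (N i)],
    (∀ i, CompactLocallyFree (K i) (N i)) →
    CompactLocallyFree (DPi K) (DPi N) ∧ φ.eval (translationGroupoid (DPi K) (DPi N)) =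
      φ.pointValue * ∏ i, φ.eval (translationGroupoid (K i) (N i))) ?_ ?_ ?_ ι
  · intro α β _ e ih K N _ _ _ _ _ _ h
    let _ := Fintype.ofEquiv β e.symm
    obtain ⟨h1, h2⟩ := ih (fun i ↦ K (e i)) (fun i ↦ N (e i)) fun i ↦ h (e i)
    let E : DPi (fun i ↦ K (e i)) ≃* DPi K :=
      { DPi.congrEquiv e K with
        map_mul' := fun a b ↦ by
          apply (DPi.congrEquiv e K).symm.injective
          change (DPi.congrEquiv e K).symm ((DPi.congrEquiv e K) _) = _
          rw [Equiv.symm_apply_apply]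
          funext i
          change a i * b i = (DPi.congrEquiv e K) a (e i) * (DPi.congrEquiv e K) b (e i)
          simp only [DPi.congrEquiv]
          erw [Equiv.piCongrLeft_apply_apply, Equiv.piCongrLeft_apply_apply] }
    have hE : ∀ k x, DPi.congrEquiv e N (k • x) = E k • DPi.congrEquiv e N x := fun k x ↦ by
      apply (DPi.congrEquiv e N).symm.injective
      rw [Equiv.symm_apply_apply]
      funext i
      change k i • x i = (DPi.congrEquiv e K) k (e i) • (DPi.congrEquiv e N) x (e i)
      simp only [DPi.congrEquiv]
      erw [Equiv.piCongrLeft_apply_apply, Equiv.piCongrLeft_apply_apply]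
    refine ⟨h1.of_equiv E (DPi.dSmooth_congrEquiv e K) (DPi.dSmooth_congrEquiv_symm e K)
      (DPi.congrEquiv e N) (DPi.dSmooth_congrEquiv e N) (DPi.dSmooth_congrEquiv_symm e N) hE, ?_⟩
    rw [← φ.eval_congr E (DPi.dSmooth_congrEquiv e K) (DPi.dSmooth_congrEquiv_symm e K)
      (DPi.congrEquiv e N) (DPi.dSmooth_congrEquiv e N) (DPi.dSmooth_congrEquiv_symm e N) hE h1, h2]
    congr 1
    exact Fintype.prod_equiv e _ _ fun _ ↦ rfl
  · intro K N _ _ _ _ _ _ _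
    have : Unique (DPi K) := Pi.uniqueOfIsEmpty K
    have : Unique (DPi N) := Pi.uniqueOfIsEmpty N
    exact ⟨.of_unique, by rw [φ.eval_of_unique]; simp⟩
  · intro α _ ih K N _ _ _ _ _ _ h
    obtain ⟨h1, h2⟩ := ih (fun i ↦ K (some i)) (fun i ↦ N (some i)) fun i ↦ h (some i)
    let E : DPi K ≃* K none × DPi (fun i ↦ K (some i)) :=
      { (DPi.optionEquiv K).symm with map_mul' := fun a b ↦ rfl }
    have hE : ∀ k x, (DPi.optionEquiv N).symm (k • x) =
      ((E k).1 • ((DPi.optionEquiv N).symm x).1, (E k).2 • ((DPi.optionEquiv N).symm x).2) :=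
      fun _ _ ↦ rfl
    refine ⟨.of_prod E (DPi.dSmooth_optionEquiv K) (DPi.dSmooth_optionEquiv_symm K)
      (DPi.optionEquiv N).symm (DPi.dSmooth_optionEquiv N) (DPi.dSmooth_optionEquiv_symm N) hE
      (h none) h1, ?_⟩
    rw [φ.eval_eq_mul E (DPi.dSmooth_optionEquiv K) (DPi.dSmooth_optionEquiv_symm K)
      (DPi.optionEquiv N).symm (DPi.dSmooth_optionEquiv N) (DPi.dSmooth_optionEquiv_symm N) hE
      (h none) h1, h2, Fintype.prod_option, mul_left_comm]

end MultiplicativeOrbifoldInvariant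

/-- A stabilizer element consists of a permutation `s` and group elements taking `x (s⁻¹ i)` to `x
i`. Such transporters are empty or cosets of a finite stabilizer. -/
theorem CompactLocallyFree.wreath {K N : Type*} [Group K] [DiffeologicalSpace K]
    [DiffeologicalSpace N] [MulAction K N] (h : CompactLocallyFree K N) (n : ℕ) :
    CompactLocallyFree (Wreath K n) (Fin n → N) where
  group := Wreath.isCompactManifold h.group
  space := h.space.piConst
  finite_stabilizer x := by
    have hfin : ∀ y z : N, Finite {k : K // k • y = z} := fun y z ↦ by
      rcases isEmpty_or_nonempty {k : K // k • y = z} with h1 | ⟨k₀, hk₀⟩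
      · infer_instance
      · have := h.finite_stabilizer y
        refine Finite.of_injective (fun k : {k : K // k • y = z} ↦
          (⟨k₀⁻¹ * k.1, ?_⟩ : MulAction.stabilizer K y)) fun a b hab ↦ ?_
        · rw [MulAction.mem_stabilizer_iff, mul_smul, k.2, ← hk₀, inv_smul_smul]
        · exact Subtype.ext (mul_left_cancel (congrArg Subtype.val hab))
    have h1 : Finite (Σ s : Equiv.Perm (Fin n), ∀ i, {k : K // k • x (s⁻¹ i) = x i}) :=
      inferInstance
    refine Finite.of_injective (fun a : MulAction.stabilizer (Wreath K n) x ↦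
      (⟨a.1.perm, fun i ↦ ⟨a.1.tuple i, congrFun a.2 i⟩⟩ :
        Σ s : Equiv.Perm (Fin n), ∀ i, {k : K // k • x (s⁻¹ i) = x i})) fun a b hab ↦ ?_
    obtain ⟨⟨a, s⟩, ha⟩ := a
    obtain ⟨⟨b, t⟩, hb⟩ := b
    simp only [Sigma.mk.injEq] at hab
    obtain ⟨h2, h3⟩ := hab
    change s = t at h2
    subst h2
    have h4 := eq_of_heq h3
    have : a = b := funext fun i ↦ congrArg Subtype.val (congrFun h4 i)
    subst this
    rfl

/-! ## Frames of bundles over finite sets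

A homomorphism `θ : Γ → G(S_n)` makes `{1, …, n} × G` a `Γ`-`G`-bundle. A frame is a family of
base points of its irreducible components. -/

namespace Wreath

/-! ### The trivial `G`-bundle over `n` points and its automorphisms -/

section Act

variable {G : Type*} [Group G] {n : ℕ}

theorem ext' {a b : Wreath G n} (h : ∀ i, a.perm i = b.perm i)
    (h' : ∀ i, a.tuple (a.perm i) = b.tuple (a.perm i)) : a = b := by
  obtain ⟨a, s⟩ := a
  obtain ⟨b, t⟩ := b
  have h1 : s = t := Equiv.ext h
  have h2 : a = b := funext fun i ↦ by
    have h3 := h' (s.symm i)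
    change a (s (s.symm i)) = b (s (s.symm i)) at h3
    simpa using h3
  rw [h1, h2]

/-- The left action of `G(S_n)` on `{1, …, n} × G`. -/
def act (a : Wreath G n) (q : Fin n × G) : Fin n × G :=
  (a.perm q.1, a.tuple (a.perm q.1) * q.2)

/-- The right action of `G` on `{1, …, n} × G`. -/
def rmul (q : Fin n × G) (g : G) : Fin n × G := (q.1, q.2 * g)

theorem act_one (q : Fin n × G) : act 1 q = q :=
  Prod.ext rfl (one_mul q.2)

theorem act_mul (a b : Wreath G n) (q : Fin n × G) : act (a * b) q = act a (act b q) := by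
  refine Prod.ext rfl ?_
  have h : a.perm⁻¹ (a.perm (b.perm q.1)) = b.perm q.1 := a.perm.symm_apply_apply _
  simp only [act, mul_tuple, mul_perm, Equiv.Perm.coe_mul, Function.comp_apply, h, mul_assoc]

theorem act_rmul (a : Wreath G n) (q : Fin n × G) (g : G) :
    act a (rmul q g) = rmul (act a q) g :=
  Prod.ext rfl (mul_assoc _ _ _).symm

theorem rmul_one (q : Fin n × G) : rmul q 1 = q := Prod.ext rfl (mul_one _)

theorem rmul_rmul (q : Fin n × G) (g h : G) : rmul (rmul q g) h = rmul q (g * h) :=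
  Prod.ext rfl (mul_assoc _ _ _)

theorem rmul_injective (q : Fin n × G) : Function.Injective (rmul q) := fun _ _ h ↦
  mul_left_cancel (congrArg Prod.snd h)

theorem eq_rmul (q : Fin n × G) : q = rmul (q.1, 1) q.2 := Prod.ext rfl (one_mul _).symm

theorem act_inv_act (a : Wreath G n) (q : Fin n × G) : act a⁻¹ (act a q) = q := by
  rw [← act_mul, inv_mul_cancel, act_one]

theorem act_act_inv (a : Wreath G n) (q : Fin n × G) : act a (act a⁻¹ q) = q := by
  rw [← act_mul, mul_inv_cancel, act_one]

theorem ext_act {a b : Wreath G n} (h : ∀ q, act a q = act b q) : a = b := by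
  have h1 : ∀ i, a.perm i = b.perm i := fun i ↦ congrArg Prod.fst (h (i, 1))
  refine ext' h1 fun i ↦ ?_
  have h2 : a.tuple (a.perm i) * 1 = b.tuple (b.perm i) * 1 := congrArg Prod.snd (h (i, 1))
  rw [h1] at h2 ⊢
  exact mul_right_cancel h2

/-- An equivariant bijection is determined by its values at the points `(i, 1)`: their first
coordinates form a permutation and their second coordinates a tuple. -/
theorem exists_act_eq (f f' : Fin n × G → Fin n × G) (hl : Function.LeftInverse f' f)
    (hr : Function.RightInverse f' f) (hf : ∀ q g, f (rmul q g) = rmul (f q) g) :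
    ∃ a : Wreath G n, ∀ q, act a q = f q := by
  have hf' : ∀ q g, f' (rmul q g) = rmul (f' q) g := fun q g ↦ by
    apply hl.injective
    rw [hf, hr, hr]
  have h1 : ∀ q, (f q).1 = (f (q.1, 1)).1 := fun q ↦ by
    conv_lhs => rw [eq_rmul q, hf]
    rfl
  have h1' : ∀ q, (f' q).1 = (f' (q.1, 1)).1 := fun q ↦ by
    conv_lhs => rw [eq_rmul q, hf']
    rfl
  let s : Equiv.Perm (Fin n) :=
    { toFun := fun i ↦ (f (i, 1)).1
      invFun := fun i ↦ (f' (i, 1)).1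
      left_inv := fun i ↦ by dsimp only; rw [← h1', hl]
      right_inv := fun i ↦ by dsimp only; rw [← h1, hr] }
  refine ⟨(⟨fun i ↦ (f (s.symm i, 1)).2, s⟩ : (Fin n → G) ⋊[mulAutArrow] Equiv.Perm (Fin n)),
    fun q ↦ ?_⟩
  conv_rhs => rw [eq_rmul q, hf]
  refine Prod.ext rfl ?_
  change (f (s.symm (s q.1), 1)).2 * q.2 = (f (q.1, 1)).2 * q.2
  rw [Equiv.symm_apply_apply]

variable {Γ : Type*} [Group Γ] (θ : Γ →* Wreath G n)

/-- The commuting actions of `Γ` and `G` on the total space of the bundle of `θ`. -/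
def move (γ : Γ) (g : G) (q : Fin n × G) : Fin n × G := rmul (act (θ γ) q) g

theorem move_move (γ γ' : Γ) (g g' : G) (q : Fin n × G) :
    move θ γ g (move θ γ' g' q) = move θ (γ * γ') (g' * g) q := by
  simp only [move, act_rmul, rmul_rmul, map_mul, act_mul]

theorem move_one (q : Fin n × G) : move θ 1 1 q = q := by
  rw [move, map_one, act_one, rmul_one]

theorem move_eq_iff {γ : Γ} {g : G} {q q' : Fin n × G} :
    move θ γ g q = q' ↔ q = move θ γ⁻¹ g⁻¹ q' := by
  constructor
  · rintro rfl
    rw [move_move, inv_mul_cancel, mul_inv_cancel, move_one]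
  · rintro rfl
    rw [move_move, mul_inv_cancel, inv_mul_cancel, move_one]

theorem rmul_move (γ : Γ) (g g' : G) (q : Fin n × G) :
    rmul (move θ γ g q) g' = move θ γ (g * g') q := rmul_rmul _ _ _

theorem act_move (γ γ' : Γ) (g : G) (q : Fin n × G) :
    act (θ γ) (move θ γ' g q) = move θ (γ * γ') g q := by
  simp only [move, act_rmul, map_mul, act_mul]

theorem act_move_of_commute {a : Wreath G n} {θ' : Γ →* Wreath G n}
    (h : ∀ γ, a * θ γ = θ' γ * a) (γ : Γ) (g : G) (q : Fin n × G) :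
    act a (move θ γ g q) = move θ' γ g (act a q) := by
  simp only [move, act_rmul, ← act_mul, h]

end Act

/-! ### Frames: coordinates, comparison, existence -/

section Frame

variable {Γ : Type*} [Group Γ] {G : Type*} [Group G] {n : ℕ} {B : Type*} {H : B → Subgroup Γ}
  {ρ : ∀ b, H b →* G} {θ θ' : Γ →* Wreath G n} {p p' : B → Fin n × G}

/-- `p` exhibits the bundle of `θ` as the disjoint union of the bundles `Γ ×_{ρ b} G`. -/
structure IsFrame (ρ : ∀ b, H b →* G) (θ : Γ →* Wreath G n) (p : B → Fin n × G) : Prop where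
  act_eq : ∀ b (h : H b), act (θ h) (p b) = rmul (p b) (ρ b h)
  exists_eq : ∀ q, ∃ b γ g, q = move θ γ g (p b)
  eq_of_move : ∀ b b' γ g, move θ γ g (p b) = p b' → b = b' ∧ γ ∈ H b

namespace IsFrame

theorem move_mul (hp : IsFrame ρ θ p) (b : B) (h : H b) (γ : Γ) (g : G) :
    move θ (γ * h) g (p b) = move θ γ (ρ b h * g) (p b) := by
  rw [move, map_mul, act_mul, hp.act_eq, act_rmul, rmul_rmul, move]

/-- A frame gives every point of the total space coordinates `(b, γ, g)`, and their ambiguity is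
exactly the relation defining `Γ ×_ρ G`. -/
theorem move_eq_move_iff (hp : IsFrame ρ θ p) {b b' : B} {γ γ' : Γ} {g g' : G} :
    move θ γ g (p b) = move θ γ' g' (p b') ↔
      b = b' ∧ ∃ h : H b, γ = γ' * h ∧ ρ b h * g = g' := by
  constructor
  · intro h
    have h1 : move θ (γ'⁻¹ * γ) (g * g'⁻¹) (p b) = p b' := by
      rw [← move_move, h, move_move, inv_mul_cancel, mul_inv_cancel, move_one]
    obtain ⟨rfl, h2⟩ := hp.eq_of_move _ _ _ _ h1
    refine ⟨rfl, ⟨_, h2⟩, by simp, ?_⟩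
    have h3 : γ = γ' * (⟨_, h2⟩ : H b) := by simp
    rw [h3, hp.move_mul] at h
    exact rmul_injective _ h
  · rintro ⟨rfl, h, rfl, rfl⟩
    rw [hp.move_mul]

theorem comp (hp : IsFrame ρ θ p) {B' : Type*} (f : B' → B) (hf : Function.Bijective f) :
    IsFrame (fun b ↦ ρ (f b)) θ (p ∘ f) where
  act_eq b h := hp.act_eq (f b) h
  exists_eq q := by
    obtain ⟨b, γ, g, h⟩ := hp.exists_eq q
    obtain ⟨b', rfl⟩ := hf.2 b
    exact ⟨b', γ, g, h⟩
  eq_of_move b b' γ g h := by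
    obtain ⟨h1, h2⟩ := hp.eq_of_move _ _ γ g h
    exact ⟨hf.1 h1, h2⟩

theorem act (hp : IsFrame ρ θ p) {a : Wreath G n} (h : ∀ γ, a * θ γ = θ' γ * a) :
    IsFrame ρ θ' (fun b ↦ a.act (p b)) where
  act_eq b x := by rw [← act_mul, ← h, act_mul, hp.act_eq, act_rmul]
  exists_eq q := by
    obtain ⟨b, γ, g, e⟩ := hp.exists_eq (a⁻¹.act q)
    refine ⟨b, γ, g, ?_⟩
    rw [← act_move_of_commute θ h, ← e, act_act_inv]
  eq_of_move b b' γ g e := by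
    rw [← act_move_of_commute θ h] at e
    refine hp.eq_of_move _ _ γ g ?_
    rw [← act_inv_act a (move θ γ g (p b)), e, act_inv_act]

/-- Bundles with frames of the same type are isomorphic. -/
theorem exists_act (hp : IsFrame ρ θ p) (hp' : IsFrame ρ θ' p') :
    ∃ a : Wreath G n, (∀ γ, a * θ γ = θ' γ * a) ∧ ∀ b, a.act (p b) = p' b := by
  -- Send a point to the point with the same coordinates in the other frame. This is well defined
  -- because the ambiguity of coordinates depends only on `ρ`.
  have key : ∀ {θ θ' : Γ →* Wreath G n} {p p' : B → Fin n × G}, IsFrame ρ θ p →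
      IsFrame ρ θ' p' → ∃ f : Fin n × G → Fin n × G,
        ∀ b γ g, f (move θ γ g (p b)) = move θ' γ g (p' b) := by
    intro θ θ' p p' hp hp'
    choose b γ g h using hp.exists_eq
    refine ⟨fun q ↦ move θ' (γ q) (g q) (p' (b q)), fun c δ k ↦ ?_⟩
    exact hp'.move_eq_move_iff.2 (hp.move_eq_move_iff.1 (h _).symm)
  obtain ⟨f, hf⟩ := key hp hp'
  obtain ⟨f', hf'⟩ := key hp' hp
  obtain ⟨a, ha⟩ := exists_act_eq f f' (fun q ↦ by
      obtain ⟨b, γ, g, rfl⟩ := hp.exists_eq q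
      rw [hf, hf']) (fun q ↦ by
      obtain ⟨b, γ, g, rfl⟩ := hp'.exists_eq q
      rw [hf', hf]) (fun q k ↦ by
      obtain ⟨b, γ, g, rfl⟩ := hp.exists_eq q
      rw [rmul_move, hf, hf, rmul_move])
  refine ⟨a, fun δ ↦ ext_act fun q ↦ ?_, fun b ↦ ?_⟩
  · obtain ⟨b, γ, g, rfl⟩ := hp.exists_eq q
    rw [act_mul, act_mul, ha, ha, act_move, hf, hf, act_move]
  · have := hf b 1 1
    rw [move_one, move_one] at this
    rw [ha, this]

/-- Two base points in the same component have conjugate isotropy data. -/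
theorem conj_of_eq_move {B' : Type*} {H' : B' → Subgroup Γ} {ρ' : ∀ b, H' b →* G}
    {p' : B' → Fin n × G} (hp : IsFrame ρ θ p) (hp' : IsFrame ρ' θ p') {b : B} {b' : B'} {γ : Γ}
    {g : G} (h : p b = move θ γ g (p' b')) (x : H b) :
    ∃ y : H' b', (y : Γ) = γ⁻¹ * x * γ ∧ ρ' b' y = g * ρ b x * g⁻¹ := by
  have h1 := hp.act_eq b x
  rw [h, act_move, rmul_move] at h1
  obtain ⟨-, y, hy, hy'⟩ := hp'.move_eq_move_iff.1 h1
  refine ⟨y, ?_, ?_⟩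
  · rw [mul_assoc, hy]; group
  · rw [← hy']; group

theorem mem_iff_of_eq_move {B' : Type*} {H' : B' → Subgroup Γ} {ρ' : ∀ b, H' b →* G}
    {p' : B' → Fin n × G} (hp : IsFrame ρ θ p) (hp' : IsFrame ρ' θ p') {b : B} {b' : B'} {γ : Γ}
    {g : G} (h : p b = move θ γ g (p' b')) (x : Γ) :
    x ∈ H b ↔ γ⁻¹ * x * γ ∈ H' b' := by
  constructor
  · intro hx
    obtain ⟨y, hy, -⟩ := conj_of_eq_move hp hp' h ⟨x, hx⟩
    rw [← hy]
    exact y.2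
  · intro hx
    -- The converse is the same argument with the two frames exchanged.
    have h' := ((move_eq_iff θ).1 h.symm)
    obtain ⟨y, hy, -⟩ := conj_of_eq_move hp' hp h' ⟨_, hx⟩
    have : x = y := by rw [hy]; group
    rw [this]
    exact y.2

/-- The base of a framed bundle, as a `Γ`-set. -/
theorem exists_equiv (hp : IsFrame ρ θ p) : ∃ e : (Σ b, Γ ⧸ H b) ≃ Fin n,
    ∀ (γ : Γ) (x : Σ b, Γ ⧸ H b), e ⟨x.1, γ • x.2⟩ = (θ γ).perm (e x) := by
  let f : (Σ b, Γ ⧸ H b) → Fin n := fun x ↦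
    Quotient.liftOn' x.2 (fun γ ↦ (θ γ).perm (p x.1).1) fun γ γ' h ↦ by
      rw [QuotientGroup.leftRel_apply] at h
      have h1 := congrArg Prod.fst (hp.act_eq x.1 ⟨_, h⟩)
      change (θ (γ⁻¹ * γ')).perm (p x.1).1 = (p x.1).1 at h1
      conv_lhs => rw [← h1]
      rw [← Equiv.Perm.mul_apply, ← mul_perm, ← map_mul, mul_inv_cancel_left]
  have hf : ∀ b (γ : Γ), f ⟨b, (γ : Γ ⧸ H b)⟩ = (θ γ).perm (p b).1 := fun _ _ ↦ rfl
  refine ⟨Equiv.ofBijective f ⟨?_, fun i ↦ ?_⟩, ?_⟩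
  · rintro ⟨b, x⟩ ⟨b', x'⟩ h
    induction x using QuotientGroup.induction_on with | H γ => ?_
    induction x' using QuotientGroup.induction_on with | H γ' => ?_
    rw [hf, hf] at h
    -- Two points of the total space over the same base point differ by a unique right translation,
    -- read off from their second coordinates.
    have h1 : move θ γ 1 (p b) = move θ γ' ((move θ γ' 1 (p b')).2⁻¹ * (move θ γ 1 (p b)).2)
        (p b') := by
      rw [← one_mul (_⁻¹ * _), ← rmul_move]
      exact Prod.ext h (by simp [rmul])
    obtain ⟨rfl, k, hk, -⟩ := hp.move_eq_move_iff.1 h1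
    rw [hk]
    simp
  · obtain ⟨b, γ, g, h⟩ := hp.exists_eq (i, 1)
    exact ⟨⟨b, (γ : Γ ⧸ H b)⟩, (congrArg Prod.fst h).symm⟩
  · rintro γ ⟨b, x⟩
    induction x using QuotientGroup.induction_on with | H γ' => ?_
    change (θ (γ * γ')).perm (p b).1 = (θ γ).perm ((θ γ').perm (p b).1)
    rw [map_mul, mul_perm, Equiv.Perm.mul_apply]

theorem card_eq (hp : IsFrame ρ θ p) : Nat.card (Σ b, Γ ⧸ H b) = n := by
  obtain ⟨e, -⟩ := hp.exists_equiv
  rw [Nat.card_congr e, Nat.card_fin]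

end IsFrame

/-- The bundle with prescribed components. -/
theorem exists_isFrame (ρ : ∀ b, H b →* G) (e : (Σ b, Γ ⧸ H b) ≃ Fin n) :
    ∃ (θ : Γ →* Wreath G n) (p : B → Fin n × G), IsFrame ρ θ p := by
  -- The section `out` of `Γ → Γ/H` turns the left action into an `H`-valued cocycle; its image
  -- under `ρ` is the tuple part of the wanted homomorphism, as in the construction of an induced
  -- representation.
  have hm : ∀ (γ : Γ) (x : Σ b, Γ ⧸ H b), x.2.out⁻¹ * γ * (γ⁻¹ • x.2).out ∈ H x.1 := by
    rintro γ ⟨b, x⟩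
    rw [mul_assoc, ← QuotientGroup.eq]
    change (x.out : Γ ⧸ H b) = ((γ • (γ⁻¹ • x).out : Γ) : Γ ⧸ H b)
    rw [← MulAction.Quotient.smul_coe, QuotientGroup.out_eq', QuotientGroup.out_eq',
      smul_inv_smul]
  let c : Γ → (Σ b, Γ ⧸ H b) → G := fun γ x ↦ ρ x.1 ⟨_, hm γ x⟩
  have hc : ∀ γ δ x, c (γ * δ) x = c γ x * c δ ⟨x.1, γ⁻¹ • x.2⟩ := by
    intro γ δ x
    simp only [c]
    rw [← map_mul]
    congr 1
    refine Subtype.ext ?_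
    simp only [mul_inv_rev, mul_smul, Subgroup.coe_mul]
    group
  let s : Γ →* Equiv.Perm (Σ b, Γ ⧸ H b) :=
    { toFun := fun γ ↦ Equiv.sigmaCongrRight fun b ↦ MulAction.toPerm γ
      map_one' := Equiv.ext fun x ↦ Sigma.ext rfl (heq_of_eq (one_smul Γ x.2))
      map_mul' := fun γ δ ↦ Equiv.ext fun x ↦ by simp [mul_smul] }
  have hs : ∀ γ b x, s γ ⟨b, x⟩ = ⟨b, γ • x⟩ := fun _ _ _ ↦ rfl
  have hs' : ∀ γ b x, (s γ)⁻¹ ⟨b, x⟩ = ⟨b, γ⁻¹ • x⟩ := fun γ b x ↦ by rw [← map_inv, hs]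
  let t : Γ → Wreath G n := fun γ ↦
    (⟨fun i ↦ c γ (e.symm i), e.permCongr (s γ)⟩ :
      (Fin n → G) ⋊[mulAutArrow] Equiv.Perm (Fin n))
  have ht : ∀ γ x, (t γ).tuple (e x) = c γ x := fun γ x ↦ by
    change c γ (e.symm (e x)) = _
    rw [e.symm_apply_apply]
  have ht' : ∀ γ x, (t γ).perm (e x) = e (s γ x) := fun γ x ↦ by
    change e (s γ (e.symm (e x))) = _
    rw [e.symm_apply_apply]
  have hta : ∀ γ b x g, act (t γ) (e ⟨b, x⟩, g) = (e ⟨b, γ • x⟩, c γ ⟨b, γ • x⟩ * g) :=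
    fun γ b x g ↦ by simp only [act, ht', ht, hs]
  let θ : Γ →* Wreath G n := MonoidHom.mk' t fun γ δ ↦ ext_act fun ⟨i, g⟩ ↦ by
    obtain ⟨⟨b, x⟩, rfl⟩ := e.surjective i
    rw [act_mul, hta, hta, hta, hc, mul_smul, mul_assoc, inv_smul_smul]
  have hθ : ∀ γ b x g, act (θ γ) (e ⟨b, x⟩, g) = (e ⟨b, γ • x⟩, c γ ⟨b, γ • x⟩ * g) := hta
  have h1 : ∀ b, ((1 : Γ) : Γ ⧸ H b).out ∈ H b := fun b ↦ by
    have := QuotientGroup.out_eq' ((1 : Γ) : Γ ⧸ H b)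
    rw [eq_comm, QuotientGroup.eq] at this
    simpa using this
  have hsm : ∀ (γ : Γ) (b : B), γ • ((1 : Γ) : Γ ⧸ H b) = (γ : Γ ⧸ H b) := fun γ b ↦ by
    change ((γ * 1 : Γ) : Γ ⧸ H b) = (γ : Γ ⧸ H b)
    rw [mul_one]
  -- The chosen representative of the trivial coset is some element of `H b`, not necessarily `1`;
  -- the second coordinate of the base point corrects for it.
  refine ⟨θ, fun b ↦ (e ⟨b, ((1 : Γ) : Γ ⧸ H b)⟩, (ρ b ⟨_, h1 b⟩)⁻¹), ⟨fun b h ↦ ?_,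
    fun q ↦ ?_, fun b b' γ g h ↦ ?_⟩⟩
  · have h2 : (h : Γ) • ((1 : Γ) : Γ ⧸ H b) = ((1 : Γ) : Γ ⧸ H b) := by
      
      rw [hsm, eq_comm, QuotientGroup.eq, inv_one, one_mul]
      exact h.2
    have h3 : (h : Γ)⁻¹ • ((1 : Γ) : Γ ⧸ H b) = ((1 : Γ) : Γ ⧸ H b) := by
      rw [inv_smul_eq_iff, h2]
    rw [hθ, h2]
    refine Prod.ext rfl ?_
    simp only [c, rmul, h3]
    rw [← map_inv, ← map_mul, ← map_mul]
    congr 1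
    refine Subtype.ext ?_
    simp
  · obtain ⟨i, g⟩ := q
    obtain ⟨⟨b, x⟩, rfl⟩ := e.surjective i
    induction x using QuotientGroup.induction_on with | H γ => ?_
    refine ⟨b, γ, (act (θ γ) (e ⟨b, ((1 : Γ) : Γ ⧸ H b)⟩, (ρ b ⟨_, h1 b⟩)⁻¹)).2⁻¹ * g, ?_⟩
    refine Prod.ext ?_ ?_
    · simp only [move, rmul, hθ, hsm]
    · simp [move, rmul]
  · have h2 := congrArg Prod.fst h
    simp only [move, rmul, hθ, hsm] at h2
    have h3 := e.injective h2
    simp only [Sigma.mk.injEq] at h3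
    obtain ⟨rfl, h4⟩ := h3
    refine ⟨rfl, ?_⟩
    have h5 := eq_of_heq h4
    rw [eq_comm, QuotientGroup.eq] at h5
    simpa using h5

/-- A bundle all of whose components are of a type in a given family has a frame. -/
theorem exists_isFrame_of_forall {I : Type*} {H : I → Subgroup Γ} (ρ : ∀ i, H i →* G)
    (θ : Γ →* Wreath G n)
    (h : ∀ x : Fin n, ∃ (i : I) (q : Fin n × G), (∃ γ, (θ γ).perm x = q.1) ∧
      (∀ γ, γ ∈ H i ↔ (θ γ).perm q.1 = q.1) ∧ ∀ y : H i, act (θ y) q = rmul q (ρ i y)) :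
    ∃ (m : I →₀ ℕ) (p : (Σ i, Fin (m i)) → Fin n × G), IsFrame (fun b ↦ ρ b.1) θ p := by
  classical
  let S : Setoid (Fin n) :=
    { r := fun x y ↦ ∃ γ, (θ γ).perm x = y
      iseqv :=
        { refl := fun x ↦ ⟨1, by rw [map_one, one_perm]; rfl⟩
          symm := fun {x y} ⟨γ, hγ⟩ ↦ ⟨γ⁻¹, by
            rw [map_inv, inv_perm, ← hγ]; exact Equiv.symm_apply_apply _ _⟩
          trans := fun {x y z} ⟨γ, hγ⟩ ⟨δ, hδ⟩ ↦ ⟨δ * γ, by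
            rw [map_mul, mul_perm, Equiv.Perm.mul_apply, hγ, hδ]⟩ } }
  -- One base point and one type for each `Γ`-orbit on `{1, …, n}`; the multiplicity of a type is
  -- its number of orbits.
  choose ty q hq1 hq2 hq3 using fun o : Quotient S ↦ h o.out
  have hqo : ∀ o, Quotient.mk S (q o).1 = o := fun o ↦ by
    obtain ⟨γ, hγ⟩ := hq1 o
    conv_rhs => rw [← o.out_eq]
    exact (Quotient.sound (s := S) ⟨γ, hγ⟩).symm
  let m : I →₀ ℕ := Finsupp.onFinset (Finset.univ.image ty) (fun i ↦ Nat.card {o // ty o = i})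
    fun i hi ↦ by
      have : Nonempty {o // ty o = i} := by
        by_contra hn
        rw [not_nonempty_iff] at hn
        exact hi (Nat.card_of_isEmpty)
      obtain ⟨o, ho⟩ := this
      exact Finset.mem_image.2 ⟨o, Finset.mem_univ _, ho⟩
  let E : ∀ i, Fin (m i) ≃ {o // ty o = i} := fun i ↦ (Finite.equivFin _).symm
  refine ⟨m, fun b ↦ q (E b.1 b.2).1, ⟨?_, fun x ↦ ?_, ?_⟩⟩
  · rintro ⟨i, k⟩ y
    obtain ⟨o, rfl⟩ := E i k
    exact hq3 o y
  · obtain ⟨γ, hγ⟩ := Quotient.exact (s := S) (hqo (Quotient.mk S x.1))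
    let o := Quotient.mk S x.1
    refine ⟨⟨ty o, (E (ty o)).symm ⟨o, rfl⟩⟩, γ, (act (θ γ) (q o)).2⁻¹ * x.2, ?_⟩
    rw [Equiv.apply_symm_apply]
    refine Prod.ext ?_ ?_
    · exact hγ.symm
    · simp [move, rmul]
  · rintro ⟨i, k⟩ ⟨i', k'⟩ γ g e
    have e1 : (θ γ).perm (q (E i k).1).1 = (q (E i' k').1).1 := congrArg Prod.fst e
    have e2 : (E i k).1 = (E i' k').1 := by
      rw [← hqo (E i k).1, ← hqo (E i' k').1]
      exact Quotient.sound (s := S) ⟨γ, e1⟩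
    have e3 : i = i' := by rw [← (E i k).2, ← (E i' k').2, e2]
    subst e3
    have e4 : k = k' := (E i).injective (Subtype.ext e2)
    subst e4
    refine ⟨rfl, ?_⟩
    have := (hq2 (E i k).1 γ).2 e1
    rwa [(E i k).2] at this

end Frame

end Wreath

/-! ### Automorphism groups of framed bundles -/

namespace Wreath

section Isotypic

variable {Γ : Type u} [Group Γ] {G : Type u} [Group G] {n : ℕ} {ι : Type*} {H : ι → Subgroup Γ}
  {ρ : ∀ i, H i →* G} {θ : Γ →* Wreath G n} {m m' : ι → ℕ}
  {p : (Σ i, Fin (m i)) → Fin n × G} {p' : (Σ i, Fin (m' i)) → Fin n × G}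

/-- The bundles `Γ ×_{ρ i} G` are pairwise non-isomorphic. -/
def Separated (ρ : ∀ i, H i →* G) : Prop :=
  ∀ i j (γ : Γ) (g : G), (∀ x, x ∈ H i ↔ γ⁻¹ * x * γ ∈ H j) →
    (∀ x : H i, ∃ y : H j, (y : Γ) = γ⁻¹ * x * γ ∧ ρ j y = g * ρ i x * g⁻¹) → i = j

/-- The action of the isotropy group of `ρ i` on base points of type `i`. -/
def bmove (θ : Γ →* Wreath G n) {i : ι} (t : isotropy (ρ i)) (q : Fin n × G) : Fin n × G :=
  move θ (t.1.1 : Γ)⁻¹ t.1.2 q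

/-- The order is reversed because moving base points is a right action; bundle automorphisms act on
the left and commute with it. -/
theorem bmove_mul {i : ι} (s t : isotropy (ρ i)) (q : Fin n × G) :
    bmove θ (s * t) q = bmove θ t (bmove θ s q) := by
  simp only [bmove, move_move, Subgroup.coe_mul, Prod.fst_mul, Prod.snd_mul, mul_inv_rev]

theorem act_bmove {a : Wreath G n} (h : ∀ γ, a * θ γ = θ γ * a) {i : ι} (t : isotropy (ρ i))
    (q : Fin n × G) : act a (bmove θ t q) = bmove θ t (act a q) :=
  act_move_of_commute θ h _ _ _

/-- Moving a base point by `(u⁻¹, g)` replaces its homomorphism `ρ` by a twist of `ρ`, and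
membership of `(u, g)` in `T_ρ` says that this twist is `ρ` itself. -/
theorem mul_mem_of_mem (hp : IsFrame (fun b ↦ ρ b.1) θ p) {b : Σ i, Fin (m i)}
    (t : isotropy (ρ b.1)) (h : H b.1) :
    act (θ h) (bmove θ t (p b)) = rmul (bmove θ t (p b)) (ρ b.1 h) := by
  have h1 : (h : Γ) * (t.1.1 : Γ)⁻¹ =
      (t.1.1 : Γ)⁻¹ * ((⟨t.1.1 * h * (t.1.1 : Γ)⁻¹, (t.1.1.2 h).1 h.2⟩ : H b.1) : Γ) := by
    simp [mul_assoc]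
  rw [bmove, act_move, h1, hp.move_mul, rmul_move, (mem_isotropy_iff _ t.1).1 t.2 h]
  simp

/-- A base point of one frame lies in some component of the other. Comparing isotropy data makes the
two types conjugate, so they are equal by `Separated`, and the conjugating pair lies in the isotropy
group. -/
theorem exists_bmove (hs : Separated ρ) (hp : IsFrame (fun b ↦ ρ b.1) θ p)
    (hp' : IsFrame (fun b ↦ ρ b.1) θ p') (i : ι) (k : Fin (m i)) :
    ∃ (l : Fin (m' i)) (t : isotropy (ρ i)), p ⟨i, k⟩ = bmove θ t (p' ⟨i, l⟩) := by
  obtain ⟨⟨j, l⟩, γ, g, h⟩ := hp'.exists_eq (p ⟨i, k⟩)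
  have h1 : ∀ x, x ∈ H i ↔ γ⁻¹ * x * γ ∈ H j := IsFrame.mem_iff_of_eq_move hp hp' h
  have h2 : ∀ x : H i, ∃ y : H j, (y : Γ) = γ⁻¹ * x * γ ∧ ρ j y = g * ρ i x * g⁻¹ :=
    IsFrame.conj_of_eq_move hp hp' h
  obtain rfl := hs i j γ g h1 h2
  refine ⟨l, ⟨(⟨γ⁻¹, fun x ↦ ?_⟩, g), (mem_isotropy_iff _ _).2 fun x ↦ ?_⟩, ?_⟩
  · rw [inv_inv]
    exact h1 x
  · obtain ⟨y, hy, hy'⟩ := h2 x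
    rw [← hy']
    congr 1
    refine Subtype.ext ?_
    simp [hy]
  · simpa [bmove] using h

/-- Moving by `(h, ρ h)` fixes the base points of type `i`. This is why `T_ρ` must be divided by `H`
to obtain automorphisms. -/
theorem bmove_eq_iff (hp : IsFrame (fun b ↦ ρ b.1) θ p) {i : ι} {k l : Fin (m i)}
    {s t : isotropy (ρ i)} : bmove θ s (p ⟨i, k⟩) = bmove θ t (p ⟨i, l⟩) ↔
      k = l ∧ BundleAut.mk (ρ i) s = BundleAut.mk (ρ i) t := by
  rw [bmove, bmove, hp.move_eq_move_iff]
  have key : BundleAut.mk (ρ i) s = BundleAut.mk (ρ i) t ↔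
      ∃ h : H i, (s.1.1 : Γ)⁻¹ = (t.1.1 : Γ)⁻¹ * h ∧ ρ i h * s.1.2 = t.1.2 := by
    have h1 : BundleAut.mk (ρ i) s = BundleAut.mk (ρ i) t ↔ t * s⁻¹ ∈ (toIsotropy (ρ i)).range := by
      rw [← QuotientGroup.ker_mk' (toIsotropy (ρ i)).range, MonoidHom.mem_ker, map_mul, map_inv,
        mul_inv_eq_one, eq_comm]
      rfl
    rw [h1]
    constructor
    · rintro ⟨h, hh⟩
      have h2 : toIsotropy (ρ i) h * s = t := by rw [hh]; group
      subst h2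
      exact ⟨h, by simp [toIsotropy], rfl⟩
    · rintro ⟨h, e1, e2⟩
      refine ⟨h, ?_⟩
      rw [eq_mul_inv_iff_mul_eq]
      refine Subtype.ext (Prod.ext (Subtype.ext ?_) e2)
      change (h : Γ) * s.1.1 = t.1.1
      rw [inv_eq_iff_eq_inv] at e1
      rw [e1]
      simp
  rw [key]
  constructor
  · rintro ⟨e, h⟩
    simp only [Sigma.mk.injEq, heq_eq_eq, true_and] at e
    exact ⟨e, h⟩
  · rintro ⟨rfl, h⟩
    exact ⟨rfl, h⟩

/-- The multiplicities of the components are determined by the bundle. -/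
theorem multiplicity_unique (hs : Separated ρ) (hp : IsFrame (fun b ↦ ρ b.1) θ p)
    (hp' : IsFrame (fun b ↦ ρ b.1) θ p') : m = m' := by
  have key : ∀ {m m' : ι → ℕ} {p : (Σ i, Fin (m i)) → Fin n × G}
      {p' : (Σ i, Fin (m' i)) → Fin n × G}, IsFrame (fun b ↦ ρ b.1) θ p →
      IsFrame (fun b ↦ ρ b.1) θ p' → ∀ i, m i ≤ m' i := by
    intro m m' p p' hp hp' i
    choose l t h using exists_bmove hs hp hp' i
    -- Base points of `p` sent to the same component of `p'` lie in one component of the bundle, so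
    -- they coincide.
    have : Function.Injective l := fun k k' e ↦ by
      have h1 : move θ (((t k').1.1 : Γ)⁻¹ * (t k).1.1) ((t k).1.2⁻¹ * (t k').1.2) (p ⟨i, k⟩) =
          p ⟨i, k'⟩ := by
        rw [h k, h k', e, bmove, bmove, move_move, mul_inv_cancel_right, mul_inv_cancel_left]
      have h2 := (hp.eq_of_move _ _ _ _ h1).1
      simpa using h2
    simpa using Fintype.card_le_of_injective l this
  exact funext fun i ↦ le_antisymm (key hp hp' i) (key hp' hp i)

/-- The element `w` of the product of the groups `Aut^{P_ρ i}(S_{m i})` describes the automorphism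
`c` of the framed bundle. -/
def Describes (p : (Σ i, Fin (m i)) → Fin n × G) (θ : Γ →* Wreath G n) (c : Wreath G n)
    (w : DPi fun i ↦ Wreath (BundleAut (ρ i)) (m i)) : Prop :=
  ∀ i (k : Fin (m i)), ∃ t : isotropy (ρ i),
    BundleAut.mk (ρ i) t = (w i).tuple ((w i).perm k) ∧
    act c (p ⟨i, k⟩) = bmove θ t (p ⟨i, (w i).perm k⟩)

theorem mem_homCentralizer {c : Wreath G n} :
    c ∈ homCentralizer θ ↔ ∀ γ, c * θ γ = θ γ * c := by
  rw [Subgroup.mem_centralizer_iff]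
  rw [Set.forall_mem_range]
  exact forall_congr' fun γ ↦ eq_comm

/-- An automorphism carries the frame `p` to another frame of the same bundle; comparing the two
through `exists_bmove` gives a permutation and isotropy elements for each type. -/
theorem exists_describes (hs : Separated ρ) (hp : IsFrame (fun b ↦ ρ b.1) θ p)
    {c : Wreath G n} (hc : c ∈ homCentralizer θ) :
    ∃ w : DPi fun i ↦ Wreath (BundleAut (ρ i)) (m i), Describes p θ c w := by
  have hcp := hp.act (mem_homCentralizer.1 hc)
  choose l t h using exists_bmove hs hcp hp
  have hl : ∀ i, Function.Injective (l i) := fun i k k' e ↦ by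
    have h1 : move θ (((t i k').1.1 : Γ)⁻¹ * (t i k).1.1) ((t i k).1.2⁻¹ * (t i k').1.2)
        (act c (p ⟨i, k⟩)) = act c (p ⟨i, k'⟩) := by
      rw [h i k, h i k', e, bmove, bmove, move_move, mul_inv_cancel_right, mul_inv_cancel_left]
    have h2 := (hcp.eq_of_move _ _ _ _ h1).1
    simpa using h2
  let s : ∀ i, Equiv.Perm (Fin (m i)) := fun i ↦
    Equiv.ofBijective (l i) (Finite.injective_iff_bijective.1 (hl i))
  refine ⟨fun i ↦ (⟨fun j ↦ BundleAut.mk (ρ i) (t i ((s i).symm j)), s i⟩ :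
    (Fin (m i) → BundleAut (ρ i)) ⋊[mulAutArrow] Equiv.Perm (Fin (m i))), fun i k ↦
    ⟨t i k, ?_, h i k⟩⟩
  change _ = BundleAut.mk (ρ i) (t i ((s i).symm (s i k)))
  rw [Equiv.symm_apply_apply]

theorem Describes.eq (hp : IsFrame (fun b ↦ ρ b.1) θ p) {c : Wreath G n}
    {w w' : DPi fun i ↦ Wreath (BundleAut (ρ i)) (m i)} (h : Describes p θ c w)
    (h' : Describes p θ c w') : w = w' := by
  funext i
  have key : ∀ k, (w i).perm k = (w' i).perm k ∧
      (w i).tuple ((w i).perm k) = (w' i).tuple ((w' i).perm k) := fun k ↦ by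
    obtain ⟨t, ht, e⟩ := h i k
    obtain ⟨t', ht', e'⟩ := h' i k
    rw [e, bmove_eq_iff hp] at e'
    exact ⟨e'.1, by rw [← ht, ← ht', e'.2]⟩
  exact ext' (fun k ↦ (key k).1) fun k ↦ by rw [(key k).2, (key k).1]

/-- Pulling the isotropy element of `c'` out of the action of `c` and then using the reversed order
in `bmove_mul` gives the wreath multiplication. -/
theorem Describes.mul {c c' : Wreath G n}
    (hc : c ∈ homCentralizer θ)
    {w w' : DPi fun i ↦ Wreath (BundleAut (ρ i)) (m i)} (h : Describes p θ c w)
    (h' : Describes p θ c' w') : Describes p θ (c * c') (w * w') := by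
  intro i k
  obtain ⟨t', ht', e'⟩ := h' i k
  obtain ⟨t, ht, e⟩ := h i ((w' i).perm k)
  refine ⟨t * t', ?_, ?_⟩
  · change _ = ((w i) * (w' i)).tuple (((w i) * (w' i)).perm k)
    rw [mul_tuple, mul_perm, map_mul, ht, ht', Equiv.Perm.mul_apply]
    congr 2
    exact ((w i).perm.symm_apply_apply _).symm
  · rw [act_mul, e', act_bmove (mem_homCentralizer.1 hc), e, bmove_mul]
    rfl

/-- Permuting and moving the base points as prescribed by `w` yields another frame of the same type
for `θ`, and two such frames are related by an automorphism (`IsFrame.exists_act`). -/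
theorem exists_describes' (hp : IsFrame (fun b ↦ ρ b.1) θ p)
    (w : DPi fun i ↦ Wreath (BundleAut (ρ i)) (m i)) :
    ∃ c ∈ homCentralizer θ, Describes p θ c w := by
  choose t ht using fun i k ↦ BundleAut.mk_surjective (ρ i) ((w i).tuple ((w i).perm k))
  have hp' : IsFrame (fun b ↦ ρ b.1) θ
      (fun b : Σ i, Fin (m i) ↦ bmove θ (t b.1 b.2) (p ⟨b.1, (w b.1).perm b.2⟩)) := by
    refine ⟨fun b h ↦ ?_, fun q ↦ ?_, ?_⟩
    · exact mul_mem_of_mem hp (b := ⟨b.1, (w b.1).perm b.2⟩) (t b.1 b.2) h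
    · obtain ⟨⟨i, l⟩, γ, g, rfl⟩ := hp.exists_eq q
      refine ⟨⟨i, (w i).perm.symm l⟩, γ * (t i ((w i).perm.symm l)).1.1,
        (t i ((w i).perm.symm l)).1.2⁻¹ * g, ?_⟩
      simp only [bmove, move_move, Equiv.apply_symm_apply]
      simp
    · rintro ⟨i, k⟩ ⟨j, l⟩ γ g h
      simp only [bmove, move_move] at h
      obtain ⟨e, x, hx, -⟩ := hp.move_eq_move_iff.1 h
      have e1 : i = j := congrArg Sigma.fst e
      subst e1
      simp only [Sigma.mk.injEq, heq_eq_eq, true_and, EmbeddingLike.apply_eq_iff_eq] at e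
      subst e
      refine ⟨rfl, ?_⟩
      have h1 : γ = ((t i k).1.1 : Γ)⁻¹ * x * ((t i k).1.1 : Γ)⁻¹⁻¹ := by
        change γ * ((t i k).1.1 : Γ)⁻¹ = ((t i k).1.1 : Γ)⁻¹ * x at hx
        rw [← hx]; group
      rw [h1]
      exact ((t i k).1.1⁻¹.2 x).1 x.2
  obtain ⟨c, hc, hcp⟩ := hp.exists_act hp'
  exact ⟨c, mem_homCentralizer.2 hc, fun i k ↦ ⟨t i k, ht i k, hcp ⟨i, k⟩⟩⟩

/-- By equivariance an automorphism is determined by its values at the base points. -/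
theorem Describes.eq' (hp : IsFrame (fun b ↦ ρ b.1) θ p) {c c' : Wreath G n}
    (hc : c ∈ homCentralizer θ) (hc' : c' ∈ homCentralizer θ)
    {w : DPi fun i ↦ Wreath (BundleAut (ρ i)) (m i)} (h : Describes p θ c w)
    (h' : Describes p θ c' w) : c = c' := by
  refine ext_act fun q ↦ ?_
  obtain ⟨⟨i, k⟩, γ, g, rfl⟩ := hp.exists_eq q
  rw [act_move_of_commute θ (mem_homCentralizer.1 hc),
    act_move_of_commute θ (mem_homCentralizer.1 hc')]
  congr 1
  obtain ⟨t, ht, e⟩ := h i k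
  obtain ⟨t', ht', e'⟩ := h' i k
  rw [e, e', bmove_eq_iff hp, ht, ht']
  exact ⟨rfl, rfl⟩

/-- The automorphism group of a framed bundle. -/
theorem exists_centralizerEquiv (hs : Separated ρ) (hp : IsFrame (fun b ↦ ρ b.1) θ p) :
    ∃ e : homCentralizer θ ≃* DPi fun i ↦ Wreath (BundleAut (ρ i)) (m i),
      ∀ c : homCentralizer θ, Describes p θ c (e c) := by
  choose f hf using fun c : homCentralizer θ ↦ exists_describes hs hp c.2
  let F : homCentralizer θ →* DPi fun i ↦ Wreath (BundleAut (ρ i)) (m i) :=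
    MonoidHom.mk' f fun c c' ↦ (hf (c * c')).eq hp ((hf c).mul c.2 (hf c'))
  refine ⟨MulEquiv.ofBijective F ⟨fun c c' h ↦ ?_, fun w ↦ ?_⟩, hf⟩
  · have h1 := hf c'
    rw [← show f c = f c' from h] at h1
    exact Subtype.ext ((hf c).eq' hp c.2 c'.2 h1)
  · obtain ⟨c, hc, h⟩ := exists_describes' hp w
    exact ⟨⟨c, hc⟩, (hf ⟨c, hc⟩).eq hp h⟩

/-! ### Smoothness of the description of centralizers -/

section Smooth

variable [DiffeologicalSpace G]

/-- Smoothness can be tested on the orbit of each `(i, 1)`. The permutation part is locally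
constant, hence constant because Euclidean space is connected. -/
theorem isPlot_tuple_perm {d : ℕ} {c : EuclideanSpace ℝ (Fin d) → Wreath G n}
    (hc : ∀ i, ∀ z, ∃ s : Set (EuclideanSpace ℝ (Fin d)), IsOpen s ∧ z ∈ s ∧
      ∃ g : EuclideanSpace ℝ (Fin d) → G, IsPlot g ∧ ∃ j, ∀ y ∈ s, act (c y) (i, 1) = (j, g y)) :
    IsPlot c := by
  have hperm : ∀ i, ∃ j, ∀ z, (c z).perm i = j := fun i ↦ by
    have : IsLocallyConstant fun z ↦ (c z).perm i := by
      refine (IsLocallyConstant.iff_exists_open _).2 fun z ↦ ?_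
      obtain ⟨s, hs, hz, g, -, j, h⟩ := hc i z
      exact ⟨s, hs, hz, fun y hy ↦ (congrArg Prod.fst (h y hy)).trans
        (congrArg Prod.fst (h z hz)).symm⟩
    exact ⟨(c 0).perm i, fun z ↦
      this.apply_eq_of_isPreconnected isPreconnected_univ trivial trivial⟩
  refine isPlot_iff.2 ⟨fun j ↦ ?_, (c 0).perm, fun z ↦ Equiv.ext fun i ↦ ?_⟩
  · refine DiffeologicalSpace.locality fun z ↦ ?_
    obtain ⟨s, hs, hz, g, hg, j', h⟩ := hc ((c z).perm.symm j) z
    refine ⟨s, hs, hz, fun {k f} hf hfs ↦ ?_⟩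
    have h1 : (fun t ↦ (c t).tuple j) ∘ f = g ∘ f := by
      funext y
      have h2 := congrArg Prod.snd (h (f y) (hf y))
      obtain ⟨j'', hj⟩ := hperm ((c z).perm.symm j)
      have h3 : (c (f y)).perm ((c z).perm.symm j) = j := by
        rw [hj, ← hj z, Equiv.apply_symm_apply]
      simp only [act, h3, mul_one] at h2
      exact h2
    rw [h1]
    exact isPlot_reparam hg hfs
  · obtain ⟨j, hj⟩ := hperm i
    rw [hj, hj]

theorem dSmooth_of_describes [DiffGroup G] (hs : Separated ρ) (hp : IsFrame (fun b ↦ ρ b.1) θ p)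
    {e : homCentralizer θ ≃* DPi fun i ↦ Wreath (BundleAut (ρ i)) (m i)}
    (he : ∀ c : homCentralizer θ, Describes p θ c (e c)) : DSmooth e := by
  intro d c hc i
  obtain ⟨hc1, s, hc2⟩ := isPlot_iff.1 (show IsPlot fun z ↦ (c z).1 from hc)
  -- The target component and the discrete `Γ`-coordinate are frozen at their values at `0`; only
  -- the `G`-coordinate `g z` varies along the plot.
  have key : ∀ k : Fin (m i), ∃ (l : Fin (m i)) (t : EuclideanSpace ℝ (Fin d) → isotropy (ρ i)),
      IsPlot t ∧ ∀ z, act (c z).1 (p ⟨i, k⟩) = bmove θ (t z) (p ⟨i, l⟩) := by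
    intro k
    obtain ⟨l, t, h⟩ := exists_bmove hs (hp.act (mem_homCentralizer.1 (c 0).2)) hp i k
    set q := act (θ (t.1.1 : Γ)⁻¹) (p ⟨i, l⟩) with hq
    let g : EuclideanSpace ℝ (Fin d) → G := fun z ↦
      q.2⁻¹ * ((c z).1.tuple (s (p ⟨i, k⟩).1) * (p ⟨i, k⟩).2)
    have hg : IsPlot g := isPlot_mul isPlot_const (isPlot_mul (hc1 _) isPlot_const)
    have h1 : ∀ z, act (c z).1 (p ⟨i, k⟩) = move θ (t.1.1 : Γ)⁻¹ (g z) (p ⟨i, l⟩) := fun z ↦ by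
      refine Prod.ext ?_ ?_
      · have h2 := congrArg Prod.fst h
        change (c z).1.perm _ = q.1
        change (c 0).1.perm _ = q.1 at h2
        rw [hc2] at h2 ⊢
        exact h2
      · change (c z).1.tuple ((c z).1.perm _) * _ = q.2 * g z
        rw [hc2]
        simp [g]
    -- The isotropy element supplied at `z` may have another `Γ`-coordinate, but it differs from the
    -- frozen pair only by an element of the embedded `H`.
    have h3 : ∀ z, (t.1.1, g z) ∈ isotropy (ρ i) := fun z ↦ by
      obtain ⟨l', t', h'⟩ := exists_bmove hs (hp.act (mem_homCentralizer.1 (c z).2)) hp i k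
      have h4 := h1 z
      have h' : act (c z).1 (p ⟨i, k⟩) = bmove θ t' (p ⟨i, l'⟩) := h'
      rw [h', bmove, hp.move_eq_move_iff] at h4
      obtain ⟨-, x, hx1, hx2⟩ := h4
      have h5 : (t.1.1, g z) = (toIsotropy (ρ i) x * t').1 := by
        refine Prod.ext (Subtype.ext ?_) hx2.symm
        change (t.1.1 : Γ) = x * t'.1.1
        rw [inv_eq_iff_eq_inv] at hx1
        rw [hx1]
        simp
      rw [h5]
      exact (toIsotropy (ρ i) x * t').2
    exact ⟨l, fun z ↦ ⟨(t.1.1, g z), h3 z⟩, ⟨isPlot_const, hg⟩, h1⟩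
  choose l t ht h using key
  have hw : ∀ z k, (e (c z) i).perm k = l k ∧
      (e (c z) i).tuple (l k) = BundleAut.mk (ρ i) (t k z) := fun z k ↦ by
    obtain ⟨t', h1, h2⟩ := he (c z) i k
    rw [h k z, bmove_eq_iff hp] at h2
    exact ⟨h2.1.symm, by rw [h2.2, h1, h2.1]⟩
  refine isPlot_iff.2 ⟨fun j ↦ ?_, (e (c 0) i).perm, fun z ↦ Equiv.ext fun k ↦ ?_⟩
  · have h1 : ∀ z, (e (c z) i).tuple j =
        BundleAut.mk (ρ i) (t ((e (c 0) i).perm.symm j) z) := fun z ↦ by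
      rw [← (hw z _).2]
      congr 1
      rw [← (hw 0 _).1, Equiv.apply_symm_apply]
    change IsPlot fun z ↦ (e (c z) i).tuple j
    simp_rw [h1]
    exact fun z ↦ ⟨_, ht _, Filter.Eventually.of_forall fun _ ↦ rfl⟩
  · exact (hw z k).1.trans (hw 0 k).1.symm

theorem dSmooth_symm_of_describes [DiffGroup G] (hp : IsFrame (fun b ↦ ρ b.1) θ p)
    {e : homCentralizer θ ≃* DPi fun i ↦ Wreath (BundleAut (ρ i)) (m i)}
    (he : ∀ c : homCentralizer θ, Describes p θ c (e c)) : DSmooth e.symm := by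
  intro d w hw
  change IsPlot fun z ↦ (e.symm (w z)).1
  refine isPlot_tuple_perm fun j z ↦ ?_
  obtain ⟨⟨i, k⟩, γ, g, hj⟩ := hp.exists_eq (j, 1)
  obtain ⟨h1, s, h2⟩ := isPlot_iff.1 (hw i)
  -- Plots of the quotient `H \ T_ρ` lift locally to `T_ρ`, and the discrete coordinate of the lift
  -- is constant.
  obtain ⟨t, ht, htw⟩ := h1 (s k) z
  have hu : ∀ y, (t y).1.1 = (t z).1.1 := fun y ↦ by
    have h3 : IsLocallyConstant fun y ↦ (t y).1.1 := ht.1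
    exact h3.apply_eq_of_isPreconnected isPreconnected_univ trivial trivial
  obtain ⟨O, hO, hOo, hzO⟩ := eventually_nhds_iff.1 htw
  have h4 : ∀ y ∈ O, act (e.symm (w y)).1 (j, 1) =
      move θ (γ * ((t z).1.1 : Γ)⁻¹) ((t y).1.2 * g) (p ⟨i, s k⟩) := fun y hy ↦ by
    obtain ⟨t', h5, h6⟩ := he (e.symm (w y)) i k
    rw [hj, act_move_of_commute θ (mem_homCentralizer.1 (e.symm (w y)).2), h6]
    rw [e.apply_symm_apply, h2] at h5
    rw [e.apply_symm_apply, h2, (bmove_eq_iff hp).2 ⟨rfl, h5.trans (hO y hy)⟩, bmove, move_move, hu]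
  set q := act (θ (γ * ((t z).1.1 : Γ)⁻¹)) (p ⟨i, s k⟩) with hq
  refine ⟨O, hOo, hzO, fun y ↦ q.2 * ((t y).1.2 * g),
    isPlot_mul isPlot_const (isPlot_mul ht.2 isPlot_const), q.1, fun y hy ↦ ?_⟩
  rw [h4 y hy]
  rfl

end Smooth

end Isotypic

end Wreath

/-! ### Points of `M^n` as equivariant functions on the total space -/

namespace Wreath

section Evaluation

variable {Γ : Type*} [Group Γ] {G : Type*} [Group G] {n : ℕ} {M : Type*} [MulAction G M]

/-- The equivariant function on `{1, …, n} × G` corresponding to a point of `M^n`. -/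
def ev (x : Fin n → M) (q : Fin n × G) : M := q.2⁻¹ • x q.1

theorem ev_act (a : Wreath G n) (x : Fin n → M) (q : Fin n × G) : ev (a • x) (act a q) = ev x q := by
  have h : a.perm⁻¹ (a.perm q.1) = q.1 := a.perm.symm_apply_apply _
  simp only [ev, act, smul_apply, h, mul_inv_rev, mul_smul, inv_smul_smul]

theorem ev_rmul (x : Fin n → M) (q : Fin n × G) (g : G) : ev x (rmul q g) = g⁻¹ • ev x q := by
  simp only [ev, rmul, mul_inv_rev, mul_smul]

theorem ev_injective : Function.Injective (ev : (Fin n → M) → Fin n × G → M) := fun x y h ↦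
  funext fun i ↦ by
    have := congrFun h (i, 1)
    simpa [ev] using this

/-- In terms of functions on the total space, `θ`-fixed points are the functions that are also
`Γ`-invariant. -/
theorem mem_fixed_iff {θ : Γ →* Wreath G n} {x : Fin n → M} :
    (∀ γ, θ γ • x = x) ↔ ∀ γ q, ev x (act (θ γ) q) = ev x q := by
  refine forall_congr' fun γ ↦ ⟨fun h q ↦ ?_, fun h ↦ ev_injective (G := G) (funext fun q ↦ ?_)⟩
  · conv_lhs => rw [← h]
    rw [ev_act]
  · rw [← act_act_inv (θ γ) q, ev_act, h]

theorem ev_move {θ : Γ →* Wreath G n} (x : fixedSet (Fin n → M) θ) (γ : Γ) (g : G)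
    (q : Fin n × G) : ev x.1 (move θ γ g q) = g⁻¹ • ev x.1 q := by
  rw [move, ev_rmul, mem_fixed_iff.1 x.2]

end Evaluation

/-! ### Sectors as products over component types -/

section Sector

variable {Γ : Type u} [Group Γ] {G : Type u} [Group G] {n : ℕ} {ι : Type*} {H : ι → Subgroup Γ}
  {ρ : ∀ i, H i →* G} {θ : Γ →* Wreath G n} {m : ι → ℕ}
  {p : (Σ i, Fin (m i)) → Fin n × G} (M : Type u) [MulAction G M]

/-- The fixed point set of a framed bundle. -/
theorem exists_fixedEquiv [DiffeologicalSpace G] [DiffeologicalSpace M] [DiffAction G M]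
    (hp : IsFrame (fun b ↦ ρ b.1) θ p) :
    ∃ f : fixedSet (Fin n → M) θ ≃ DPi fun i ↦ (Fin (m i) → fixedSet M (ρ i)),
      (∀ x i k, (f x i k).1 = ev x.1 (p ⟨i, k⟩)) ∧ DSmooth f ∧ DSmooth f.symm := by
  let f : fixedSet (Fin n → M) θ → DPi fun i ↦ (Fin (m i) → fixedSet M (ρ i)) := fun x i k ↦
    ⟨ev x.1 (p ⟨i, k⟩), fun h ↦ by
      have h1 := hp.act_eq ⟨i, k⟩ h
      have h2 := mem_fixed_iff.1 x.2 h (p ⟨i, k⟩)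
      rw [h1, ev_rmul, inv_smul_eq_iff] at h2
      exact h2.symm⟩
  -- The inverse extends values at base points equivariantly. The next claim shows independence of
  -- the chosen coordinates, which holds because the values are fixed by `ρ`.
  choose b γ g hb using fun j : Fin n ↦ hp.exists_eq (j, 1)
  let x : (DPi fun i ↦ (Fin (m i) → fixedSet M (ρ i))) → Fin n → M := fun y j ↦
    (g j)⁻¹ • (y (b j).1 (b j).2).1
  have hx : ∀ y c δ k, ev (x y) (move θ δ k (p c)) = k⁻¹ • (y c.1 c.2).1 := by
    intro y c δ k
    set q := move θ δ k (p c) with hq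
    have h1 : move θ δ k (p c) = move θ (γ q.1) (g q.1 * q.2) (p (b q.1)) := by
      rw [← rmul_move, ← hb, ← eq_rmul]
    obtain ⟨h2, h, -, h3⟩ := hp.move_eq_move_iff.1 h1
    have h4 : ev (x y) q = (g q.1 * q.2)⁻¹ • (y (b q.1).1 (b q.1).2).1 := by
      simp only [ev, x, mul_inv_rev, mul_smul]
    rw [h4, ← h3, ← h2, mul_inv_rev, mul_smul]
    congr 1
    rw [inv_smul_eq_iff]
    exact ((y c.1 c.2).2 h).symm
  have hxf : ∀ y γ, θ γ • x y = x y := fun y ↦ mem_fixed_iff.2 fun δ q ↦ by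
    obtain ⟨c, ε, k, rfl⟩ := hp.exists_eq q
    rw [act_move, hx, hx]
  refine ⟨⟨f, fun y ↦ ⟨x y, hxf y⟩, fun z ↦ Subtype.ext (ev_injective (G := G) (funext fun q ↦ ?_)),
    fun y ↦ funext fun i ↦ funext fun k ↦ Subtype.ext ?_⟩, fun _ _ _ ↦ rfl, ?_, ?_⟩
  · obtain ⟨c, ε, k, rfl⟩ := hp.exists_eq q
    rw [hx, ev_move]
  · have := hx y ⟨i, k⟩ 1 1
    rw [move_one, inv_one, one_smul] at this
    exact this
  · exact fun d z hz i k ↦ isPlot_smul (K := G) (N := M) isPlot_const (hz (p ⟨i, k⟩).1)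
  · exact fun d y hy j ↦ isPlot_smul (K := G) (N := M) isPlot_const (hy (b j).1 (b j).2)

variable {M}

/-- Evaluation is invariant under moving the point of `M^n` and the point of the total space
together, so the action of `c` on values at base points is the one that `w` prescribes. -/
theorem describes_smul [DiffeologicalSpace G] [DiffeologicalSpace M] [DiffAction G M]
    {f : fixedSet (Fin n → M) θ ≃ DPi fun i ↦ (Fin (m i) → fixedSet M (ρ i))}
    (hf : ∀ x i k, (f x i k).1 = ev x.1 (p ⟨i, k⟩)) {c : homCentralizer θ}
    {w : DPi fun i ↦ Wreath (BundleAut (ρ i)) (m i)} (h : Describes p θ c w)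
    (x : fixedSet (Fin n → M) θ) : f (c • x) = w • f x := by
  funext i l
  obtain ⟨k, rfl⟩ := (w i).perm.surjective l
  obtain ⟨t, h1, h2⟩ := h i k
  refine Subtype.ext ?_
  rw [hf]
  change _ = ((w i).tuple ((w i).perm k) • f x i ((w i).perm⁻¹ ((w i).perm k))).1
  have h3 : (w i).perm⁻¹ ((w i).perm k) = k := (w i).perm.symm_apply_apply _
  rw [h3, ← h1, BundleAut.mk_smul, hf]
  have h4 : ev (c • x).1 (act c (p ⟨i, k⟩)) = ev x.1 (p ⟨i, k⟩) := ev_act _ _ _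
  rw [h2, bmove, ev_move, inv_smul_eq_iff] at h4
  exact h4

/-- The two equivalences are compatible with the actions, so `eval_pi` applies. Nonzero
multiplicities ensure that an empty fixed set makes both sides vanish; the manifold hypothesis is
then needed only for nonempty fixed sets. -/
theorem eval_sector {R : Type v} [CommRing R] (φ : MultiplicativeOrbifoldInvariant.{u} R)
    {ι : Type u} [Fintype ι] {H : ι → Subgroup Γ}
    {ρ : ∀ i, H i →* G} {θ : Γ →* Wreath G n} {m : ι → ℕ}
    {p : (Σ i, Fin (m i)) → Fin n × G}
    [DiffeologicalSpace G] [DiffGroup G] [DiffeologicalSpace M] [DiffAction G M]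
    (hs : Separated ρ) (hp : IsFrame (fun b ↦ ρ b.1) θ p) (hm : ∀ i, m i ≠ 0)
    (hρ : ∀ i, Nonempty (fixedSet M (ρ i)) →
      CompactLocallyFree (BundleAut (ρ i)) (fixedSet M (ρ i))) :
    φ.eval (translationGroupoid (homCentralizer θ) (fixedSet (Fin n → M) θ)) =
      φ.pointValue * ∏ i, φ.eval
        (translationGroupoid (Wreath (BundleAut (ρ i)) (m i)) (Fin (m i) → fixedSet M (ρ i))) := by
  obtain ⟨e, he⟩ := exists_centralizerEquiv hs hp
  obtain ⟨f, hf, hf1, hf2⟩ := exists_fixedEquiv M hp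
  by_cases hne : ∀ i, Nonempty (fixedSet M (ρ i))
  · obtain ⟨h1, h2⟩ := φ.eval_pi (fun i ↦ Wreath (BundleAut (ρ i)) (m i))
      (fun i ↦ (Fin (m i) → fixedSet M (ρ i))) fun i ↦ (hρ i (hne i)).wreath (m i)
    rw [← h2]
    symm
    refine φ.eval_congr e.symm (dSmooth_symm_of_describes hp he) (dSmooth_of_describes hs hp he)
      f.symm hf2 hf1 (fun w x ↦ f.injective ?_) h1
    rw [Equiv.apply_symm_apply, describes_smul hf (he _), Equiv.apply_symm_apply,
      MulEquiv.apply_symm_apply]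
  · push Not at hne
    obtain ⟨i, hi⟩ := hne
    have : NeZero (m i) := ⟨hm i⟩
    have h1 : IsEmpty (Fin (m i) → fixedSet M (ρ i)) := ⟨fun y ↦ hi.false (y 0)⟩
    have h2 : IsEmpty (fixedSet (Fin n → M) θ) := ⟨fun x ↦ h1.false (f x i)⟩
    rw [φ.eval_of_isEmpty, Finset.prod_eq_zero (Finset.mem_univ i) (φ.eval_of_isEmpty), mul_zero]

end Sector

end Wreath

/-! ## Power series -/

section PowerSeries

variable {I : Type*} {R : Type*} [CommRing R]

theorem coeff_dilatedSeries (d : ℕ) (a : ℕ → R) (n : ℕ) :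
    PowerSeries.coeff n (dilatedSeries d a) = if d ∣ n then a (n / d) else 0 :=
  PowerSeries.coeff_mk _ _

theorem dilatedSeries_one (a : ℕ → R) : dilatedSeries 1 a = PowerSeries.mk a := by
  ext n
  simp [coeff_dilatedSeries]

/-- The total weight `∑ m i * d i`. -/
def totalWeight (d : I → ℕ) (m : I →₀ ℕ) : ℕ := m.sum fun i k ↦ k * d i

/-- The families of multiplicities of total weight `n`. -/
def weightSet (d : I → ℕ) (n : ℕ) : Set (I →₀ ℕ) := {m | totalWeight d m = n}

/-- Multiplication of the values of `m` by `d`. -/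
noncomputable def scaleFinsupp (d : I → ℕ) (m : I →₀ ℕ) : I →₀ ℕ :=
  Finsupp.onFinset m.support (fun i ↦ m i * d i) fun i hi ↦ by
    rw [Finsupp.mem_support_iff]
    exact left_ne_zero_of_mul hi

theorem scaleFinsupp_apply (d : I → ℕ) (m : I →₀ ℕ) (i : I) : scaleFinsupp d m i = m i * d i := rfl

theorem le_totalWeight (d : I → ℕ) (m : I →₀ ℕ) {i : I} (hi : m i ≠ 0) : d i ≤ totalWeight d m := by
  calc d i ≤ m i * d i := Nat.le_mul_of_pos_left _ (Nat.pos_of_ne_zero hi)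
    _ ≤ totalWeight d m := Finset.single_le_sum (f := fun i ↦ m i * d i) (fun _ _ ↦ Nat.zero_le _)
      (Finsupp.mem_support_iff.2 hi)

theorem scaleFinsupp_mem_finsuppAntidiag [DecidableEq I] {d : I → ℕ} (hd : ∀ i, d i ≠ 0)
    {m : I →₀ ℕ} {S : Finset I} {n : ℕ} :
    scaleFinsupp d m ∈ Finset.finsuppAntidiag S n ↔ totalWeight d m = n ∧ m.support ⊆ S := by
  have h1 : (scaleFinsupp d m).support = m.support := by
    ext i
    simp [scaleFinsupp_apply, hd i]
  rw [Finset.mem_finsuppAntidiag, h1]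
  refine and_congr_left fun h ↦ ?_
  rw [totalWeight, Finsupp.sum, ← Finset.sum_subset h]
  · rfl
  · intro i _ hi
    rw [scaleFinsupp_apply, Finsupp.notMem_support_iff.1 hi, zero_mul]

theorem scaleFinsupp_injective {d : I → ℕ} (hd : ∀ i, d i ≠ 0) :
    Function.Injective (scaleFinsupp d) := fun _ _ h ↦ Finsupp.ext fun i ↦
  Nat.eq_of_mul_eq_mul_right (Nat.pos_of_ne_zero (hd i)) (DFunLike.congr_fun h i)

section Expansion

variable {d : I → ℕ} {a : I → ℕ → R} {e : R}

/-- The coefficients of a finite product of dilated series. -/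
theorem coeff_prod_dilatedSeries [DecidableEq I] (hd : ∀ i, d i ≠ 0) (S : Finset I) (n : ℕ) :
    PowerSeries.coeff n (∏ i ∈ S, dilatedSeries (d i) (a i)) =
      ∑ m ∈ (Finset.finsuppAntidiag S n).preimage (scaleFinsupp d)
        (scaleFinsupp_injective hd).injOn, ∏ i ∈ S, a i (m i) := by
  rw [PowerSeries.coeff_prod, ← Finset.sum_preimage (scaleFinsupp d) (Finset.finsuppAntidiag S n)
    (scaleFinsupp_injective hd).injOn]
  · refine Finset.sum_congr rfl fun m _ ↦ Finset.prod_congr rfl fun i _ ↦ ?_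
    rw [coeff_dilatedSeries, scaleFinsupp_apply, if_pos (Dvd.intro_left _ rfl),
      Nat.mul_div_cancel _ (Nat.pos_of_ne_zero (hd i))]
  -- An exponent family outside the image of the scaling has an exponent not divisible by `d i`, so
  -- its product vanishes.
  · intro l hl hl'
    by_contra h0
    refine hl' ⟨Finsupp.onFinset S (fun i ↦ l i / d i) fun i hi ↦ ?_, Finsupp.ext fun i ↦ ?_⟩
    · refine (Finset.mem_finsuppAntidiag.1 hl).2 (Finsupp.mem_support_iff.2 fun h ↦ hi ?_)
      rw [h, Nat.zero_div]
    · rw [scaleFinsupp_apply, Finsupp.onFinset_apply]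
      by_cases hi : i ∈ S
      · have h1 : PowerSeries.coeff (l i) (dilatedSeries (d i) (a i)) ≠ 0 := fun h ↦
          h0 (Finset.prod_eq_zero hi h)
        rw [coeff_dilatedSeries] at h1
        exact Nat.div_mul_cancel (ite_ne_right_iff.1 h1).1
      · have : l i = 0 := by
          by_contra h
          exact hi ((Finset.mem_finsuppAntidiag.1 hl).2 (Finsupp.mem_support_iff.2 h))
        rw [this, Nat.zero_div, zero_mul]

/-- Factors off the support equal `e`, and the idempotent absorbs its powers. For empty `S` the left
side would be `1` rather than `e`. -/
theorem prod_eq_mul_prod_support (he : e * e = e) (ha0 : ∀ i, a i 0 = e)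
    (hae : ∀ i r, e * a i r = a i r) {S : Finset I} (hS : S.Nonempty) {m : I →₀ ℕ}
    (hm : m.support ⊆ S) : ∏ i ∈ S, a i (m i) = e * ∏ i ∈ m.support, a i (m i) := by
  classical
  have h1 : ∀ T : Finset I, ∏ i ∈ T, a i (m i) = ∏ i ∈ T, (e * a i (m i)) := fun T ↦ by
    simp only [hae]
  have hpow : ∀ k : ℕ, k ≠ 0 → e ^ k = e := fun k hk ↦ IsIdempotentElem.pow_eq he hk
  have h2 : ∏ i ∈ S, a i (m i) = e * ∏ i ∈ S, a i (m i) := by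
    conv_lhs => rw [h1]
    rw [Finset.prod_mul_distrib, Finset.prod_const, hpow _ hS.card_ne_zero]
  rw [h2, ← Finset.prod_sdiff hm, ← mul_assoc]
  congr 1
  rw [Finset.prod_congr rfl (g := fun _ ↦ e) fun i hi ↦ by
    rw [Finsupp.notMem_support_iff.1 (Finset.mem_sdiff.1 hi).2, ha0], Finset.prod_const]
  rcases Nat.eq_zero_or_pos (S \ m.support).card with h | h
  · rw [h, pow_zero, mul_one]
  · rw [hpow _ h.ne', he]

/-- Each index in the support has weight at most the total weight and contributes a nonzero
coefficient of positive degree. -/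
theorem support_subset_of_term_ne_zero
    (hfin : ∀ n, {i | d i ≤ n ∧ ∃ r, r ≠ 0 ∧ a i r ≠ 0}.Finite) {n : ℕ} {m : I →₀ ℕ} (hm : totalWeight d m = n)
    (h : e * ∏ i ∈ m.support, a i (m i) ≠ 0) : m.support ⊆ (hfin n).toFinset := by
  intro i hi
  rw [Set.Finite.mem_toFinset]
  refine ⟨hm ▸ le_totalWeight d m (Finsupp.mem_support_iff.1 hi), m i,
    Finsupp.mem_support_iff.1 hi, fun h0 ↦ h ?_⟩
  rw [Finset.prod_eq_zero hi h0, mul_zero]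

theorem finite_support_term
    (hfin : ∀ n, {i | d i ≤ n ∧ ∃ r, r ≠ 0 ∧ a i r ≠ 0}.Finite) (hd : ∀ i, d i ≠ 0) (n : ℕ) :
    (weightSet d n ∩
      Function.support fun m ↦ e * ∏ i ∈ m.support, a i (m i)).Finite := by
  classical
  refine ((Finset.finsuppAntidiag (hfin n).toFinset n).preimage (scaleFinsupp d)
        (scaleFinsupp_injective hd).injOn).finite_toSet.subset fun m hm ↦ ?_
  rw [Finset.mem_coe, Finset.mem_preimage, scaleFinsupp_mem_finsuppAntidiag hd]
  exact ⟨hm.1, support_subset_of_term_ne_zero hfin hm.1 hm.2⟩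

/-- Expansion of an infinite product of dilated series. -/
theorem hasProd_dilatedSeries [Nonempty I]
    (hfin : ∀ n, {i | d i ≤ n ∧ ∃ r, r ≠ 0 ∧ a i r ≠ 0}.Finite) (hd : ∀ i, d i ≠ 0) (he : e * e = e)
    (ha0 : ∀ i, a i 0 = e) (hae : ∀ i r, e * a i r = a i r) :
    letI : TopologicalSpace R := ⊥
    HasProd (fun i ↦ dilatedSeries (d i) (a i)) (PowerSeries.mk fun n ↦
      ∑ᶠ m ∈ weightSet d n, e * ∏ i ∈ m.support, a i (m i)) := by
  classical
  let _ : TopologicalSpace R := ⊥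
  have : DiscreteTopology R := ⟨rfl⟩
  obtain ⟨i₀⟩ := ‹Nonempty I›
  rw [HasProd, PowerSeries.WithPiTopology.tendsto_iff_coeff_tendsto]
  intro n
  refine tendsto_nhds_of_eventually_eq ?_
  rw [SummationFilter.unconditional_filter]
  -- Once `S` contains all indices that can affect degree `n`, the coefficient is constant. The
  -- index `i₀` keeps `S` nonempty, so that the factor `e` is present.
  filter_upwards [Filter.eventually_ge_atTop (insert i₀ (hfin n).toFinset)] with S hS
  rw [coeff_prod_dilatedSeries hd, PowerSeries.coeff_mk,
    finsum_mem_eq_sum_of_inter_support_eq _ (t := (Finset.finsuppAntidiag S n).preimage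
      (scaleFinsupp d) (scaleFinsupp_injective hd).injOn)]
  · refine Finset.sum_congr rfl fun m hm ↦ ?_
    rw [Finset.mem_preimage, scaleFinsupp_mem_finsuppAntidiag hd] at hm
    exact prod_eq_mul_prod_support he ha0 hae ⟨i₀, hS (Finset.mem_insert_self _ _)⟩ hm.2
  · ext m
    refine and_congr_left fun hm ↦ ?_
    rw [Finset.mem_coe, Finset.mem_preimage, scaleFinsupp_mem_finsuppAntidiag hd, weightSet,
      Set.mem_ofPred_eq]
    exact ⟨fun h ↦ ⟨h, (support_subset_of_term_ne_zero hfin h hm).trans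
      ((Finset.subset_insert _ _).trans hS)⟩, fun h ↦ h.1⟩

end Expansion

end PowerSeries

/-! ## Conjugacy classes and multiplicities -/

namespace Wreath

section Classes

variable {Γ : Type u} [Group Γ] {G : Type u} [Group G] {n : ℕ}

/-- The bundles in the class `c` contain the bundle `Γ ×_{ρ i} G` with multiplicity `m i`. -/
def Realizes {I : Type*} {H : I → Subgroup Γ} (ρ : ∀ i, H i →* G) (m : I →₀ ℕ)
    (c : HomConj Γ (Wreath G n)) : Prop :=
  ∃ (θ : Γ →* Wreath G n) (p : (Σ i, Fin (m i)) → Fin n × G),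
    Quotient.mk (conjSetoid Γ (Wreath G n)) θ = c ∧ IsFrame (fun b ↦ ρ b.1) θ p

variable {I : Type*} {H : I → Subgroup Γ} {ρ : ∀ i, H i →* G} {m m' : I →₀ ℕ}
  {c c' : HomConj Γ (Wreath G n)}

theorem Realizes.exists_isFrame (h : Realizes ρ m c) {θ : Γ →* Wreath G n}
    (hθ : Quotient.mk (conjSetoid Γ (Wreath G n)) θ = c) :
    ∃ p : (Σ i, Fin (m i)) → Fin n × G, IsFrame (fun b ↦ ρ b.1) θ p := by
  obtain ⟨θ', p, h1, hp⟩ := h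
  obtain ⟨k, hk⟩ := Quotient.exact (s := conjSetoid Γ (Wreath G n)) (h1.trans hθ.symm)
  exact ⟨_, hp.act (a := k) fun γ ↦ by rw [hk, inv_mul_cancel_right]⟩

theorem Realizes.class_eq (h : Realizes ρ m c) (h' : Realizes ρ m c') : c = c' := by
  obtain ⟨θ, p, rfl, hp⟩ := h
  obtain ⟨θ', p', rfl, hp'⟩ := h'
  obtain ⟨a, ha, -⟩ := hp.exists_act hp'
  exact Quotient.sound (s := conjSetoid Γ (Wreath G n)) ⟨a, fun γ ↦ by
    rw [ha, mul_inv_cancel_right]⟩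

theorem Realizes.multiplicity_eq (hs : Separated ρ) (h : Realizes ρ m c) (h' : Realizes ρ m' c) :
    m = m' := by
  obtain ⟨θ, p, hθ, hp⟩ := h
  obtain ⟨p', hp'⟩ := h'.exists_isFrame hθ
  exact DFunLike.coe_injective (multiplicity_unique hs hp hp')

/-- Blocks of size `m i` for `i` in the support of `m`. -/
theorem bijective_support_sigma (m : I →₀ ℕ) : Function.Bijective
    (fun b : Σ i : m.support, Fin (m i) ↦ (⟨b.1.1, b.2⟩ : Σ i, Fin (m i))) := by
  constructor
  · rintro ⟨⟨i, hi⟩, k⟩ ⟨⟨j, hj⟩, l⟩ h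
    simp only [Sigma.mk.injEq] at h
    obtain ⟨rfl, h⟩ := h
    rw [eq_of_heq h]
  · rintro ⟨i, k⟩
    have : i ∈ m.support := Finsupp.mem_support_iff.2 fun h ↦ by
      rw [h] at k
      exact k.elim0
    exact ⟨⟨⟨i, this⟩, k⟩, rfl⟩

theorem finite_sigma (m : I →₀ ℕ) : Finite (Σ i, Fin (m i)) :=
  Finite.of_surjective _ (bijective_support_sigma m).2

theorem card_sigma (m : I →₀ ℕ) : Nat.card (Σ i, Fin (m i)) = m.sum fun _ k ↦ k := by
  rw [← Nat.card_congr (Equiv.ofBijective _ (bijective_support_sigma m)), Nat.card_sigma]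
  simp only [Nat.card_fin]
  exact Finset.sum_coe_sort m.support fun i ↦ m i

theorem card_sigma_quotient (hH : ∀ i, (H i).FiniteIndex) (m : I →₀ ℕ) :
    Nat.card (Σ b : Σ i, Fin (m i), Γ ⧸ H b.1) = totalWeight (fun i ↦ (H i).index) m := by
  have := finite_sigma m
  have := Fintype.ofFinite (Σ i, Fin (m i))
  let e := Equiv.ofBijective _ (bijective_support_sigma m)
  rw [Nat.card_sigma, ← Fintype.sum_equiv e (fun b ↦ (H b.1).index) _ fun _ ↦ rfl,
    Fintype.sum_sigma]
  simp only [Finset.sum_const, Finset.card_univ, Fintype.card_fin, smul_eq_mul]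
  exact Finset.sum_coe_sort m.support fun i ↦ m i * (H i).index

/-- The weight condition says that the disjoint union of the `Γ`-sets `Γ/H` has `n` points, so it
can serve as the base of a bundle over `{1, …, n}`. -/
theorem exists_realizes (hH : ∀ i, (H i).FiniteIndex)
    (hm : totalWeight (fun i ↦ (H i).index) m = n) :
    ∃ c : HomConj Γ (Wreath G n), Realizes ρ m c := by
  have h1 := finite_sigma m
  have h2 : Finite (Σ b : Σ i, Fin (m i), Γ ⧸ H b.1) := inferInstance
  rw [← card_sigma_quotient hH] at hm
  obtain ⟨θ, p, hp⟩ := Wreath.exists_isFrame (fun b : Σ i, Fin (m i) ↦ ρ b.1)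
    (Finite.equivFinOfCardEq hm)
  exact ⟨_, θ, p, rfl, hp⟩

theorem Realizes.totalWeight_eq (hH : ∀ i, (H i).FiniteIndex) (h : Realizes ρ m c) :
    totalWeight (fun i ↦ (H i).index) m = n := by
  obtain ⟨θ, p, -, hp⟩ := h
  rw [← card_sigma_quotient hH, hp.card_eq]

/-- A bijection from the classes of bundles with components in a family of types to the families
of multiplicities. -/
theorem exists_bijOn_multiplicity (hs : Separated ρ) (hH : ∀ i, (H i).FiniteIndex) (n : ℕ) :
    ∃ f : HomConj Γ (Wreath G n) → I →₀ ℕ,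
      Set.BijOn f {c | ∃ m, Realizes ρ m c} (weightSet (fun i ↦ (H i).index) n) ∧
      ∀ c, (∃ m, Realizes ρ m c) → Realizes ρ (f c) c := by
  classical
  let f : HomConj Γ (Wreath G n) → I →₀ ℕ := fun c ↦
    if h : ∃ m, Realizes ρ m c then h.choose else 0
  have hf : ∀ c, (∃ m, Realizes ρ m c) → Realizes ρ (f c) c := fun c h ↦ by
    simp only [f, dif_pos h]
    exact h.choose_spec
  refine ⟨f, ⟨fun c hc ↦ (hf c hc).totalWeight_eq hH, fun c hc c' hc' e ↦ ?_, fun m hm ↦ ?_⟩, hf⟩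
  · have h1 := hf c' hc'
    rw [← e] at h1
    exact (hf c hc).class_eq h1
  · obtain ⟨c, hc⟩ := exists_realizes (ρ := ρ) hH hm
    exact ⟨c, ⟨m, hc⟩, (hf c ⟨m, hc⟩).multiplicity_eq hs hc⟩

/-! ### Contributions of conjugacy classes -/

section Sum

variable {R : Type v} [CommRing R] (φ : MultiplicativeOrbifoldInvariant.{u} R)
  [DiffeologicalSpace G] [DiffGroup G] (M : Type u) [DiffeologicalSpace M] [MulAction G M]
  [DiffAction G M]

/-- The contribution of `r` copies of the bundle of `ρ`. -/
noncomputable def isotypicTerm {H : Subgroup Γ} (ρ : H →* G) (r : ℕ) : R :=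
  φ.eval (translationGroupoid (Wreath (BundleAut ρ) r) (Fin r → fixedSet M ρ))

variable {M}

/-- The zeroth power is a point even when the fixed set of `ρ` is empty. -/
theorem isotypicTerm_zero {H : Subgroup Γ} (ρ : H →* G) : isotypicTerm φ M ρ 0 = φ.pointValue := by
  have : Unique (Wreath (BundleAut ρ) 0) :=
    { default := 1
      uniq := fun a ↦ ext' (fun i ↦ i.elim0) fun i ↦ i.elim0 }
  exact φ.eval_of_unique

theorem pointValue_mul_isotypicTerm {H : Subgroup Γ} (ρ : H →* G)
    (hρ : Nonempty (fixedSet M ρ) → CompactLocallyFree (BundleAut ρ) (fixedSet M ρ)) (r : ℕ) :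
    φ.pointValue * isotypicTerm φ M ρ r = isotypicTerm φ M ρ r := by
  rcases Nat.eq_zero_or_pos r with rfl | hr
  · rw [isotypicTerm_zero, φ.pointValue_mul_self]
  rcases isEmpty_or_nonempty (fixedSet M ρ) with h | h
  · have : NeZero r := ⟨hr.ne'⟩
    have : IsEmpty (Fin r → fixedSet M ρ) := ⟨fun y ↦ h.false (y 0)⟩
    rw [isotypicTerm, φ.eval_of_isEmpty, mul_zero]
  · exact φ.pointValue_mul_eval ((hρ h).wreath r)

theorem nonempty_of_isotypicTerm_ne_zero {H : Subgroup Γ} {ρ : H →* G} {r : ℕ} (hr : r ≠ 0)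
    (h : isotypicTerm φ M ρ r ≠ 0) : Nonempty (fixedSet M ρ) := by
  by_contra hn
  rw [not_nonempty_iff] at hn
  have : NeZero r := ⟨hr⟩
  have : IsEmpty (Fin r → fixedSet M ρ) := ⟨fun y ↦ hn.false (y 0)⟩
  exact h φ.eval_of_isEmpty

/-- Reindexing the frame by the support of `m` makes the index set finite and all multiplicities
nonzero, as `eval_sector` requires. -/
theorem Realizes.sectorTerm_eq {I : Type u} {H : I → Subgroup Γ} {ρ : ∀ i, H i →* G}
    {m : I →₀ ℕ} (hs : Separated ρ)
    (hρ : ∀ i, Nonempty (fixedSet M (ρ i)) →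
      CompactLocallyFree (BundleAut (ρ i)) (fixedSet M (ρ i)))
    (h : Realizes ρ m c) : φ.sectorTerm Γ (Wreath G n) (Fin n → M) c =
      φ.pointValue * ∏ i ∈ m.support, isotypicTerm φ M (ρ i) (m i) := by
  obtain ⟨p, hp⟩ := h.exists_isFrame c.out_eq
  have h1 := hp.comp _ (bijective_support_sigma m)
  have h2 : Separated (fun i : m.support ↦ ρ i) := fun i j γ g e1 e2 ↦
    Subtype.ext (hs i j γ g e1 e2)
  rw [MultiplicativeOrbifoldInvariant.sectorTerm,
    eval_sector φ (ι := m.support) (m := fun i ↦ m i) h2 h1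
      (fun i ↦ Finsupp.mem_support_iff.1 i.2) fun i ↦ hρ i]
  congr 1
  exact Finset.prod_coe_sort m.support fun i ↦ isotypicTerm φ M (ρ i) (m i)

variable {I : Type u} {H : I → Subgroup Γ} {ρ : ∀ i, H i →* G}

theorem finsum_sectorTerm (hs : Separated ρ) (hH : ∀ i, (H i).FiniteIndex)
    (hρ : ∀ i, Nonempty (fixedSet M (ρ i)) →
      CompactLocallyFree (BundleAut (ρ i)) (fixedSet M (ρ i))) (n : ℕ) :
    ∑ᶠ c ∈ {c : HomConj Γ (Wreath G n) | ∃ m, Realizes ρ m c},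
      φ.sectorTerm Γ (Wreath G n) (Fin n → M) c =
    ∑ᶠ m ∈ weightSet (fun i ↦ (H i).index) n,
      φ.pointValue * ∏ i ∈ m.support, isotypicTerm φ M (ρ i) (m i) := by
  obtain ⟨f, hf, hf'⟩ := exists_bijOn_multiplicity hs hH n
  exact finsum_mem_eq_of_bijOn f hf fun c hc ↦ (hf' c hc).sectorTerm_eq φ hs hρ

end Sum

/-- Base points with isotropy group `H` have a type in `HOM(H, G) / (N_Γ(H) × G)`. -/
theorem exists_twistClass {H : Subgroup Γ} (θ : Γ →* Wreath G n) (x : Fin n)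
    (hx : ∀ γ, γ ∈ H ↔ (θ γ).perm x = x) :
    ∃ (τ : TwistClass H G) (q : Fin n × G), (∃ γ, (θ γ).perm x = q.1) ∧
      (∀ γ, γ ∈ H ↔ (θ γ).perm q.1 = q.1) ∧ ∀ y : H, act (θ y) q = rmul q (τ.out y) := by
  have hx' : ∀ y : H, (θ y).perm x = x := fun y ↦ (hx y).1 y.2
  -- `H` preserves the fibre over `x`; its action on the point `(x, 1)` of that fibre defines `σ`.
  let σ : H →* G := MonoidHom.mk' (fun h ↦ (θ h).tuple x) fun h k ↦ by
    have h1 : (θ h).perm⁻¹ x = x := Equiv.Perm.inv_eq_iff_eq.2 (hx' h).symm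
    rw [Subgroup.coe_mul, map_mul, mul_tuple, h1]
  have hσ : ∀ h : H, act (θ h) (x, 1) = rmul (x, 1) (σ h) := fun h ↦ by
    refine Prod.ext (hx' h) ?_
    change (θ h).tuple ((θ h).perm x) * 1 = 1 * (θ h).tuple x
    rw [hx', mul_one, one_mul]
  obtain ⟨⟨u, g⟩, hp⟩ := Quotient.mk_out (s := twistSetoid H G) σ
  set τ := Quotient.mk (twistSetoid H G) σ with hτ
  have hu : ∀ γ, γ ∈ H ↔ (u : Γ)⁻¹ * γ * u ∈ H := fun γ ↦ by
    refine Iff.trans ?_ (u.2 ((u : Γ)⁻¹ * γ * u)).symm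
    simp [mul_assoc]
  -- The chosen representative of the class of `σ` is related to `σ` by the twist `(u, g)`; moving
  -- the base point accordingly realizes that representative.
  refine ⟨τ, move θ (u : Γ) g⁻¹ (x, 1), ⟨u, rfl⟩, fun γ ↦ ?_, fun y ↦ ?_⟩
  · rw [hu, hx, map_mul, map_mul, map_inv, mul_perm, mul_perm, inv_perm, Equiv.Perm.mul_apply,
      Equiv.Perm.mul_apply, Equiv.Perm.inv_eq_iff_eq]
    rfl
  · let z : H := ⟨(u : Γ)⁻¹ * y * u, (hu y).1 y.2⟩
    have h1 : (y : Γ) * u = u * z := by simp [z, mul_assoc]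
    have h2 : σ z * g⁻¹ = g⁻¹ * τ.out y := by
      rw [hp, twist_apply, mul_inv_cancel_right]
      congr 2
      refine Subtype.ext ?_
      simp [z, mul_assoc]
    rw [act_move, h1, rmul_move, ← h2, ← rmul_move, move, map_mul, act_mul, hσ, act_rmul, move,
      rmul_rmul]

end Classes

end Wreath

/-! ## The product formulas -/

section ProductFormula

open Wreath

variable {Γ : Type u} [Group Γ] {G : Type u} [Group G]

/-- Types of irreducible bundles: conjugacy classes `(H)` together with classes of
homomorphisms `H → G`. -/
abbrev BundleType (Γ : Type u) [Group Γ] (G : Type u) [Group G] : Type u :=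
  Σ c : FiniteIndexClass Γ, TwistClass c.out.1 G

theorem twistClass_eq_of_conj {H : Subgroup Γ} {τ τ' : TwistClass H G} {γ : Γ} {g : G}
    (h : ∀ x, x ∈ H ↔ γ⁻¹ * x * γ ∈ H)
    (h' : ∀ x : H, ∃ y : H, (y : Γ) = γ⁻¹ * x * γ ∧ τ'.out y = g * τ.out x * g⁻¹) : τ = τ' := by
  rw [← τ.out_eq, ← τ'.out_eq]
  refine (Quotient.sound (s := twistSetoid H G) ⟨(⟨γ⁻¹, fun x ↦ ?_⟩, g), ?_⟩).symm
  · rw [inv_inv]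
    exact h x
  · ext x
    obtain ⟨y, hy, hy'⟩ := h' x
    rw [twist_apply]
    have : (⟨γ⁻¹ * x * (γ⁻¹)⁻¹, by rw [inv_inv]; exact (h x).1 x.2⟩ : H) = y :=
      Subtype.ext (by simp [hy])
    change _ = g⁻¹ * τ'.out (⟨γ⁻¹ * x * (γ⁻¹)⁻¹, _⟩ : H) * g
    rw [this, hy']
    group

theorem separated_twistClass (H : Subgroup Γ) : Separated fun τ : TwistClass H G ↦ τ.out :=
  fun _ _ _ _ h h' ↦ twistClass_eq_of_conj h h'

/-- Conjugate subgroups have the same class, hence literally the same chosen representative, so the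
conjugating element normalizes it. -/
theorem separated_bundleType : Separated fun i : BundleType Γ G ↦ i.2.out := by
  rintro ⟨c, τ⟩ ⟨c', τ'⟩ γ g h h'
  have e : c' = c := by
    rw [← c.out_eq, ← c'.out_eq]
    exact Quotient.sound (s := finiteIndexSetoid Γ) ⟨γ, h⟩
  subst e
  have e : τ = τ' := twistClass_eq_of_conj h h'
  rw [e]

variable {n : ℕ}

/-- The stabilizer of `x` contains the kernel of a homomorphism to a finite group, so it has finite
index; moving `x` along its orbit makes the stabilizer the chosen representative of its class. -/
theorem exists_realizes_bundleType (c : HomConj Γ (Wreath G n)) :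
    ∃ m, Realizes (fun i : BundleType Γ G ↦ i.2.out) m c := by
  suffices ∃ (m : BundleType Γ G →₀ ℕ) (p : (Σ i, Fin (m i)) → Fin n × G),
      IsFrame (fun b ↦ b.1.2.out) c.out p by
    obtain ⟨m, p, hp⟩ := this
    exact ⟨m, c.out, p, c.out_eq, hp⟩
  set θ := c.out
  refine exists_isFrame_of_forall (fun i : BundleType Γ G ↦ i.2.out) θ fun x ↦ ?_
  let a : Γ →* Equiv.Perm (Fin n) :=
    { toFun := fun γ ↦ (θ γ).perm
      map_one' := by rw [map_one, one_perm]
      map_mul' := fun γ δ ↦ by rw [map_mul, mul_perm] }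
  let S : Subgroup Γ := (MulAction.stabilizer (Equiv.Perm (Fin n)) x).comap a
  have hS : ∀ γ, γ ∈ S ↔ (θ γ).perm x = x := fun _ ↦ Iff.rfl
  have hSf : S.FiniteIndex := by
    have : a.ker.FiniteIndex := inferInstance
    refine Subgroup.finiteIndex_of_le (H := a.ker) fun γ hγ ↦ ?_
    have h1 : (θ γ).perm = 1 := hγ
    rw [hS, h1]
    rfl
  obtain ⟨δ, hδ⟩ := Quotient.mk_out (s := finiteIndexSetoid Γ) ⟨S, hSf⟩
  set k := Quotient.mk (finiteIndexSetoid Γ) ⟨S, hSf⟩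
  have hx' : ∀ γ, γ ∈ k.out.1 ↔ (θ γ).perm ((θ δ⁻¹).perm x) = (θ δ⁻¹).perm x := fun γ ↦ by
    have h1 := hδ (δ * γ * δ⁻¹)
    have h2 : δ⁻¹ * (δ * γ * δ⁻¹) * δ = γ := by group
    rw [h2] at h1
    rw [← h1, hS, map_mul, map_mul, mul_perm, mul_perm, Equiv.Perm.mul_apply,
      Equiv.Perm.mul_apply, map_inv, inv_perm, Equiv.Perm.eq_inv_iff_eq]
  obtain ⟨τ, q, ⟨γ, h1⟩, h2, h3⟩ := exists_twistClass θ _ hx'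
  exact ⟨⟨k, τ⟩, q, ⟨γ * δ⁻¹, by rw [map_mul, mul_perm, Equiv.Perm.mul_apply, h1]⟩, h2, h3⟩

/-- Over `r(Γ/H)` each orbit contains a point with stabilizer exactly `H`, so every component has a
type over `H`. Conversely, counting points recovers the number `r` of orbits. -/
theorem liesOver_copies_iff {H : Subgroup Γ} (hH : H.FiniteIndex) (r : ℕ) (hn : n = r * H.index)
    (c : HomConj Γ (Wreath G n)) :
    LiesOver c (copies r H) ↔ ∃ m, Realizes (fun τ : TwistClass H G ↦ τ.out) m c := by
  constructor
  · rintro ⟨θ, rfl, e, he⟩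
    suffices ∃ (m : TwistClass H G →₀ ℕ) (p : (Σ i, Fin (m i)) → Fin n × G),
        IsFrame (fun b ↦ b.1.out) θ p by
      obtain ⟨m, p, hp⟩ := this
      exact ⟨m, θ, p, rfl, hp⟩
    refine exists_isFrame_of_forall (fun τ : TwistClass H G ↦ τ.out) θ fun x ↦ ?_
    obtain ⟨⟨k, z⟩, rfl⟩ := e.symm.surjective x
    obtain ⟨δ, rfl⟩ := QuotientGroup.mk_surjective z
    have he' : ∀ γ y, (θ γ).perm (e.symm y) = e.symm (γ • y) := fun γ y ↦ by
      rw [Equiv.eq_symm_apply, he, Equiv.apply_symm_apply]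
    have hx : ∀ γ, γ ∈ H ↔ (θ γ).perm (e.symm ⟨k, ((1 : Γ) : Γ ⧸ H)⟩) =
        e.symm ⟨k, ((1 : Γ) : Γ ⧸ H)⟩ := fun γ ↦ by
      rw [he', e.symm.injective.eq_iff]
      change _ ↔ (⟨k, ((γ * 1 : Γ) : Γ ⧸ H)⟩ : copies r H) = ⟨k, ((1 : Γ) : Γ ⧸ H)⟩
      rw [mul_one, Sigma.mk.injEq, heq_eq_eq, eq_comm (a := ((γ : Γ) : Γ ⧸ H)), QuotientGroup.eq]
      simp
    obtain ⟨τ, q, ⟨γ, h1⟩, h2, h3⟩ := exists_twistClass θ _ hx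
    refine ⟨τ, q, ⟨γ * δ⁻¹, ?_⟩, h2, h3⟩
    rw [← h1, map_mul, mul_perm, Equiv.Perm.mul_apply, he']
    congr 2
    change (⟨k, ((δ⁻¹ * δ : Γ) : Γ ⧸ H)⟩ : copies r H) = ⟨k, ((1 : Γ) : Γ ⧸ H)⟩
    rw [inv_mul_cancel]
  · rintro ⟨m, θ, p, rfl, hp⟩
    obtain ⟨e, he⟩ := hp.exists_equiv
    have h1 := hp.card_eq
    rw [card_sigma_quotient (H := fun _ : TwistClass H G ↦ H) (fun _ ↦ hH)] at h1
    have h2 : Nat.card (Σ i, Fin (m i)) = r := by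
      have h3 : (m.sum fun _ k ↦ k) * H.index = r * H.index := by
        rw [← hn, ← h1, totalWeight, Finsupp.sum_mul]
      rw [card_sigma]
      exact Nat.eq_of_mul_eq_mul_right (Nat.pos_of_ne_zero hH.index_ne_zero) h3
    have := finite_sigma m
    let f : (Σ i, Fin (m i)) ≃ Fin r := Finite.equivFinOfCardEq h2
    let F : (Σ _ : (Σ i, Fin (m i)), Γ ⧸ H) ≃ copies r H :=
      Equiv.sigmaCongrLeft (β := fun _ ↦ Γ ⧸ H) f
    refine ⟨θ, rfl, e.symm.trans F, fun γ i ↦ ?_⟩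
    obtain ⟨x, rfl⟩ := e.surjective i
    rw [← he]
    simp only [Equiv.trans_apply, Equiv.symm_apply_apply]
    rfl

theorem card_copies (r : ℕ) {H : Subgroup Γ} (hH : H.FiniteIndex) : Nat.card (copies r H) = r * H.index := by
  have : Finite (Γ ⧸ H) := inferInstance
  rw [Nat.card_sigma, Finset.sum_const, Finset.card_univ, Fintype.card_fin, smul_eq_mul]
  rfl

variable {R : Type v} [CommRing R] (φ : MultiplicativeOrbifoldInvariant.{u} R)
  [DiffeologicalSpace G] [DiffGroup G] {M : Type u} [DiffeologicalSpace M] [MulAction G M]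
  [DiffAction G M]

theorem finite_bundleType
    (hτ : ∀ H : Subgroup Γ, H.FiniteIndex →
      {τ : TwistClass H G | Nonempty (fixedSet M τ.out)}.Finite)
    (hΓ : ∀ n, {c : FiniteIndexClass Γ | c.out.1.index ≤ n}.Finite) (n : ℕ) :
    {i : BundleType Γ G | i.1.out.1.index ≤ n ∧ ∃ r, r ≠ 0 ∧
      isotypicTerm φ M i.2.out r ≠ 0}.Finite := by
  refine ((hΓ n).biUnion fun c _ ↦ (hτ _ c.out.2).image (Sigma.mk c)).subset ?_
  rintro ⟨c, τ⟩ ⟨h1, r, hr, h2⟩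
  exact Set.mem_biUnion h1 ⟨τ, nonempty_of_isotypicTerm_ne_zero φ hr h2, rfl⟩

variable (hρ : ∀ H : Subgroup Γ, H.FiniteIndex → ∀ ρ : H →* G, Nonempty (fixedSet M ρ) →
    CompactLocallyFree (BundleAut ρ) (fixedSet M ρ))

theorem totalWeight_const {I : Type*} (d : ℕ) (m : I →₀ ℕ) :
    totalWeight (fun _ ↦ d) m = totalWeight (fun _ ↦ 1) m * d := by
  simp only [totalWeight, Finsupp.sum_mul, mul_one]

include hρ

/-- All components have the same number of sheets `[Γ : H]`, so the weight condition reduces to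
having `r` components. -/
theorem setExtension_copies {H : Subgroup Γ} (hH : H.FiniteIndex) (r : ℕ) :
    φ.setExtension Γ (copies r H) G M = ∑ᶠ m ∈ weightSet (fun _ : TwistClass H G ↦ 1) r,
      φ.pointValue * ∏ τ ∈ m.support, isotypicTerm φ M τ.out (m τ) := by
  have h1 : weightSet (fun _ : TwistClass H G ↦ 1) r =
      weightSet (fun _ : TwistClass H G ↦ H.index) (Nat.card (copies r H)) := by
    ext m
    rw [weightSet, weightSet, Set.mem_ofPred_eq, Set.mem_ofPred_eq, card_copies r hH,
      totalWeight_const H.index]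
    exact ⟨fun h ↦ by rw [h], fun h ↦
      Nat.eq_of_mul_eq_mul_right (Nat.pos_of_ne_zero hH.index_ne_zero) h⟩
  rw [h1, ← finsum_sectorTerm φ (separated_twistClass H) (fun _ ↦ hH) (fun τ ↦ hρ H hH τ.out),
    MultiplicativeOrbifoldInvariant.setExtension]
  refine finsum_congr fun c ↦ ?_
  exact finsum_congr_Prop (propext (liesOver_copies_iff hH r (card_copies r hH) c)) fun _ ↦ rfl

theorem extension_wreath (n : ℕ) :
    φ.extension Γ (Wreath G n) (Fin n → M) =
      ∑ᶠ m ∈ weightSet (fun i : BundleType Γ G ↦ i.1.out.1.index) n,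
        φ.pointValue * ∏ i ∈ m.support, isotypicTerm φ M i.2.out (m i) := by
  rw [← finsum_sectorTerm φ separated_bundleType (fun i ↦ i.1.out.2)
    (fun i ↦ hρ _ i.1.out.2 i.2.out), MultiplicativeOrbifoldInvariant.extension]
  rw [Set.eq_univ_of_forall (s := {c | ∃ m, Realizes (fun i : BundleType Γ G ↦ i.2.out) m c})
    exists_realizes_bundleType, finsum_mem_univ]

variable (hτ : ∀ H : Subgroup Γ, H.FiniteIndex →
    {τ : TwistClass H G | Nonempty (fixedSet M τ.out)}.Finite)
include hτ

/-- The dilation `d` is free because the result is used twice: with `d = 1` for the second formula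
and with `d = [Γ : H]` for the factor of `(H)` in the first. -/
theorem hasProd_twistClass {H : Subgroup Γ} (hH : H.FiniteIndex) {d : ℕ} (hd : d ≠ 0) :
    letI : TopologicalSpace R := ⊥
    HasProd (fun τ : TwistClass H G ↦ dilatedSeries d (isotypicTerm φ M τ.out))
      (dilatedSeries d fun r ↦ φ.setExtension Γ (copies r H) G M) := by
  have : Nonempty (TwistClass H G) := ⟨Quotient.mk _ 1⟩
  have h1 := hasProd_dilatedSeries (d := fun _ : TwistClass H G ↦ d)
    (a := fun τ ↦ isotypicTerm φ M τ.out) (e := φ.pointValue)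
    (fun n ↦ (hτ H hH).subset fun τ hτ' ↦ by
      obtain ⟨-, r, hr, h⟩ := hτ'
      exact nonempty_of_isotypicTerm_ne_zero φ hr h)
    (fun _ ↦ hd) φ.pointValue_mul_self (fun τ ↦ isotypicTerm_zero φ _)
    (fun τ r ↦ pointValue_mul_isotypicTerm φ _ (hρ H hH _) r)
  convert h1 using 1
  ext n
  rw [coeff_dilatedSeries, PowerSeries.coeff_mk]
  split_ifs with h
  · obtain ⟨r, rfl⟩ := h
    rw [Nat.mul_div_cancel_left _ (Nat.pos_of_ne_zero hd), setExtension_copies φ hρ hH]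
    congr 1
    funext m
    refine finsum_congr_Prop (propext ?_) fun _ ↦ rfl
    change totalWeight _ m = r ↔ totalWeight _ m = d * r
    rw [totalWeight_const d, mul_comm d r]
    exact (Nat.mul_left_inj hd).symm
  · symm
    refine finsum_mem_eq_zero_of_forall_eq_zero fun m hm ↦ ?_
    refine absurd ?_ h
    change totalWeight _ m = n at hm
    rw [totalWeight_const d] at hm
    exact ⟨_, hm.symm.trans (mul_comm _ _)⟩

variable (hΓ : ∀ n, {c : FiniteIndexClass Γ | c.out.1.index ≤ n}.Finite)
include hΓ

/-- The multiplicity map is injective on classes and sends nonzero sectors to nonzero terms of the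
expansion, of which there are finitely many. -/
theorem finite_support_sectorTerm (n : ℕ) :
    (Function.support (φ.sectorTerm Γ (Wreath G n) (Fin n → M))).Finite := by
  obtain ⟨f, hf, hf'⟩ := exists_bijOn_multiplicity (ρ := fun i : BundleType Γ G ↦ i.2.out)
    separated_bundleType (fun i ↦ i.1.out.2) n
  have h1 := finite_support_term (e := φ.pointValue) (finite_bundleType φ hτ hΓ)
    (fun i ↦ i.1.out.2.index_ne_zero) n
  refine Set.Finite.of_finite_image (f := f) (h1.subset ?_) fun c _ c' _ e ↦
    hf.injOn (exists_realizes_bundleType c) (exists_realizes_bundleType c') e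
  rintro _ ⟨c, hc, rfl⟩
  refine ⟨hf.mapsTo (exists_realizes_bundleType c), ?_⟩
  rw [Function.mem_support] at hc ⊢
  rwa [← (hf' c (exists_realizes_bundleType c)).sectorTerm_eq φ separated_bundleType
    (fun i ↦ hρ _ i.1.out.2 i.2.out)]

theorem hasProd_bundleType :
    letI : TopologicalSpace R := ⊥
    HasProd (fun i : BundleType Γ G ↦
        dilatedSeries i.1.out.1.index (isotypicTerm φ M i.2.out))
      (PowerSeries.mk fun n ↦ φ.extension Γ (Wreath G n) (Fin n → M)) := by
  have : Nonempty (BundleType Γ G) :=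
    ⟨⟨Quotient.mk _ ⟨⊤, inferInstance⟩, Quotient.mk _ 1⟩⟩
  have h1 := hasProd_dilatedSeries (finite_bundleType φ hτ hΓ)
    (fun i ↦ i.1.out.2.index_ne_zero) φ.pointValue_mul_self (fun i ↦ isotypicTerm_zero φ _)
    (fun i r ↦ pointValue_mul_isotypicTerm φ _ (hρ _ i.1.out.2 _) r)
  convert h1 using 1
  ext n
  rw [PowerSeries.coeff_mk, PowerSeries.coeff_mk, extension_wreath φ hρ]

/-- The product formulas, under finiteness assumptions. -/
theorem product_formulas :
    letI : TopologicalSpace R := ⊥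
    HasProd
      (fun c : FiniteIndexClass Γ ↦
        dilatedSeries c.out.1.index (fun r ↦ φ.setExtension Γ (copies r c.out.1) G M))
      (PowerSeries.mk fun n ↦ φ.extension Γ (Wreath G n) (Fin n → M)) ∧
    ∀ H : Subgroup Γ, H.FiniteIndex →
      HasProd (fun c : TwistClass H G ↦ PowerSeries.mk (isotypicTerm φ M c.out))
        (PowerSeries.mk fun n ↦ φ.setExtension Γ (copies n H) G M) := by
  let _ : TopologicalSpace R := ⊥
  have : DiscreteTopology R := ⟨rfl⟩
  have : RegularSpace (PowerSeries R) := inferInstanceAs (RegularSpace ((Unit →₀ ℕ) → R))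
  have : IsTopologicalRing (PowerSeries R) := PowerSeries.WithPiTopology.instIsTopologicalRing R
  refine ⟨?_, fun H hH ↦ ?_⟩
  · have h1 := hasProd_bundleType φ hρ hτ hΓ
    have h2 := fun c : FiniteIndexClass Γ ↦
      hasProd_twistClass φ hρ hτ c.out.2 c.out.2.index_ne_zero
    -- The product over all types is grouped by conjugacy class; regularity of the space of power
    -- series justifies taking the inner products first.
    exact HasProd.sigma h1 h2
  have h1 := hasProd_twistClass φ hρ hτ hH one_ne_zero
  simpa only [dilatedSeries_one] using h1

end ProductFormula

/-! ## Subgroups of finite index in finitely generated groups -/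

theorem Group.finite_monoidHom (Γ P : Type*) [Group Γ] [Group.FG Γ] [Group P] [Finite P] :
    Finite (Γ →* P) := by
  obtain ⟨S, hS, hfin⟩ := Group.fg_iff.1 ‹Group.FG Γ›
  have := hfin.to_subtype
  refine Finite.of_injective (fun (f : Γ →* P) (s : S) ↦ f s) fun f g h ↦ ?_
  exact MonoidHom.eq_of_eqOn_dense hS fun s hs ↦ congrFun h ⟨s, hs⟩

/-- A subgroup of index `d` is a point stabilizer for some action of `Γ` on `d` points, and a
finitely generated group has finitely many such actions. -/
theorem Subgroup.finite_setOf_index_eq (Γ : Type*) [Group Γ] [Group.FG Γ] (d : ℕ) :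
    {H : Subgroup Γ | H.FiniteIndex ∧ H.index = d}.Finite := by
  have := Group.finite_monoidHom Γ (Equiv.Perm (Fin d))
  refine (Set.finite_range fun p : (Γ →* Equiv.Perm (Fin d)) × Fin d ↦
    (MulAction.stabilizer (Equiv.Perm (Fin d)) p.2).comap p.1).subset ?_
  rintro H ⟨hH, hd⟩
  have e : Γ ⧸ H ≃ Fin d := (Finite.equivFin _).trans (finCongr hd)
  refine ⟨(e.permCongrHom.toMonoidHom.comp (MulAction.toPermHom Γ (Γ ⧸ H)),
    e (QuotientGroup.mk 1)), ?_⟩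
  ext γ
  simp only [Subgroup.mem_comap, MulAction.mem_stabilizer_iff]
  change e (γ • e.symm (e _)) = _ ↔ _
  rw [e.symm_apply_apply, e.injective.eq_iff, MulAction.Quotient.smul_mk, smul_eq_mul, mul_one,
    eq_comm, QuotientGroup.eq]
  simp

theorem FiniteIndexClass.finite_setOf_index_le (Γ : Type*) [Group Γ] [Group.FG Γ] (n : ℕ) :
    {c : FiniteIndexClass Γ | c.out.1.index ≤ n}.Finite := by
  have h : (⋃ d ∈ Set.Iic n, {H : Subgroup Γ | H.FiniteIndex ∧ H.index = d}).Finite :=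
    (Set.finite_Iic n).biUnion fun d _ ↦ Subgroup.finite_setOf_index_eq Γ d
  refine Set.Finite.of_finite_image (f := fun c : FiniteIndexClass Γ ↦ c.out.1)
    (h.subset ?_) ?_
  · rintro _ ⟨c, hc, rfl⟩
    exact Set.mem_biUnion (x := c.out.1.index) hc ⟨c.out.2, rfl⟩
  · intro c _ c' _ hcc
    rw [← Quotient.out_eq c, ← Quotient.out_eq c', Subtype.ext hcc]

/-! ## Linearization of finite group actions -/

/-- The inverse function theorem with an inverse smooth on its whole domain: the source is shrunk to
the open set where the derivative is invertible. -/
theorem ContDiffOn.exists_openPartialHomeomorph {E F : Type*} [NormedAddCommGroup E]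
    [NormedSpace ℝ E] [CompleteSpace E] [NormedAddCommGroup F] [NormedSpace ℝ F] {f : E → F}
    {U : Set E} (hU : IsOpen U) (hf : ContDiffOn ℝ ∞ f U) {x : E} (hx : x ∈ U) {L : E ≃L[ℝ] F}
    (hL : HasFDerivAt f (L : E →L[ℝ] F) x) :
    ∃ h : OpenPartialHomeomorph E F, x ∈ h.source ∧ h.source ⊆ U ∧ (∀ y, h y = f y) ∧
      ContDiffOn ℝ ∞ h.symm h.target := by
  have hx' := hf.contDiffAt (hU.mem_nhds hx)
  let h₀ := hx'.toOpenPartialHomeomorph f hL (by simp)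
  have hcont : ContinuousOn (fderiv ℝ f) U := hf.continuousOn_fderiv_of_isOpen hU (by simp)
  let V := U ∩ fderiv ℝ f ⁻¹' Set.range ((↑) : (E ≃L[ℝ] F) → E →L[ℝ] F)
  have hV : IsOpen V := hcont.isOpen_inter_preimage hU ContinuousLinearEquiv.isOpen
  have hxV : x ∈ V := ⟨hx, L, hL.fderiv.symm⟩
  refine ⟨h₀.restrOpen V hV, ⟨hx'.mem_toOpenPartialHomeomorph_source hL _, hxV⟩,
    fun y hy ↦ hy.2.1, fun y ↦ rfl, fun z hz ↦ ContDiffAt.contDiffWithinAt ?_⟩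
  have hz' := (h₀.restrOpen V hV).map_target hz
  obtain ⟨⟨hzU, K, hK⟩, hz0⟩ : (h₀.restrOpen V hV).symm z ∈ V ∧
    (h₀.restrOpen V hV).symm z ∈ h₀.source := ⟨hz'.2, hz'.1⟩
  have hd := hf.contDiffAt (hU.mem_nhds hzU)
  refine (h₀.restrOpen V hV).contDiffAt_symm (f₀' := K) hz ?_ hd
  rw [hK]
  exact (hd.differentiableAt (by simp)).hasFDerivAt

/-- Bochner linearization: averaging a chart `c` as `∑ b, L b⁻¹ (c (b • y) - c x)` gives an
equivariant map whose derivative, read in the chart, is `|A|` times the identity at `x`, hence an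
equivariant chart near `x`. -/
theorem exists_linearizing_chart {E : Type*} [NormedAddCommGroup E] [NormedSpace ℝ E]
    [FiniteDimensional ℝ E] {M : Type*} [TopologicalSpace M] [ChartedSpace E M]
    [IsManifold 𝓘(ℝ, E) ∞ M] {A : Type*} [Group A] [Finite A] [MulAction A M]
    (hA : ∀ a : A, ContMDiff 𝓘(ℝ, E) 𝓘(ℝ, E) ∞ fun x : M ↦ a • x) {x : M}
    (hx : ∀ a : A, a • x = x) :
    ∃ (L : A →* E →L[ℝ] E) (ψ : OpenPartialHomeomorph M E), x ∈ ψ.source ∧ ψ x = 0 ∧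
      (∀ a, ∀ y ∈ ψ.source, a • y ∈ ψ.source ∧ ψ (a • y) = L a (ψ y)) ∧
      ContMDiffOn 𝓘(ℝ, E) 𝓘(ℝ, E) ∞ ψ ψ.source ∧
      ContMDiffOn 𝓘(ℝ, E) 𝓘(ℝ, E) ∞ ψ.symm ψ.target := by
  cases nonempty_fintype A
  let c := chartAt E x
  have hcs : ContMDiffOn 𝓘(ℝ, E) 𝓘(ℝ, E) ∞ c c.source := contMDiffOn_chart
  have hct : ContMDiffOn 𝓘(ℝ, E) 𝓘(ℝ, E) ∞ c.symm c.target := contMDiffOn_chart_symm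
  have hxc : x ∈ c.source := mem_chart_source E x
  have hx0 : c.symm (c x) = x := c.left_inv hxc
  let f : A → E → E := fun a v ↦ c (a • c.symm v)
  let S : Set E := c.target ∩ c.symm ⁻¹' ⋂ a : A, (fun y ↦ a • y) ⁻¹' c.source
  have hS : IsOpen S := c.symm.isOpen_inter_preimage
    (isOpen_iInter_of_finite fun a ↦ c.open_source.preimage (hA a).continuous)
  have hxS : c x ∈ S := ⟨c.map_source hxc, by
    simp only [Set.mem_preimage, Set.mem_iInter, hx0, hx]
    exact fun _ ↦ hxc⟩
  have hfS : ∀ a, ContDiffOn ℝ ∞ (f a) S := fun a ↦ by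
    rw [← contMDiffOn_iff_contDiffOn]
    refine hcs.comp ((hA a).comp_contMDiffOn (hct.mono Set.inter_subset_left)) fun v hv ↦ ?_
    exact Set.mem_iInter.1 hv.2 a
  have hfx : ∀ a, f a (c x) = c x := fun a ↦ by simp only [f, hx0, hx]
  have hfd : ∀ a, HasFDerivAt (f a) (fderiv ℝ (f a) (c x)) (c x) := fun a ↦
    (((hfS a).contDiffAt (hS.mem_nhds hxS)).differentiableAt (by simp)).hasFDerivAt
  let L : A →* E →L[ℝ] E :=
    { toFun := fun a ↦ fderiv ℝ (f a) (c x)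
      map_one' := by
        refine HasFDerivAt.fderiv ((hasFDerivAt_id (c x)).congr_of_eventuallyEq ?_)
        filter_upwards [hS.mem_nhds hxS] with v hv
        simp only [f, one_smul, id, c.right_inv hv.1]
      map_mul' := fun a b ↦ by
        refine HasFDerivAt.fderiv (HasFDerivAt.congr_of_eventuallyEq
          (f := f a ∘ f b) ?_ ?_)
        · refine HasFDerivAt.comp (c x) ?_ (hfd b)
          rw [hfx]
          exact hfd a
        · filter_upwards [hS.mem_nhds hxS] with v hv
          have : b • c.symm v ∈ c.source := Set.mem_iInter.1 hv.2 b
          simp only [f, mul_smul, Function.comp_apply, c.left_inv this] }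
  let Ψ : E → E := fun v ↦ ∑ b, L b⁻¹ (f b v - c x)
  let ψ : M → E := fun y ↦ ∑ b : A, L b⁻¹ (c (b • y) - c x)
  -- `c` is a total function, so equivariance is a formal reindexing of the sum, valid even off the
  -- chart domain.
  have hψ : ∀ (a : A) (y : M), ψ (a • y) = L a (ψ y) := fun a y ↦ by
    simp only [ψ, map_sum]
    refine Fintype.sum_equiv (Equiv.mulRight a) _ _ fun b ↦ ?_
    rw [← mul_apply_eq_comp, ← map_mul]
    simp [mul_smul]
  have hΨS : ContDiffOn ℝ ∞ Ψ S := ContDiffOn.sum fun b _ ↦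
    (L b⁻¹).contDiff.comp_contDiffOn ((hfS b).sub contDiffOn_const)
  have hN : (Fintype.card A : ℝ) ≠ 0 := by simp [Fintype.card_ne_zero]
  let D : E ≃L[ℝ] E := ContinuousLinearEquiv.smulLeft (Units.mk0 (Fintype.card A : ℝ) hN)
  have hD : HasFDerivAt Ψ (D : E →L[ℝ] E) (c x) := by
    have h1 : HasFDerivAt Ψ (∑ b, (L b⁻¹).comp (L b)) (c x) := by
      refine HasFDerivAt.fun_sum fun b _ ↦ ?_
      exact (L b⁻¹).hasFDerivAt.comp (c x) ((hfd b).sub_const (c x))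
    convert h1 using 1
    have h2 : ∀ b : A, (L b⁻¹).comp (L b) = 1 := fun b ↦ by
      rw [← ContinuousLinearMap.mul_def, ← map_mul, inv_mul_cancel, map_one]
    simp only [h2, Finset.sum_const, Finset.card_univ]
    ext v
    simp [D, Nat.cast_smul_eq_nsmul]
  obtain ⟨h, hxh, hhS, hhf, hhs⟩ := hΨS.exists_openPartialHomeomorph hS hxS hD
  let e := c.trans h
  have hxe : x ∈ e.source := by simp [e, hxc, hxh]
  -- Intersecting the translates of the domain makes it invariant under `A`.
  let U : Set M := ⋂ a : A, (fun y ↦ a • y) ⁻¹' e.source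
  have hU : IsOpen U := isOpen_iInter_of_finite fun a ↦ e.open_source.preimage (hA a).continuous
  have hes : ∀ y ∈ e.source, e y = ψ y := fun y hy ↦ by
    have : y ∈ c.source := by simp [e] at hy; exact hy.1
    change h (c y) = _
    rw [hhf]
    simp only [Ψ, f, c.left_inv this, ψ]
  refine ⟨L, e.restrOpen U hU, ⟨hxe, ?_⟩, ?_, fun a y hy ↦ ?_, ?_, ?_⟩
  · simp only [U, Set.mem_iInter, Set.mem_preimage, hx, hxe, implies_true]
  · change e x = 0
    rw [hes x hxe]
    simp [ψ, hx]
  · have hy' : ∀ b : A, b • y ∈ e.source := Set.mem_iInter.1 hy.2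
    refine ⟨⟨hy' a, Set.mem_iInter.2 fun b ↦ ?_⟩, ?_⟩
    · change b • a • y ∈ e.source
      rw [← mul_smul]
      exact hy' _
    · change e (a • y) = L a (e y)
      rw [hes _ (hy' a), hes _ hy.1, hψ]
  · change ContMDiffOn _ _ _ (h ∘ c) _
    have h1 : ContDiffOn ℝ ∞ h h.source := (hΨS.mono hhS).congr fun y _ ↦ hhf y
    refine h1.contMDiffOn.comp (hcs.mono fun y hy ↦ ?_) fun y hy ↦ ?_
    · have := hy.1
      simp [e] at this
      exact this.1
    · have := hy.1
      simp [e] at this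
      exact this.2
  · change ContMDiffOn _ _ _ (c.symm ∘ h.symm) _
    refine hct.comp (hhs.contMDiffOn.mono fun z hz ↦ ?_) fun z hz ↦ ?_
    · have := hz.1
      simp [e] at this
      exact this.1
    · have := hz.1
      simp [e] at this
      exact this.2

/-! ## Fixed points of finite groups -/

/-- In a linearizing chart the fixed set becomes the linear subspace of invariants. Working with an
injection `j` covers both fixed sets in `M` and centralizers in `G`. -/
theorem isCompactManifold_of_fixedPoints {E : Type*} [NormedAddCommGroup E] [NormedSpace ℝ E]
    [FiniteDimensional ℝ E] {M : Type*} [TopologicalSpace M] [ChartedSpace E M]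
    [IsManifold 𝓘(ℝ, E) ∞ M] [T2Space M] [CompactSpace M] {A : Type*} [Group A] [Finite A]
    [MulAction A M] (hA : ∀ a : A, ContMDiff 𝓘(ℝ, E) 𝓘(ℝ, E) ∞ fun x : M ↦ a • x) {X : Type*}
    [DiffeologicalSpace X] (j : X → M) (hj : Function.Injective j)
    (hr : ∀ x : M, x ∈ Set.range j ↔ ∀ a : A, a • x = x)
    (hp : ∀ (n : ℕ) (p : EuclideanSpace ℝ (Fin n) → X),
      IsPlot p ↔ ContMDiff 𝓘(ℝ, EuclideanSpace ℝ (Fin n)) 𝓘(ℝ, E) ∞ (j ∘ p)) :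
    IsCompactManifold X := by
  let τ : TopologicalSpace X := .induced j inferInstance
  have hcl : IsClosed (Set.range j) := by
    have : Set.range j = ⋂ a : A, {x | a • x = x} := by
      ext x
      simp [hr]
    rw [this]
    exact isClosed_iInter fun a ↦ isClosed_eq (hA a).continuous continuous_id
  have he : Topology.IsClosedEmbedding j := ⟨⟨⟨rfl⟩, hj⟩, hcl⟩
  refine ⟨τ, he.isEmbedding.t2Space, he.compactSpace,
    fun n p hpp ↦ continuous_induced_rng.2 ((hp n p).1 hpp).continuous, fun x ↦ ?_⟩
  have : Nonempty X := ⟨x⟩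
  obtain ⟨L, ψ, hxψ, -, hL, hs, ht⟩ := exists_linearizing_chart hA ((hr (j x)).1 ⟨x, rfl⟩)
  let V : Submodule ℝ E :=
    { carrier := {v | ∀ a, L a v = v}
      add_mem' := fun hv hw a ↦ by rw [map_add, hv a, hw a]
      zero_mem' := fun a ↦ map_zero _
      smul_mem' := fun r v hv a ↦ by rw [map_smul, hv a] }
  -- A linear projection onto `V` makes the chart take values in `V` everywhere, without dependence
  -- on membership proofs.
  obtain ⟨π₀, hπ₀⟩ := LinearMap.exists_leftInverse_of_injective V.subtype
    (LinearMap.ker_eq_bot.2 V.injective_subtype)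
  let π : E →L[ℝ] V := LinearMap.toContinuousLinearMap π₀
  have hπ : ∀ v : V, π v = v := fun v ↦ LinearMap.congr_fun hπ₀ v
  have hV : ∀ y : X, j y ∈ ψ.source → ψ (j y) ∈ V := fun y hy a ↦ by
    rw [← (hL a _ hy).2, (hr (j y)).1 ⟨y, rfl⟩]
  have hπV : ∀ y : X, j y ∈ ψ.source → (π (ψ (j y)) : E) = ψ (j y) := fun y hy ↦
    congrArg Subtype.val (hπ ⟨_, hV y hy⟩)
  have hg : ∀ v : V, (v : E) ∈ ψ.target → j (Function.invFun j (ψ.symm v)) = ψ.symm v := by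
    intro v hv
    refine Function.invFun_eq ((hr _).2 fun a ↦ ?_)
    have h1 := ψ.map_target hv
    refine ψ.injOn (hL a _ h1).1 h1 ?_
    rw [(hL a _ h1).2, ψ.right_inv hv]
    exact v.2 a
  refine HasChartAt.euclidean (V := V) ⟨fun y ↦ π (ψ (j y)), fun v ↦ Function.invFun j (ψ.symm v),
    j ⁻¹' ψ.source, (↑) ⁻¹' ψ.target, ψ.open_source.preimage he.continuous, hxψ,
    ψ.open_target.preimage continuous_subtype_val, fun y hy ↦ ?_, fun v hv ↦ ?_, fun y hy ↦ ?_,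
    fun v hv ↦ ?_, ?_, fun n p hpp hps ↦ ?_, fun n q hq hqt ↦ ?_⟩
  · rw [Set.mem_preimage, hπV y hy]
    exact ψ.map_source hy
  · rw [Set.mem_preimage, hg v hv]
    exact ψ.map_target hv
  · apply hj
    have h1 := hg (π (ψ (j y)))
    rw [hπV y hy, ψ.left_inv hy] at h1
    simp only [hπV y hy]
    rw [ψ.left_inv hy, h1 (ψ.map_source hy)]
  · simp only [hg v hv, ψ.right_inv hv, hπ]
  · exact π.continuous.comp_continuousOn (ψ.continuousOn.comp he.continuous.continuousOn
      fun y hy ↦ hy)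
  · have h1 : ContMDiff 𝓘(ℝ, EuclideanSpace ℝ (Fin n)) 𝓘(ℝ, E) ∞ (ψ ∘ (j ∘ p)) :=
      hs.comp_contMDiff ((hp n p).1 hpp) hps
    exact π.contDiff.comp h1.contDiff
  · rw [hp]
    have h1 : ContMDiff 𝓘(ℝ, EuclideanSpace ℝ (Fin n)) 𝓘(ℝ, E) ∞ (ψ.symm ∘ fun z ↦ (q z : E)) :=
      ht.comp_contMDiff (V.subtypeL.contDiff.comp hq).contMDiff hqt
    exact h1.congr fun z ↦ hg (q z) (hqt z)

section LocallyFree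

theorem finite_range_of_fixedSet {G M L : Type*} [Group G] [MulAction G M] [Group L]
    (hfree : ∀ x : M, Finite (MulAction.stabilizer G x)) (ρ : L →* G)
    (h : Nonempty (fixedSet M ρ)) : Finite ρ.range := by
  obtain ⟨x⟩ := h
  have := hfree x.1
  have hle : ρ.range ≤ MulAction.stabilizer G x.1 := by
    rintro _ ⟨l, rfl⟩
    exact x.2 l
  exact Finite.of_injective _ (Subgroup.inclusion_injective hle)

variable (E : Type*) [NormedAddCommGroup E] [NormedSpace ℝ E] [FiniteDimensional ℝ E]
  (F : Type*) [NormedAddCommGroup F] [NormedSpace ℝ F]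
  (M : Type*) [TopologicalSpace M] [ChartedSpace E M] [IsManifold 𝓘(ℝ, E) ∞ M]
  [T2Space M] [CompactSpace M]
  {G : Type*} [Group G] [TopologicalSpace G] [ChartedSpace F G]
  [MulAction G M]
  {L : Type*} [Group L]

theorem isCompactManifold_fixedSet [ContMDiffSMul 𝓘(ℝ, F) 𝓘(ℝ, E) ∞ G M] (ρ : L →* G)
    [Finite ρ.range] :
    let _ := manifoldDiffeology E M
    IsCompactManifold (fixedSet M ρ) := by
  let _ := manifoldDiffeology E M
  refine isCompactManifold_of_fixedPoints (E := E) (M := M) (A := ρ.range) (fun a ↦ ?_)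
    (fun x : fixedSet M ρ ↦ x.1) Subtype.val_injective (fun x ↦ ?_) fun n p ↦ Iff.rfl
  · exact (ContMDiffSMul.contMDiff_smul (I := 𝓘(ℝ, F)) (I' := 𝓘(ℝ, E)) (G := G) (M := M)).comp
      (contMDiff_const (c := a.1).prodMk contMDiff_id)
  · constructor
    · rintro ⟨x, rfl⟩ ⟨_, l, rfl⟩
      exact x.2 l
    · exact fun h ↦ ⟨⟨x, fun l ↦ h ⟨_, l, rfl⟩⟩, rfl⟩

/-- The centralizer is the fixed set of the finite group `ρ.range` acting on `G` by conjugation. -/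
theorem isCompactManifold_homCentralizer [FiniteDimensional ℝ F]
    [LieGroup 𝓘(ℝ, F) ∞ G] [T2Space G] [CompactSpace G] (ρ : L →* G) [Finite ρ.range] :
    let _ := manifoldDiffeology F G
    IsCompactManifold (homCentralizer ρ) := by
  let _ := manifoldDiffeology F G
  let _ : MulAction ρ.range G := MulAction.compHom G
    ((MulAut.conj (G := G)).comp ρ.range.subtype)
  have : IsManifold 𝓘(ℝ, F) ∞ G := ContMDiffMul.toIsManifold
  refine isCompactManifold_of_fixedPoints (E := F) (M := G) (A := ρ.range) (fun a ↦ ?_)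
    (fun x : homCentralizer ρ ↦ x.1) Subtype.val_injective (fun x ↦ ?_) fun n p ↦ Iff.rfl
  · exact (contMDiff_const.mul contMDiff_id).mul contMDiff_const
  · constructor
    · rintro ⟨x, rfl⟩ ⟨_, l, rfl⟩
      change ρ l * x.1 * (ρ l)⁻¹ = x.1
      rw [mul_inv_eq_iff_eq_mul]
      exact Subgroup.mem_centralizer_iff.1 x.2 _ ⟨l, rfl⟩
    · refine fun h ↦ ⟨⟨x, Subgroup.mem_centralizer_iff.2 ?_⟩, rfl⟩
      rintro _ ⟨l, rfl⟩
      have : ρ l * x * (ρ l)⁻¹ = x := h ⟨_, l, rfl⟩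
      rwa [mul_inv_eq_iff_eq_mul] at this

end LocallyFree

/-! ## Bundle automorphism groups are compact -/

namespace BundleAut

variable {Γ G : Type u} [Group Γ] [Group G] {H : Subgroup Γ} (ρ : H →* G)

/-- The bundle automorphisms over the identity of the base. -/
def ofCentralizer : homCentralizer ρ →* isotropy ρ where
  toFun c := ⟨(1, c.1), (mem_isotropy_iff ρ _).2 fun h ↦ by
    have : (⟨((1 : Subgroup.normalizer (H : Set Γ)) : Γ) * h *
        ((1 : Subgroup.normalizer (H : Set Γ)) : Γ)⁻¹,
        ((1 : Subgroup.normalizer (H : Set Γ)).2 h).1 h.2⟩ : H) = h := Subtype.ext (by simp)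
    rw [this, eq_mul_inv_iff_mul_eq]
    exact Subgroup.mem_centralizer_iff.1 c.2 _ ⟨h, rfl⟩⟩
  map_one' := rfl
  map_mul' c d := Subtype.ext (Prod.ext (mul_one 1).symm rfl)

theorem mem_centralizer_of_isotropy (c : G) (hc : ((1 : Subgroup.normalizer (H : Set Γ)), c) ∈
    isotropy ρ) : c ∈ homCentralizer ρ := by
  rw [Subgroup.mem_centralizer_iff]
  rintro _ ⟨h, rfl⟩
  have h1 := (mem_isotropy_iff ρ _).1 hc h
  rw [eq_mul_inv_iff_mul_eq] at h1
  rw [← h1]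
  congr 2
  exact Subtype.ext (by simp)

/-- The action of a bundle automorphism on the base, evaluated at the base point. -/
def base : BundleAut ρ → Γ ⧸ H :=
  Quotient.lift (fun t : isotropy ρ ↦ ((t.1.1 : Γ) : Γ ⧸ H)) fun s t hst ↦ by
    obtain ⟨h, hh⟩ := QuotientGroup.leftRel_apply.1 hst
    rw [QuotientGroup.eq]
    have : (s.1.1 : Γ)⁻¹ * t.1.1 = h := congrArg (fun t : isotropy ρ ↦ (t.1.1 : Γ)) hh.symm
    rw [this]
    exact h.2

theorem base_mk (t : isotropy ρ) : base ρ (mk ρ t) = ((t.1.1 : Γ) : Γ ⧸ H) := rfl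

/-- A representative of a bundle automorphism over a given map of the base. -/
noncomputable def lift (d : Set.range (base ρ)) : isotropy ρ :=
  (mk_surjective ρ d.2.choose).choose

theorem base_lift (d : Set.range (base ρ)) : base ρ (mk ρ (lift ρ d)) = d := by
  rw [lift, (mk_surjective ρ d.2.choose).choose_spec, d.2.choose_spec]

theorem lift_inv_mul_mem (t : isotropy ρ) (d : Set.range (base ρ))
    (hd : base ρ (mk ρ t) = d) : ((lift ρ d).1.1 : Γ)⁻¹ * t.1.1 ∈ H := by
  have h := base_lift ρ d
  rw [← hd] at h
  exact QuotientGroup.eq.1 h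

/-- The isotropy element `t⁻¹ * t' * (h, ρ h)⁻¹` has trivial `Γ`-coordinate, so its `G`-coordinate
centralizes `ρ`. -/
theorem difference_mem (t t' : isotropy ρ) (h : H) (hh : (t'.1.1 : Γ) = t.1.1 * h) :
    t.1.2⁻¹ * t'.1.2 * (ρ h)⁻¹ ∈ homCentralizer ρ := by
  apply mem_centralizer_of_isotropy
  have h1 := (t⁻¹ * t' * (toIsotropy ρ h)⁻¹).2
  convert h1 using 1
  refine Prod.ext (Subtype.ext ?_) rfl
  change 1 = (t.1.1 : Γ)⁻¹ * t'.1.1 * (h : Γ)⁻¹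
  rw [hh]
  group

theorem mk_mul_difference (t t' : isotropy ρ) (h : H) (hh : (t'.1.1 : Γ) = t.1.1 * h) :
    mk ρ (t * ofCentralizer ρ ⟨_, difference_mem ρ t t' h hh⟩) = mk ρ t' := by
  refine QuotientGroup.eq.2 ⟨h, Subtype.ext (Prod.ext (Subtype.ext ?_) ?_)⟩
  · change (h : Γ) = ((t.1.1 : Γ) * 1)⁻¹ * t'.1.1
    rw [hh]
    group
  · change ρ h = (t.1.2 * (t.1.2⁻¹ * t'.1.2 * (ρ h)⁻¹))⁻¹ * t'.1.2
    group

theorem base_lift_mul (d : Set.range (base ρ)) (c : homCentralizer ρ) :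
    base ρ (mk ρ (lift ρ d * ofCentralizer ρ c)) = d := by
  rw [← base_lift ρ d, base_mk, base_mk]
  exact congrArg _ (mul_one _)

theorem mk_ofCentralizer_injective : Function.Injective fun c ↦ mk ρ (ofCentralizer ρ c) := by
  intro c c' h
  obtain ⟨k, hk⟩ := QuotientGroup.eq.1 h
  have hk1 : (k : Γ) = 1⁻¹ * 1 := congrArg (fun t : isotropy ρ ↦ (t.1.1 : Γ)) hk
  have hk2 : ρ k = c.1⁻¹ * c'.1 := congrArg (fun t : isotropy ρ ↦ t.1.2) hk
  obtain rfl : k = 1 := Subtype.ext (by simpa using hk1)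
  rw [map_one, eq_inv_mul_iff_mul_eq, mul_one] at hk2
  exact Subtype.ext hk2

/-- The fibres of `base` are the cosets of the group of automorphisms over the identity of the base,
which is `C_G(ρ)`; `lift` chooses one representative per fibre. -/
theorem mk_lift_mul_bijective : Function.Bijective
    fun p : homCentralizer ρ × Set.range (base ρ) ↦ mk ρ (lift ρ p.2 * ofCentralizer ρ p.1) := by
  constructor
  · rintro ⟨c, d⟩ ⟨c', d'⟩ h
    obtain rfl : d = d' := Subtype.ext ((base_lift_mul ρ d c).symm.trans
      ((congrArg _ h).trans (base_lift_mul ρ d' c')))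
    simp only [map_mul, mul_right_inj] at h
    rw [mk_ofCentralizer_injective ρ h]
  · intro b
    obtain ⟨t, rfl⟩ := mk_surjective ρ b
    let d : Set.range (base ρ) := ⟨_, mk ρ t, rfl⟩
    let h : H := ⟨_, lift_inv_mul_mem ρ t d rfl⟩
    have hh : (t.1.1 : Γ) = (lift ρ d).1.1 * h := (mul_inv_cancel_left _ _).symm
    exact ⟨(⟨_, difference_mem ρ (lift ρ d) t h hh⟩, d), mk_mul_difference ρ (lift ρ d) t h hh⟩

/-- The group of bundle automorphisms is a disjoint union of copies of `C_G(ρ)`. -/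
noncomputable def centralizerEquiv : homCentralizer ρ × Set.range (base ρ) ≃ BundleAut ρ :=
  Equiv.ofBijective _ (mk_lift_mul_bijective ρ)

theorem centralizerEquiv_apply (p : homCentralizer ρ × Set.range (base ρ)) :
    centralizerEquiv ρ p = mk ρ (lift ρ p.2 * ofCentralizer ρ p.1) := rfl

theorem centralizerEquiv_symm_mk (t : isotropy ρ) (d : Set.range (base ρ)) (h : H)
    (hh : (t.1.1 : Γ) = (lift ρ d).1.1 * h) :
    (centralizerEquiv ρ).symm (mk ρ t) = (⟨_, difference_mem ρ (lift ρ d) t h hh⟩, d) := by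
  rw [Equiv.symm_apply_eq, centralizerEquiv_apply]
  exact (mk_mul_difference ρ (lift ρ d) t h hh).symm

/-- Finite index makes the disjoint union of copies of `C_G(ρ)` finite, and its identification with
the quotient is smooth both ways since plots lift locally with constant `Γ`-coordinate. -/
theorem isCompactManifold [DiffeologicalSpace G] [DiffGroup G] [H.FiniteIndex]
    (hC : IsCompactManifold (homCentralizer ρ)) : IsCompactManifold (BundleAut ρ) := by
  let _ : DiffeologicalSpace (Set.range (base ρ)) := discreteDiffeology _
  have : Finite (Γ ⧸ H) := Subgroup.finite_quotient_of_finiteIndex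
  refine (hC.prod IsCompactManifold.of_finite).of_diffeo (centralizerEquiv ρ)
    (fun n p hp x ↦ ?_) fun n p hp ↦ DiffeologicalSpace.locality fun x ↦ ?_
  · refine ⟨fun z ↦ lift ρ (p x).2 * ofCentralizer ρ (p z).1,
      ⟨show IsPlot (fun _ : EuclideanSpace ℝ (Fin n) ↦ (lift ρ (p x).2).1.1 * 1) from
        isPlot_const, isPlot_mul (K := G) isPlot_const hp.1⟩, ?_⟩
    filter_upwards [(IsLocallyConstant.iff_eventually_eq _).1 hp.2 x] with z hz
    rw [← hz]
    rfl
  · obtain ⟨q, hq, hqp⟩ := hp x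
    have h1 := (IsLocallyConstant.iff_eventually_eq _).1 hq.1 x
    obtain ⟨s, hs, hso, hxs⟩ := eventually_nhds_iff.1 (hqp.and h1)
    refine ⟨s, hso, hxs, fun {m f} hf hf' ↦ ?_⟩
    let d : Set.range (base ρ) := ⟨_, mk ρ (q x), rfl⟩
    have h2 := lift_inv_mul_mem ρ (q x) d rfl
    have h3 : ∀ z, ((q (f z)).1.1 : Γ) = (lift ρ d).1.1 * (⟨_, h2⟩ : H) := fun z ↦ by
      have h4 : (q (f z)).1.1 = (q x).1.1 := (hs _ (hf z)).2
      rw [h4]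
      simp
    have h5 : ((centralizerEquiv ρ).symm ∘ p) ∘ f =
        fun z ↦ (⟨_, difference_mem ρ (lift ρ d) (q (f z)) _ (h3 z)⟩, d) := by
      funext z
      change (centralizerEquiv ρ).symm (p (f z)) = _
      rw [(hs _ (hf z)).1, centralizerEquiv_symm_mk ρ _ d _ (h3 z)]
    rw [h5]
    exact ⟨isPlot_mul (K := G) (isPlot_mul (K := G) isPlot_const (isPlot_reparam hq.2 hf'))
      isPlot_const, isPlot_const⟩

/-- An automorphism is determined by its value on the finite base and by the `G`-coordinate of a
normalized representative, which must stabilize `x` in `G`. -/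
theorem finite_stabilizer [H.FiniteIndex] {M : Type*} [MulAction G M]
    (hfree : ∀ x : M, Finite (MulAction.stabilizer G x)) (x : fixedSet M ρ) :
    Finite (MulAction.stabilizer (BundleAut ρ) x) := by
  have : Finite (Γ ⧸ H) := Subgroup.finite_quotient_of_finiteIndex
  have := hfree x.1
  let r : BundleAut ρ → G := fun b ↦
    (lift ρ ((centralizerEquiv ρ).symm b).2).1.2 * ((centralizerEquiv ρ).symm b).1.1
  have hr : ∀ b, b • x = x → r b ∈ MulAction.stabilizer G x.1 := fun b hb ↦ by
    rw [← (centralizerEquiv ρ).apply_symm_apply b, centralizerEquiv_apply] at hb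
    exact congrArg Subtype.val hb
  refine Finite.of_injective (fun b : MulAction.stabilizer (BundleAut ρ) x ↦
    ((⟨r b, hr b b.2⟩ : MulAction.stabilizer G x.1), ((centralizerEquiv ρ).symm b).2))
    fun a b hab ↦ Subtype.ext ((centralizerEquiv ρ).symm.injective ?_)
  obtain ⟨h1, h2⟩ := Prod.ext_iff.1 hab
  have h3 : r a = r b := congrArg Subtype.val h1
  simp only at h2
  simp only [r, h2, mul_right_inj] at h3
  exact Prod.ext (Subtype.ext h3) h2

theorem compactLocallyFree [DiffeologicalSpace G] [DiffGroup G] [H.FiniteIndex] {M : Type*}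
    [MulAction G M] [DiffeologicalSpace M]
    (hfree : ∀ x : M, Finite (MulAction.stabilizer G x))
    (hC : IsCompactManifold (homCentralizer ρ)) (hM : IsCompactManifold (fixedSet M ρ)) :
    CompactLocallyFree (BundleAut ρ) (fixedSet M ρ) :=
  ⟨isCompactManifold ρ hC, hM, finite_stabilizer ρ hfree⟩

end BundleAut

/-! ## Rigidity of finite subgroups of Lie groups -/

/-- An element `g` conjugates the inclusion to `σ` iff it is fixed by the twisted action `b · y = σ
b * y * b⁻¹` of `A` on `G`. Such a fixed point near `1` is found as a zero of the averaged chart `q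
(κ, v) = ∑ a, L a⁻¹ (ψ (a · ψ.symm v))`, where `κ` records `σ`. The implicit function theorem gives
a locally unique zero, and the equivariance of `q` sends zeros to zeros, so the zero is fixed. -/
theorem Subgroup.eventually_conj_of_finite (F : Type*) [NormedAddCommGroup F] [NormedSpace ℝ F]
    [FiniteDimensional ℝ F] {G : Type*} [Group G] [TopologicalSpace G] [ChartedSpace F G]
    [LieGroup 𝓘(ℝ, F) ∞ G] (A : Subgroup G) [Finite A] :
    ∀ᶠ s in 𝓝 ((↑) : A → G), ∀ σ : A →* G, ⇑σ = s → ∃ g : G, ∀ a, σ a = g * a * g⁻¹ := by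
  cases nonempty_fintype A
  have : IsTopologicalGroup G := topologicalGroup_of_lieGroup 𝓘(ℝ, F) ∞
  have : CompleteSpace F := FiniteDimensional.complete ℝ F
  have : IsManifold 𝓘(ℝ, F) ∞ G := ContMDiffMul.toIsManifold
  obtain ⟨L, ψ, h1, hψ1, hL, hs, ht⟩ : ∃ (L : A →* F →L[ℝ] F) (ψ : OpenPartialHomeomorph G F),
      1 ∈ ψ.source ∧ ψ 1 = 0 ∧
      (∀ a : A, ∀ y ∈ ψ.source, ↑a * y * (↑a)⁻¹ ∈ ψ.source ∧ ψ (a * y * (↑a)⁻¹) = L a (ψ y)) ∧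
      ContMDiffOn 𝓘(ℝ, F) 𝓘(ℝ, F) ∞ ψ ψ.source ∧
      ContMDiffOn 𝓘(ℝ, F) 𝓘(ℝ, F) ∞ ψ.symm ψ.target := by
    let _ : MulAction A G := MulAction.compHom G ((MulAut.conj (G := G)).comp A.subtype)
    refine exists_linearizing_chart (A := A) (x := (1 : G)) (fun a ↦ ?_) fun a ↦ ?_
    · exact (contMDiff_const.mul contMDiff_id).mul contMDiff_const
    · change (a : G) * 1 * (a : G)⁻¹ = 1
      simp
  have h0 : (0 : F) ∈ ψ.target := hψ1 ▸ ψ.map_source h1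
  have hψ0 : ψ.symm 0 = 1 := by rw [← hψ1, ψ.left_inv h1]
  let m : A → (A → F) × F → G := fun a p ↦ ψ.symm (p.1 a) * a * ψ.symm p.2 * (a : G)⁻¹
  let q : (A → F) × F → F := fun p ↦ ∑ a : A, L a⁻¹ (ψ (m a p))
  have hm0 : ∀ a, m a 0 = 1 := fun a ↦ by simp [m, hψ0]
  have hsymm : ContMDiffAt 𝓘(ℝ, F) 𝓘(ℝ, F) ∞ ψ.symm 0 :=
    ht.contMDiffAt (ψ.open_target.mem_nhds h0)
  have hm : ∀ a, ContMDiffAt 𝓘(ℝ, (A → F) × F) 𝓘(ℝ, F) ∞ (m a) 0 := fun a ↦ by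
    have e1 : ContMDiffAt 𝓘(ℝ, (A → F) × F) 𝓘(ℝ, F) ∞ (fun p : (A → F) × F ↦ p.1 a) 0 :=
      ContDiff.contMDiff (by fun_prop) |>.contMDiffAt
    have e2 : ContMDiffAt 𝓘(ℝ, (A → F) × F) 𝓘(ℝ, F) ∞ (fun p : (A → F) × F ↦ p.2) 0 :=
      ContDiff.contMDiff (by fun_prop) |>.contMDiffAt
    exact (((ContMDiffAt.comp 0 hsymm e1).mul contMDiffAt_const).mul
      (ContMDiffAt.comp 0 hsymm e2)).mul contMDiffAt_const
  have hψm : ∀ a, ContDiffAt ℝ ∞ (fun p ↦ ψ (m a p)) 0 := fun a ↦ by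
    have e1 : ContMDiffAt 𝓘(ℝ, F) 𝓘(ℝ, F) ∞ ψ (m a 0) := by
      rw [hm0]
      exact hs.contMDiffAt (ψ.open_source.mem_nhds h1)
    exact (ContMDiffAt.comp 0 e1 (hm a)).contDiffAt
  have hq : ContDiffAt ℝ ∞ q 0 := ContDiffAt.sum fun a _ ↦
    (L a⁻¹).contDiff.contDiffAt.comp (0 : (A → F) × F) (hψm a)
  have hLinv : ∀ a v, L a⁻¹ (L a v) = v := fun a v ↦ by
    rw [← mul_apply_eq_comp, ← map_mul, inv_mul_cancel, map_one]
    rfl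
  have hN : (Fintype.card A : ℝ) ≠ 0 := by simp [Fintype.card_ne_zero]
  let D : F ≃L[ℝ] F := ContinuousLinearEquiv.smulLeft (Units.mk0 (Fintype.card A : ℝ) hN)
  have hstrict := hq.hasStrictFDerivAt (by simp)
  -- For `κ = 0` the twisted action is conjugation, linear in the chart, so `q (0, v) = |A| v` near
  -- `0`.
  have hinv : (fderiv ℝ q 0 ∘L .inr ℝ (A → F) F).IsInvertible := by
    refine ⟨D, ?_⟩
    have e1 : HasFDerivAt (fun v : F ↦ q (0, v)) (fderiv ℝ q 0 ∘L .inr ℝ (A → F) F) 0 :=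
      HasFDerivAt.comp (0 : F) (f := fun v : F ↦ ((0 : A → F), v)) hstrict.hasFDerivAt
        (hasFDerivAt_prodMk_right 0 0)
    have e2 : HasFDerivAt (fun v : F ↦ q (0, v)) (D : F →L[ℝ] F) 0 := by
      refine (D : F →L[ℝ] F).hasFDerivAt.congr_of_eventuallyEq ?_
      filter_upwards [ψ.open_target.mem_nhds h0] with v hv
      have e3 : ∀ a : A, L a⁻¹ (ψ (m a (0, v))) = v := fun a ↦ by
        simp only [m, Pi.zero_apply, hψ0, one_mul]
        rw [(hL a _ (ψ.map_target hv)).2, ψ.right_inv hv, hLinv]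
      simp only [q, e3]
      simp [D, Nat.cast_smul_eq_nsmul]
    exact e2.unique e1
  have hq0 : q 0 = 0 := by simp [q, hm0, hψ1]
  let ξ := hstrict.implicitFunctionOfProdDomain hinv
  have hξ : Filter.Tendsto ξ (𝓝 0) (𝓝 0) := hstrict.tendsto_implicitFunctionOfProdDomain hinv
  have hiff := hstrict.eventually_apply_eq_iff_implicitFunctionOfProdDomain hinv
  have hzero := hstrict.eventually_apply_implicitFunctionOfProdDomain hinv
  rw [hq0] at hiff hzero
  have hpair : Filter.Tendsto (fun κ ↦ (κ, ξ κ)) (𝓝 0) (𝓝 (0 : (A → F) × F)) :=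
    Filter.tendsto_id.prodMk_nhds hξ
  have hmt : ∀ a, Filter.Tendsto (fun κ ↦ m a (κ, ξ κ)) (𝓝 0) (𝓝 1) := fun a ↦ by
    have := (hm a).continuousAt.tendsto.comp hpair
    rwa [hm0] at this
  have hvt : ∀ a, Filter.Tendsto (fun κ ↦ (κ, ψ (m a (κ, ξ κ)))) (𝓝 0)
      (𝓝 (0 : (A → F) × F)) := fun a ↦ by
    refine Filter.tendsto_id.prodMk_nhds ?_
    have := (hψm a).continuousAt.tendsto.comp hpair
    simp only [hm0, hψ1] at this
    exact this
  -- Translates of the zero stay in the small region where the implicit function theorem guarantees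
  -- uniqueness.
  have hK : ∀ᶠ κ in 𝓝 (0 : A → F), q (κ, ξ κ) = 0 ∧ ∀ a, m a (κ, ξ κ) ∈ ψ.source ∧
      (q (κ, ψ (m a (κ, ξ κ))) = 0 → ξ κ = ψ (m a (κ, ξ κ))) := by
    refine Filter.Eventually.and hzero (Filter.eventually_all.2 fun a ↦ ?_)
    filter_upwards [(hmt a).eventually (ψ.open_source.mem_nhds h1), (hvt a).eventually hiff]
      with κ e1 e2
    exact ⟨e1, e2.1⟩
  have hκ : Filter.Tendsto (fun (s : A → G) (a : A) ↦ ψ (s a * (a : G)⁻¹)) (𝓝 (↑)) (𝓝 0) := by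
    rw [tendsto_pi_nhds]
    intro a
    have e1 : Filter.Tendsto (fun s : A → G ↦ s a * (a : G)⁻¹) (𝓝 (↑)) (𝓝 1) := by
      have e2 : Continuous fun s : A → G ↦ s a * (a : G)⁻¹ := by fun_prop
      have := e2.tendsto (↑)
      rwa [mul_inv_cancel] at this
    have e3 := (ψ.continuousAt h1).tendsto.comp e1
    rwa [hψ1] at e3
  have hsrc : ∀ᶠ s in 𝓝 ((↑) : A → G), ∀ a : A, s a * (a : G)⁻¹ ∈ ψ.source := by
    refine Filter.eventually_all.2 fun a ↦ ?_
    have e2 : Continuous fun s : A → G ↦ s a * (a : G)⁻¹ := by fun_prop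
    refine e2.continuousAt.eventually (ψ.open_source.mem_nhds ?_)
    simpa using h1
  filter_upwards [hκ.eventually hK, hsrc] with s hs1 hs2 σ hσ
  subst hσ
  set κ : A → F := fun a ↦ ψ (σ a * (a : G)⁻¹) with hκdef
  obtain ⟨hz, hall⟩ := hs1
  have hκs : ∀ a, ψ.symm (κ a) = σ a * (a : G)⁻¹ := fun a ↦ ψ.left_inv (hs2 a)
  set g := ψ.symm (ξ κ) with hg
  have hm' : ∀ b v, m b (κ, v) = σ b * ψ.symm v * (b : G)⁻¹ := fun b v ↦ by
    simp only [m, hκs]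
    group
  refine ⟨g, fun b ↦ ?_⟩
  obtain ⟨hb1, hb2⟩ := hall b
  -- Only here is it used that `σ` is a homomorphism: the sum is reindexed by `a ↦ a * b`.
  have hqb : q (κ, ψ (m b (κ, ξ κ))) = L b (q (κ, ξ κ)) := by
    simp only [q, map_sum]
    refine Fintype.sum_equiv (Equiv.mulRight b) _ _ fun a ↦ ?_
    rw [← mul_apply_eq_comp, ← map_mul, hm' a, ψ.left_inv hb1, hm' b, Equiv.coe_mulRight, hm']
    simp [mul_assoc]
  have hfix : ξ κ = ψ (m b (κ, ξ κ)) := hb2 (by rw [hqb, hz, map_zero])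
  have : g = σ b * g * (b : G)⁻¹ := by
    rw [hg, ← hm', ← ψ.left_inv hb1, ← hfix]
  calc σ b = (σ b * g * (b : G)⁻¹) * b * g⁻¹ := by group
    _ = g * b * g⁻¹ := by rw [← this]

/-! ## Locally free actions are uniformly locally free -/

/-- Multiplication has derivative `(v, w) ↦ v + w` at the identity, so squaring is close to doubling
near `1`. This quantifies the absence of small subgroups. -/
theorem LieGroup.exists_chart_sq (F : Type*) [NormedAddCommGroup F] [NormedSpace ℝ F]
    [FiniteDimensional ℝ F] (G : Type*) [Group G] [TopologicalSpace G] [ChartedSpace F G]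
    [LieGroup 𝓘(ℝ, F) ∞ G] :
    ∃ ψ : OpenPartialHomeomorph G F, 1 ∈ ψ.source ∧ ψ 1 = 0 ∧ ∀ᶠ v in 𝓝 (0 : F),
      v ∈ ψ.target ∧ ψ.symm v * ψ.symm v ∈ ψ.source ∧
        ‖ψ (ψ.symm v * ψ.symm v) - (v + v)‖ ≤ 1 / 2 * ‖v‖ := by
  have : IsTopologicalGroup G := topologicalGroup_of_lieGroup 𝓘(ℝ, F) ∞
  have : IsManifold 𝓘(ℝ, F) ∞ G := ContMDiffMul.toIsManifold
  -- Linearizing the action of the trivial group just provides a smooth chart centred at `1`.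
  have hone : ∀ (a : (⊥ : Subgroup G)) (x : G), a • x = x := fun a x ↦ by
    rw [Subsingleton.elim a 1, one_smul]
  obtain ⟨-, ψ, h1, hψ1, -, hs, ht⟩ := exists_linearizing_chart (E := F) (M := G)
    (A := (⊥ : Subgroup G)) (fun a ↦ by
      simp only [hone]
      exact contMDiff_id)
    (x := (1 : G)) fun a ↦ hone a 1
  have h0 : (0 : F) ∈ ψ.target := hψ1 ▸ ψ.map_source h1
  have hψ0 : ψ.symm 0 = 1 := by rw [← hψ1, ψ.left_inv h1]
  have hT : ∀ᶠ v in 𝓝 (0 : F), v ∈ ψ.target := ψ.open_target.mem_nhds h0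
  have hsymm : ContMDiffAt 𝓘(ℝ, F) 𝓘(ℝ, F) ∞ ψ.symm 0 :=
    ht.contMDiffAt (ψ.open_target.mem_nhds h0)
  let m : F × F → G := fun p ↦ ψ.symm p.1 * ψ.symm p.2
  have hm0 : m 0 = 1 := by simp [m, hψ0]
  have hm : ContMDiffAt 𝓘(ℝ, F × F) 𝓘(ℝ, F) ∞ m 0 :=
    (ContMDiffAt.comp 0 hsymm contDiff_fst.contMDiff.contMDiffAt).mul
      (ContMDiffAt.comp 0 hsymm contDiff_snd.contMDiff.contMDiffAt)
  have hψm : ContDiffAt ℝ ∞ (fun p ↦ ψ (m p)) 0 := by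
    have e1 : ContMDiffAt 𝓘(ℝ, F) 𝓘(ℝ, F) ∞ ψ (m 0) := by
      rw [hm0]
      exact hs.contMDiffAt (ψ.open_source.mem_nhds h1)
    exact (ContMDiffAt.comp 0 e1 hm).contDiffAt
  have hd := (hψm.differentiableAt (by simp)).hasFDerivAt
  set D := fderiv ℝ (fun p ↦ ψ (m p)) 0
  have hl : D ∘L .inl ℝ F F = .id ℝ F := by
    have e1 : HasFDerivAt (fun v : F ↦ ψ (m (v, 0))) (D ∘L .inl ℝ F F) 0 :=
      HasFDerivAt.comp (0 : F) (f := fun v : F ↦ (v, (0 : F))) hd (hasFDerivAt_prodMk_left 0 0)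
    refine e1.unique ((hasFDerivAt_id 0).congr_of_eventuallyEq ?_)
    filter_upwards [hT] with v hv
    simp [m, hψ0, ψ.right_inv hv]
  have hr : D ∘L .inr ℝ F F = .id ℝ F := by
    have e1 : HasFDerivAt (fun v : F ↦ ψ (m (0, v))) (D ∘L .inr ℝ F F) 0 :=
      HasFDerivAt.comp (0 : F) (f := fun v : F ↦ ((0 : F), v)) hd (hasFDerivAt_prodMk_right 0 0)
    refine e1.unique ((hasFDerivAt_id 0).congr_of_eventuallyEq ?_)
    filter_upwards [hT] with v hv
    simp [m, hψ0, ψ.right_inv hv]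
  have hdiag : HasFDerivAt (fun v : F ↦ ψ (m (v, v)))
      (D ∘L (ContinuousLinearMap.id ℝ F).prod (.id ℝ F)) 0 :=
    HasFDerivAt.comp (0 : F) (f := fun v : F ↦ (v, v)) hd
      ((hasFDerivAt_id 0).prodMk (hasFDerivAt_id 0))
  have hDv : ∀ v, D (v, v) = v + v := fun v ↦ by
    have e1 : D (v, 0) = v := congrArg (fun T : F →L[ℝ] F ↦ T v) hl
    have e2 : D (0, v) = v := congrArg (fun T : F →L[ℝ] F ↦ T v) hr
    calc D (v, v) = D ((v, 0) + (0, v)) := by simp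
      _ = v + v := by rw [map_add, e1, e2]
  have hmc : ContinuousAt (fun v : F ↦ m (v, v)) 0 :=
    ContinuousAt.comp (f := fun v : F ↦ (v, v)) hm.continuousAt (by fun_prop)
  refine ⟨ψ, h1, hψ1, hT.and (Filter.Eventually.and ?_ ?_)⟩
  · refine hmc.eventually (ψ.open_source.mem_nhds ?_)
    change m 0 ∈ _
    rwa [hm0]
  · have e1 := (hasFDerivAt_iff_isLittleO.1 hdiag).def (c := 1 / 2) (by norm_num)
    filter_upwards [e1] with v hv
    have e2 : ψ (m (0, 0)) = 0 := by
      change ψ (m 0) = 0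
      rw [hm0, hψ1]
    simpa [e2, hDv, m] using hv

/-- No element of the compact shell `ε / 3 ≤ ‖v‖ ≤ ε` fixes `x`, hence none fixes a nearby `y`. A
small nontrivial element fixing `y` could be squared repeatedly until it enters the shell. -/
theorem eventually_eq_one_of_smul_eq_at (F : Type*) [NormedAddCommGroup F] [NormedSpace ℝ F]
    [FiniteDimensional ℝ F] {M : Type*} [TopologicalSpace M] [T2Space M] {G : Type*} [Group G]
    [TopologicalSpace G] [ChartedSpace F G] [LieGroup 𝓘(ℝ, F) ∞ G] [T2Space G] [MulAction G M]
    [ContinuousSMul G M] (hfree : ∀ x : M, Finite (MulAction.stabilizer G x)) (x : M) :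
    ∀ᶠ z : G × M in 𝓝 (1, x), z.1 • z.2 = z.2 → z.1 = 1 := by
  obtain ⟨ψ, h1, hψ1, hsq⟩ := LieGroup.exists_chart_sq F G
  have h0 : (0 : F) ∈ ψ.target := hψ1 ▸ ψ.map_source h1
  have hψ0 : ψ.symm 0 = 1 := by rw [← hψ1, ψ.left_inv h1]
  have hx : ∀ᶠ v in 𝓝 (0 : F), ψ.symm v • x = x → ψ.symm v = 1 := by
    have hfin : ({g : G | g • x = x} \ {1}).Finite :=
      (Set.toFinite (MulAction.stabilizer G x : Set G)).subset fun g hg ↦ hg.1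
    have e1 : ({g : G | g • x = x} \ {1})ᶜ ∈ 𝓝 (ψ.symm 0) := by
      rw [hψ0]
      exact hfin.isClosed.isOpen_compl.mem_nhds fun h ↦ h.2 rfl
    filter_upwards [(ψ.continuousAt_symm h0).eventually e1] with v hv hvx
    by_contra hne
    exact hv ⟨hvx, hne⟩
  obtain ⟨ε, hε, hball⟩ := Metric.nhds_basis_closedBall.eventually_iff.1 (hsq.and hx)
  -- Squaring multiplies the norm by a factor between `3 / 2` and `5 / 2`; as `5 / 2 < 3`, it cannot
  -- jump from below `ε / 3` to beyond `ε`.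
  let S : Set F := Metric.closedBall 0 ε ∩ {v | ε / 3 ≤ ‖v‖}
  have hS : IsCompact S := (isCompact_closedBall 0 ε).inter_right
    (isClosed_le continuous_const continuous_norm)
  have hST : S ⊆ ψ.target := fun v hv ↦ (hball hv.1).1.1
  have hC : IsCompact (ψ.symm '' S) := hS.image_of_continuousOn (ψ.continuousOn_symm.mono hST)
  have hCx : ∀ᶠ y in 𝓝 x, ∀ g ∈ ψ.symm '' S, g • y ≠ y := by
    refine hC.eventually_forall_of_forall_eventually (P := fun y g ↦ g • y ≠ y) ?_
    rintro _ ⟨v, hv, rfl⟩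
    have ho : IsOpen {z : M × G | z.2 • z.1 ≠ z.1} :=
      isOpen_ne_fun (continuous_snd.smul continuous_fst) continuous_fst
    refine ho.mem_nhds fun h ↦ ?_
    have e1 := (hball hv.1).2 h
    have e2 : v = 0 := by
      rw [← ψ.right_inv (hST hv), e1, hψ1]
    have e3 : ε / 3 ≤ ‖v‖ := hv.2
    rw [e2, norm_zero] at e3
    linarith
  have hV : ∀ᶠ g in 𝓝 (1 : G), g ∈ ψ.source ∧ ‖ψ g‖ ≤ ε := by
    refine Filter.Eventually.and (ψ.open_source.mem_nhds h1) ?_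
    have e1 : Filter.Tendsto (fun g ↦ ‖ψ g‖) (𝓝 1) (𝓝 0) := by
      have := (ψ.continuousAt h1).norm.tendsto
      rwa [hψ1, norm_zero] at this
    exact (e1.eventually (gt_mem_nhds hε)).mono fun g hg ↦ hg.le
  rw [nhds_prod_eq]
  filter_upwards [hV.prod_mk hCx] with ⟨g, y⟩ ⟨⟨hg1, hg2⟩, hy⟩ hgy
  by_contra hne
  have := hfree y
  let B : Set G := {k | k • y = y ∧ k ≠ 1 ∧ k ∈ ψ.source ∧ ‖ψ k‖ ≤ ε}
  have hB : B.Finite := (Set.toFinite (MulAction.stabilizer G y : Set G)).subset fun k hk ↦ hk.1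
  -- Finiteness of the stabilizer replaces iterated squaring: a nontrivial element of maximal norm
  -- must already lie in the shell.
  obtain ⟨k, ⟨hk1, hk2, hk3, hk4⟩, hmax⟩ := hB.exists_maximalFor (fun k ↦ ‖ψ k‖) B
    ⟨g, hgy, hne, hg1, hg2⟩
  have hkb : ψ k ∈ Metric.closedBall (0 : F) ε := by simpa using hk4
  obtain ⟨⟨-, e2, e3⟩, -⟩ := hball hkb
  rw [ψ.left_inv hk3] at e2 e3
  have hpos : 0 < ‖ψ k‖ := norm_pos_iff.2 fun h ↦ hk2 (ψ.injOn hk3 h1 (h.trans hψ1.symm))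
  have h2 : ‖ψ k + ψ k‖ = 2 * ‖ψ k‖ := by
    rw [← two_smul ℝ, norm_smul]
    simp
  have h3 : ‖ψ (k * k)‖ ≤ 5 / 2 * ‖ψ k‖ := by
    have := norm_sub_norm_le (ψ (k * k)) (ψ k + ψ k)
    linarith
  have h4 : 3 / 2 * ‖ψ k‖ ≤ ‖ψ (k * k)‖ := by
    have := norm_sub_norm_le (ψ k + ψ k) (ψ (k * k))
    rw [norm_sub_rev] at this
    linarith
  by_cases hlt : ‖ψ k‖ < ε / 3
  · have hkB : k * k ∈ B := by
      refine ⟨by rw [mul_smul, hk1, hk1], fun h ↦ ?_, e2, by linarith⟩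
      rw [h, hψ1, norm_zero] at h4
      linarith
    have := hmax hkB (by simp only; linarith)
    simp only at this
    linarith
  · refine hy k ⟨ψ k, ⟨hkb, not_lt.1 hlt⟩, ψ.left_inv hk3⟩ hk1

theorem eventually_eq_one_of_smul_eq (F : Type*) [NormedAddCommGroup F] [NormedSpace ℝ F]
    [FiniteDimensional ℝ F] {M : Type*} [TopologicalSpace M] [T2Space M] [CompactSpace M] {G : Type*} [Group G]
    [TopologicalSpace G] [ChartedSpace F G] [LieGroup 𝓘(ℝ, F) ∞ G] [T2Space G] [MulAction G M]
    [ContinuousSMul G M]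
    (hfree : ∀ x : M, Finite (MulAction.stabilizer G x)) :
    ∀ᶠ g in 𝓝 (1 : G), ∀ y : M, g • y = y → g = 1 := by
  have := isCompact_univ.eventually_forall_of_forall_eventually (x₀ := (1 : G))
    (P := fun g (y : M) ↦ g • y = y → g = 1)
    fun y _ ↦ eventually_eq_one_of_smul_eq_at F hfree y
  simpa using this

/-! ## Finiteness of the set of conjugacy classes of homomorphisms with a fixed point -/

/-- The kernel of `ρ` has finite index, so it is finitely generated. A nearby `ρ'` sends the
generators near `1`; having a fixed point, it kills them and factors through the finite image of
`ρ`, where rigidity applies. -/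
theorem eventually_conj_of_fixedSet (F : Type*) [NormedAddCommGroup F] [NormedSpace ℝ F]
    [FiniteDimensional ℝ F] {M : Type*} [TopologicalSpace M] [T2Space M] [CompactSpace M]
    {G : Type*} [Group G] [TopologicalSpace G] [ChartedSpace F G] [LieGroup 𝓘(ℝ, F) ∞ G]
    [T2Space G] [MulAction G M] [ContinuousSMul G M] {L : Type*} [Group L] [Group.FG L]
    (hfree : ∀ x : M, Finite (MulAction.stabilizer G x)) (ρ : L →* G) (hρ : Nonempty (fixedSet M ρ)) :
    ∀ᶠ f in 𝓝 (ρ : L → G), ∀ ρ' : L →* G, ⇑ρ' = f → Nonempty (fixedSet M ρ') →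
      ∃ g : G, ∀ l, ρ' l = g * ρ l * g⁻¹ := by
  have : Finite ρ.range := finite_range_of_fixedSet hfree ρ hρ
  have : Finite (L ⧸ ρ.ker) := .of_equiv _ (QuotientGroup.quotientKerEquivRange ρ).symm.toEquiv
  have : ρ.ker.FiniteIndex := Subgroup.finiteIndex_of_finite_quotient
  have : Group.FG ρ.ker := inferInstance
  obtain ⟨S, hS⟩ := (Group.fg_iff_subgroup_fg _).1 this
  let s : ρ.range → L := Function.surjInv ρ.rangeRestrict_surjective
  have hs : Function.RightInverse s ρ.rangeRestrict :=
    Function.rightInverse_surjInv ρ.rangeRestrict_surjective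
  have h1 : ∀ᶠ f in 𝓝 (ρ : L → G), ∀ k : S, ∀ y : M, f k • y = y → f k = 1 := by
    refine Filter.eventually_all.2 fun k ↦ ?_
    have h2 : Filter.Tendsto (fun f : L → G ↦ f k) (𝓝 ρ) (𝓝 1) := by
      have h3 : ρ k = 1 := by
        have : (k : L) ∈ ρ.ker := hS ▸ Subgroup.subset_closure k.2
        exact this
      rw [← h3]
      exact (continuous_apply (k : L)).tendsto _
    exact h2.eventually (eventually_eq_one_of_smul_eq F hfree)
  have h4 : Filter.Tendsto (fun (f : L → G) (a : ρ.range) ↦ f (s a)) (𝓝 ρ) (𝓝 (↑)) := by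
    have h5 : (fun a : ρ.range ↦ ρ (s a)) = (↑) := funext fun a ↦ congrArg Subtype.val (hs a)
    rw [← h5]
    exact (continuous_pi fun a ↦ continuous_apply (s a)).tendsto _
  filter_upwards [h1, h4.eventually (Subgroup.eventually_conj_of_finite F ρ.range)]
    with f hf1 hf2 ρ' hρ' ⟨y⟩
  subst hρ'
  have hker : ρ.rangeRestrict.ker ≤ ρ'.ker := by
    rw [MonoidHom.ker_rangeRestrict, ← hS, Subgroup.closure_le]
    exact fun k hk ↦ hf1 ⟨k, hk⟩ y.1 (y.2 k)
  let σ : ρ.range →* G := ρ.rangeRestrict.liftOfRightInverse s hs ⟨ρ', hker⟩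
  have hσ : ∀ l, σ (ρ.rangeRestrict l) = ρ' l := fun l ↦
    MonoidHom.liftOfRightInverse_comp_apply _ _ hs ⟨ρ', hker⟩ l
  obtain ⟨g, hg⟩ := hf2 σ (funext fun a ↦ by rw [← hσ, hs])
  exact ⟨g, fun l ↦ by rw [← hσ, hg]; rfl⟩

/-- The pairs of a homomorphism and a common fixed point form a closed subset of the compact space
`G^L × M`. Its projection to `G^L` is compact and covered by neighbourhoods on which the conjugacy
class is constant. -/
theorem exists_finite_conj_representatives (F : Type*) [NormedAddCommGroup F] [NormedSpace ℝ F]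
    [FiniteDimensional ℝ F] {M : Type*} [TopologicalSpace M] [T2Space M] [CompactSpace M]
    {G : Type*} [Group G] [TopologicalSpace G] [ChartedSpace F G] [LieGroup 𝓘(ℝ, F) ∞ G]
    [T2Space G] [MulAction G M] [ContinuousSMul G M] [CompactSpace G] {L : Type*} [Group L]
    [Group.FG L] (hfree : ∀ x : M, Finite (MulAction.stabilizer G x)) :
    ∃ T : Set (L →* G), T.Finite ∧ ∀ ρ : L →* G, Nonempty (fixedSet M ρ) →
      ∃ ρ₀ ∈ T, ∃ g : G, ∀ l, ρ l = g * ρ₀ l * g⁻¹ := by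
  have : IsTopologicalGroup G := topologicalGroup_of_lieGroup 𝓘(ℝ, F) ∞
  let Z : Set ((L → G) × M) := {p | (∀ a b, p.1 (a * b) = p.1 a * p.1 b) ∧ ∀ l, p.1 l • p.2 = p.2}
  have hZ : IsClosed Z := by
    have e1 : Z = (⋂ (a) (b), {p : (L → G) × M | p.1 (a * b) = p.1 a * p.1 b}) ∩
        ⋂ l, {p : (L → G) × M | p.1 l • p.2 = p.2} := by
      ext p
      simp [Z]
    rw [e1]
    refine (isClosed_iInter fun a ↦ isClosed_iInter fun b ↦ ?_).inter (isClosed_iInter fun l ↦ ?_)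
    · exact isClosed_eq (by fun_prop) (by fun_prop)
    · exact isClosed_eq (((continuous_apply l).comp continuous_fst).smul continuous_snd)
        continuous_snd
  have hK : IsCompact (Prod.fst '' Z) := hZ.isCompact.image continuous_fst
  have hom : ∀ f ∈ Prod.fst '' Z, ∃ ρ : L →* G, ⇑ρ = f ∧ Nonempty (fixedSet M ρ) := by
    rintro _ ⟨p, hp, rfl⟩
    exact ⟨MonoidHom.mk' p.1 hp.1, rfl, ⟨p.2, hp.2⟩⟩
  choose! r hr1 hr2 using hom
  have hnhds : ∀ f ∈ Prod.fst '' Z, {f' | ∀ ρ' : L →* G, ⇑ρ' = f' → Nonempty (fixedSet M ρ') →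
      ∃ g : G, ∀ l, ρ' l = g * r f l * g⁻¹} ∈ 𝓝 f := fun f hf ↦ by
    rw [show 𝓝 f = 𝓝 (r f : L → G) by rw [hr1 f hf]]
    exact eventually_conj_of_fixedSet F hfree (r f) (hr2 f hf)
  obtain ⟨t, -, ht⟩ := hK.elim_nhds_subcover _ hnhds
  refine ⟨r '' t, t.finite_toSet.image _, fun ρ hρ ↦ ?_⟩
  obtain ⟨x⟩ := id hρ
  have hmem : (ρ : L → G) ∈ Prod.fst '' Z := ⟨(ρ, x.1), ⟨map_mul ρ, x.2⟩, rfl⟩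
  obtain ⟨f, hf, hf'⟩ := Set.mem_iUnion₂.1 (ht hmem)
  exact ⟨r f, ⟨f, hf, rfl⟩, hf' ρ rfl hρ⟩

theorem TwistClass.finite_setOf_nonempty_fixedSet (F : Type*) [NormedAddCommGroup F]
    [NormedSpace ℝ F] [FiniteDimensional ℝ F] {M : Type*} [TopologicalSpace M] [T2Space M]
    [CompactSpace M] {G : Type u} [Group G] [TopologicalSpace G] [ChartedSpace F G]
    [LieGroup 𝓘(ℝ, F) ∞ G] [T2Space G] [CompactSpace G] [MulAction G M] [ContinuousSMul G M]
    (hfree : ∀ x : M, Finite (MulAction.stabilizer G x)) {Γ : Type u} [Group Γ] [Group.FG Γ]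
    (H : Subgroup Γ) [H.FiniteIndex] :
    {τ : TwistClass H G | Nonempty (fixedSet M τ.out)}.Finite := by
  obtain ⟨T, hT, h⟩ := exists_finite_conj_representatives (M := M) (G := G) (L := H) F hfree
  refine (hT.image (Quotient.mk (twistSetoid H G))).subset fun τ hτ ↦ ?_
  obtain ⟨ρ₀, hρ₀, g, hg⟩ := h τ.out hτ
  refine ⟨ρ₀, hρ₀, ?_⟩
  conv_rhs => rw [← Quotient.out_eq τ]
  -- Conjugation by `G` is the part of the twisting action with trivial normalizer coordinate.
  refine Quotient.sound ⟨(1, g⁻¹), MonoidHom.ext fun k ↦ ?_⟩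
  rw [twist_apply, hg, inv_inv]
  congr 3
  exact Subtype.ext (by simp)

/-! ### The theorem for smooth locally free actions -/

theorem mainTheorem5
    {E : Type*} [NormedAddCommGroup E] [NormedSpace ℝ E] [FiniteDimensional ℝ E]
    {F : Type*} [NormedAddCommGroup F] [NormedSpace ℝ F] [FiniteDimensional ℝ F]
    (M : Type u) [TopologicalSpace M] [ChartedSpace E M] [IsManifold 𝓘(ℝ, E) ∞ M]
    [T2Space M] [CompactSpace M]
    (G : Type u) [Group G] [TopologicalSpace G] [ChartedSpace F G] [LieGroup 𝓘(ℝ, F) ∞ G]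
    [T2Space G] [CompactSpace G] [ConnectedSpace G]
    [MulAction G M] [ContMDiffSMul 𝓘(ℝ, F) 𝓘(ℝ, E) ∞ G M]
    (hfree : ∀ x : M, Finite (MulAction.stabilizer G x))
    (Γ : Type u) [Group Γ] [Group.FG Γ]
    {R : Type v} [CommRing R] (φ : MultiplicativeOrbifoldInvariant.{u} R) :
    letI : DiffeologicalSpace M := manifoldDiffeology E M
    letI : DiffeologicalSpace G := manifoldDiffeology F G
    haveI : DiffGroup G := diffGroup_of_lieGroup F G
    haveI : DiffAction G M := diffAction_of_contMDiffSMul F E G M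
    letI : TopologicalSpace R := ⊥
    (∀ n : ℕ, (Function.support (φ.sectorTerm Γ (Wreath G n) (Fin n → M))).Finite) ∧
    HasProd
      (fun c : FiniteIndexClass Γ ↦
        dilatedSeries c.out.1.index (fun r ↦ φ.setExtension Γ (copies r c.out.1) G M))
      (PowerSeries.mk fun n ↦ φ.extension Γ (Wreath G n) (Fin n → M)) ∧
    ∀ H : Subgroup Γ, H.FiniteIndex →
      HasProd
        (fun c : TwistClass H G ↦ PowerSeries.mk fun r ↦
          φ.eval (translationGroupoid (Wreath (BundleAut c.out) r) (Fin r → fixedSet M c.out)))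
        (PowerSeries.mk fun n ↦ φ.setExtension Γ (copies n H) G M) := by
  let _ : DiffeologicalSpace M := manifoldDiffeology E M
  let _ : DiffeologicalSpace G := manifoldDiffeology F G
  have : DiffGroup G := diffGroup_of_lieGroup F G
  have : DiffAction G M := diffAction_of_contMDiffSMul F E G M
  have : ContinuousSMul G M :=
    ⟨(ContMDiffSMul.contMDiff_smul (I := 𝓘(ℝ, F)) (I' := 𝓘(ℝ, E)) (n := ∞)).continuous⟩
  have hρ : ∀ H : Subgroup Γ, H.FiniteIndex → ∀ ρ : H →* G, Nonempty (fixedSet M ρ) →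
      CompactLocallyFree (BundleAut ρ) (fixedSet M ρ) := by
    intro H hH ρ h
    -- A common fixed point puts the image of `ρ` inside a finite isotropy group, which makes the
    -- fixed set and the centralizer accessible to linearization.
    have : Finite ρ.range := finite_range_of_fixedSet hfree ρ h
    exact BundleAut.compactLocallyFree ρ hfree (isCompactManifold_homCentralizer F ρ)
      (isCompactManifold_fixedSet E F M ρ)
  have hτ : ∀ H : Subgroup Γ, H.FiniteIndex →
      {τ : TwistClass H G | Nonempty (fixedSet M τ.out)}.Finite := fun H _ ↦
    TwistClass.finite_setOf_nonempty_fixedSet F hfree H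
  have hΓ : ∀ n, {c : FiniteIndexClass Γ | c.out.1.index ≤ n}.Finite :=
    FiniteIndexClass.finite_setOf_index_le Γ
  exact ⟨fun n ↦ finite_support_sectorTerm φ hρ hτ hΓ n, product_formulas φ hρ hτ hΓ⟩
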